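/- **Setting.** Let $\lambda_k>0$ and $C_{kk,0}\ge 0$ ($k\ge 1$) be real sequences with $\sum_k\lambda_kC_{kk,0}<\infty$ (the eigenvalues of the Hessian and the initial second moments), let $\lambda_{\max}=\sup_k\lambda_k$, and let $\tau\in(0,1]$. For parameters $\alpha,\beta,\gamma$ (learning rate, momentum, noise level) and $\lambda>0$ define the linear operator $A_\lambda$ on real $2\times 2$ matrices by $$A_\lambda M=\begin{pmatrix}1-\alpha\lambda&\beta\\-\alpha\lambda&\beta\end{pmatrix}M\begin{pmatrix}1-\alpha\lambda&\beta\\-\alpha\lambda&\beta\end{pmatrix}^{T}-\tau\gamma\alpha^2\lambda^2\begin{pmatrix}1&0\\1&0\end{pmatrix}M\begin{pmatrix}1&0\\1&0\end{pmatrix}^{T}.$$ The diagonal second moments $M_{k,t}=\begin{pmatrix}C_{kk,t}&J_{kk,t}\\J_{kk,t}&V_{kk,t}\end{pmatrix}$ of mini-batch SGD under the spectrally expressible approximation (with $\tau_1=1$, $\tau_2=\tau$) start at $M_{k,0}=\begin{pmatrix}C_{kk,0}&0\\0&0\end{pmatrix}$ and evolve by $$M_{k,t+1}=A_{\lambda_k}M_{k,t}+\gamma\alpha^2\lambda_k\Big(\sum_l\lambda_lC_{ll,t}\Big)\begin{pmatrix}1&1\\1&1\end{pmatrix},$$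 and the average loss is $L(t)=\frac12\sum_k\lambda_kC_{kk,t}$. The noise and signal generating functions are $$\widetilde U(z)=\gamma\alpha^2\sum_k\lambda_k^2\Big[(1-zA_{\lambda_k})^{-1}\begin{pmatrix}1&1\\1&1\end{pmatrix}\Big]_{11},\qquad \widetilde V(z)=\sum_k\lambda_kC_{kk,0}\Big[(1-zA_{\lambda_k})^{-1}\begin{pmatrix}1&0\\0&0\end{pmatrix}\Big]_{11}.$$ **Theorem.** Let $\beta\in(-1,1)$, $0<\alpha<2(\beta+1)/\lambda_{\max}$, $\gamma\in[0,1]$. Assume that as $k\to\infty$ $$\lambda_k=\Lambda k^{-\nu}(1+o(1)),\qquad \sum_{l\ge k}\lambda_lC_{ll,0}=Kk^{-\varkappa}(1+o(1))$$ with constants $\Lambda,K>0$, $\nu>1$, $\varkappa>0$; set $\zeta=\varkappa/\nu$. Assume also $\widetilde U(1)<1$. Then, as $T\to\infty$: 1. (signal-dominated phase) if $2-\zeta>1/\nu$, then $$\sum_{t=1}^TtL(t)=(1+o(1))\,\frac{K\,\Gamma(\zeta+1)}{2(1-\widetilde U(1))(2-\zeta)}\Big(\frac{2\alpha\Lambda}{1-\beta}\Big)^{-\zeta}T^{2-\zeta};$$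 2. (noise-dominated phase) if $2-\zeta<1/\nu$ and $\gamma>0$, then $$\sum_{t=1}^TtL(t)=(1+o(1))\,\frac{\gamma\,\widetilde V(1)\,\Gamma(2-1/\nu)}{8(1-\widetilde U(1))^2}\Big(\frac{2\alpha\Lambda}{1-\beta}\Big)^{1/\nu}T^{1/\nu};$$ if $2-\zeta<1/\nu$ and $\gamma=0$, then $\sum_{t=1}^TtL(t)=o(T^{1/\nu})$. -/

import Mathlib

open Filter Topology Asymptotics

noncomputable section

namespace SESGD

/-- Real `2 × 2` matrices, holding the second moments `(C J; J V)` of (parameter deviation,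
momentum) along one eigendirection of the Hessian. -/
abbrev Mat2 : Type := Matrix (Fin 2) (Fin 2) ℝ

/-- The matrix `(1 - α l, β; -α l, β)` of one noiseless heavy-ball step at the eigenvalue `l`. -/
def stepMatrix (α β l : ℝ) : Mat2 := !![1 - α * l, β; -(α * l), β]

/-- The matrix `(1, 0; 1, 0)`. -/
def leftOnes : Mat2 := !![1, 0; 1, 0]

/-- The matrix `(1, 1; 1, 1)`. -/
def allOnes : Mat2 := !![1, 1; 1, 1]

/-- The matrix `(1, 0; 0, 0)`. -/
def unit11 : Mat2 := !![1, 0; 0, 0]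

/-- The main term `A_l` of the evolution of second moments at the eigenvalue `l`:
`A_l M = B M Bᵀ - τ γ α² l² E M Eᵀ` with `B = (1 - α l, β; -α l, β)` and `E = (1, 0; 1, 0)`. -/
def mainOp (α β γ τ l : ℝ) : Mat2 →ₗ[ℝ] Mat2 :=
  LinearMap.mulLeft ℝ (stepMatrix α β l) ∘ₗ LinearMap.mulRight ℝ (stepMatrix α β l).transpose
    - (τ * γ * α ^ 2 * l ^ 2) •
      (LinearMap.mulLeft ℝ leftOnes ∘ₗ LinearMap.mulRight ℝ leftOnes.transpose)

/-- The noise term, of rank one on sequences of `2 × 2` matrices indexed by the eigenvalues: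
`(Q M)_k = γ α² λ_k (∑_l λ_l (M_l)₁₁) (1, 1; 1, 1)`. -/
def noiseOp (α γ : ℝ) (lam : ℕ → ℝ) (M : ℕ → Mat2) (k : ℕ) : Mat2 :=
  (γ * α ^ 2 * lam k * ∑' l, lam l * M l 0 0) • allOnes

/-- The (diagonal) second moments at time `t` of SGD with constant learning rate `α`, momentum `β`
and noise parameter `γ`, under the spectrally expressible approximation with parameters
`τ₁ = 1, τ₂ = τ`: the matrix at index `k` is `(C_{kk,t}, J_{kk,t}; J_{kk,t}, V_{kk,t})`.
The Hessian eigenvalues and the initial moments `C_{kk,0}` are `lam k` and `c k`; the initial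
momentum is zero. Indices start at `0`, so `lam k` is the `(k+1)`-st eigenvalue. -/
def moments (α β γ τ : ℝ) (lam c : ℕ → ℝ) : ℕ → ℕ → Mat2
  | 0 => fun k => c k • unit11
  | t + 1 => fun k =>
      mainOp α β γ τ (lam k) (moments α β γ τ lam c t k)
        + noiseOp α γ lam (moments α β γ τ lam c t) k

/-- The average loss `L(t) = (1/2) Tr(H C_t) = (1/2) ∑_k λ_k C_{kk,t}`. -/
def loss (α β γ τ : ℝ) (lam c : ℕ → ℝ) (t : ℕ) : ℝ :=
  (1 / 2) * ∑' k, lam k * moments α β γ τ lam c t k 0 0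

/-- The entry `⟨(1, 0; 0, 0), (1 - z A_l)⁻¹ M⟩` of the resolvent of the main term. -/
def resolventEntry (α β γ τ l z : ℝ) (M : Mat2) : ℝ :=
  (Ring.inverse (1 - z • mainOp α β γ τ l : Module.End ℝ Mat2)) M 0 0

/-- The noise generating function
`Ũ(z) = γ α² ⟨(λ, 0; 0, 0), (1 - z A)⁻¹ λ (1, 1; 1, 1)⟩`.
The resolvent continues the power series `∑_t U_{t+1} z^t` up to `z = 1`, where
the power series itself may diverge. -/
def noiseGen (α β γ τ : ℝ) (lam : ℕ → ℝ) (z : ℝ) : ℝ :=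
  γ * α ^ 2 * ∑' k, lam k ^ 2 * resolventEntry α β γ τ (lam k) z allOnes

/-- The signal generating function
`Ṽ(z) = ⟨(λ, 0; 0, 0), (1 - z A)⁻¹ (C₀, 0; 0, 0)⟩`. -/
def signalGen (α β γ τ : ℝ) (lam c : ℕ → ℝ) (z : ℝ) : ℝ :=
  ∑' k, lam k * c k * resolventEntry α β γ τ (lam k) z unit11

end SESGD

end

/-! The eigendirections are coupled only through the scalar energy E_t = ∑ λ_l C_{ll,t} = 2 L(t), so
generating functions reduce the dynamics to a scalar renewal equation E(z) (1 - G(z)) = F(z), with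
F(z) = Ṽ(z) and G(z) = z Ũ(z). In one direction, with a = α λ_k, the (1,1) entry of the resolvent is
an explicit linear functional divided by an explicit polynomial D(a, z) (`resNum`, `resDenom`,
linked by `resNum_sub_smul`). The functional is nonnegative on positive semidefinite matrices, and
the moments remain positive semidefinite because τ ≤ 1. Remainders of the truncated series therefore
have a sign, which forces convergence; they then tend to zero, and the renewal equation follows
(`IsStable.renewal`).

The value G(1) = Ũ(1) is finite, and so is F(1) when ζ > 1. The singularity at z = 1 must then be
sought in the derivatives, and the weight t supplies them: ∑ t E_t z^t = z (F' (1 - G) + F G') / (1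
- G)². Put δ = 1 - z. As a and δ tend to 0, D behaves like (1-β)² (1+β) (δ + 2a/(1-β)), so F' and G'
behave like sums of weights over (δ + B k^(-ν))² with B = 2αΛ/(1-β). A weight with tail K k^(-κ)
gives K B^(-ζ) Γ(ζ+1) Γ(2-ζ) δ^(ζ-2), where ζ = κ/ν (`tendsto_stieltjes`, transferred to the true
terms by `tendsto_tsum_of_singularity`). For F' the weight is λ_k C_{kk,0}. For G' it is (α λ_k)²,
up to the factor γ, with tail exponent 2ν - 1 and hence order δ^(-1/ν).

The two phases record which product dominates. If 2 - ζ > 1/ν, then F G' is negligible against F'.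
If 2 - ζ < 1/ν, then ζ > 1 because 1/ν < 1, so F tends to Ṽ(1), and F' is negligible at the scale
δ^(-1/ν). Since t L(t) ≥ 0, Karamata's theorem (`tendsto_partialSum_of_tendsto_powerSeries`) turns
the behaviour at z = 1 into that of the partial sums. -/

namespace SESGD

/-! ### Karamata's Tauberian theorem -/

open MeasureTheory Set

/-- The Gamma weight `x ^ (ρ - 1) * exp (-x)` on the positive half-line, tested against
`x ↦ g (exp (-x))`. -/
noncomputable def gammaMean (ρ : ℝ) (g : ℝ → ℝ) : ℝ :=
  ∫ x in Ioi (0 : ℝ), Real.exp (-x) * x ^ (ρ - 1) * g (Real.exp (-x))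

/-- The Abel means `s ^ ρ * ∑ b t * exp (-t s)`, tested against `g (exp (-t s))`. -/
noncomputable def abelMean (b : ℕ → ℝ) (ρ : ℝ) (g : ℝ → ℝ) (s : ℝ) : ℝ :=
  s ^ ρ * ∑' t : ℕ, b t * Real.exp (-s) ^ t * g (Real.exp (-s) ^ t)

theorem exp_neg_pow_mem {s : ℝ} (hs : 0 < s) (t : ℕ) : Real.exp (-s) ^ t ∈ Icc (0 : ℝ) 1 :=
  ⟨by positivity, pow_le_one₀ (Real.exp_pos _).le (Real.exp_le_one_iff.2 (by linarith))⟩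

theorem integrableOn_gammaMean {ρ : ℝ} (hρ : 0 < ρ) {g : ℝ → ℝ} (hg : Continuous g) :
    IntegrableOn (fun x => Real.exp (-x) * x ^ (ρ - 1) * g (Real.exp (-x))) (Ioi 0) := by
  obtain ⟨A, hA⟩ := isCompact_Icc.exists_bound_of_continuousOn (s := Icc (0 : ℝ) 1) hg.continuousOn
  refine Integrable.mul_bdd (c := A) (Real.GammaIntegral_convergent hρ)
    (by fun_prop : Continuous fun x => g (Real.exp (-x))).aestronglyMeasurable ?_
  refine (ae_restrict_iff' measurableSet_Ioi).2 (ae_of_all _ fun x hx => hA _ ?_)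
  exact ⟨(Real.exp_pos _).le, Real.exp_le_one_iff.2 (by simpa using (le_of_lt hx))⟩

theorem summable_abelMean {b : ℕ → ℝ} {s : ℝ} (hs : 0 < s)
    (hb : Summable fun t : ℕ => b t * Real.exp (-s) ^ t) {g : ℝ → ℝ} (hg : Continuous g) :
    Summable fun t : ℕ => b t * Real.exp (-s) ^ t * g (Real.exp (-s) ^ t) := by
  obtain ⟨A, hA⟩ := isCompact_Icc.exists_bound_of_continuousOn (s := Icc (0 : ℝ) 1) hg.continuousOn
  refine Summable.of_norm_bounded (g := fun t => ‖b t * Real.exp (-s) ^ t‖ * A)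
    (hb.norm.mul_right A) fun t => ?_
  rw [norm_mul]
  exact mul_le_mul_of_nonneg_left (hA _ (exp_neg_pow_mem hs t)) (norm_nonneg _)

theorem gammaMean_pow {ρ : ℝ} (hρ : 0 < ρ) (n : ℕ) :
    gammaMean ρ (fun u => u ^ n) = ((n : ℝ) + 1) ^ (-ρ) * Real.Gamma ρ := by
  have h := Real.integral_rpow_mul_exp_neg_mul_Ioi hρ (by positivity : (0 : ℝ) < n + 1)
  rw [one_div, Real.inv_rpow (by positivity), ← Real.rpow_neg (by positivity)] at h
  rw [gammaMean, ← h]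
  refine setIntegral_congr_fun measurableSet_Ioi fun x _ => ?_
  rw [← Real.exp_nat_mul, mul_comm (Real.exp (-x)), mul_assoc, ← Real.exp_add]
  congr 2; ring

/-- Testing against u^n amounts to replacing s by (n+1) s, which costs a factor (n+1)^(-ρ); the
Gamma integral rescales in the same way. -/
theorem tendsto_abelMean_pow {b : ℕ → ℝ} {ρ C : ℝ} (hρ : 0 < ρ)
    (h : Tendsto (abelMean b ρ fun _ => 1) (𝓝[>] 0) (𝓝 C)) (n : ℕ) :
    Tendsto (abelMean b ρ fun u => u ^ n) (𝓝[>] 0)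
      (𝓝 (C / Real.Gamma ρ * gammaMean ρ fun u => u ^ n)) := by
  have h1 : Tendsto (fun s : ℝ => ((n : ℝ) + 1) * s) (𝓝[>] 0) (𝓝[>] 0) := by
    refine tendsto_nhdsWithin_iff.2 ⟨?_, ?_⟩
    · have : Tendsto (fun s : ℝ => ((n : ℝ) + 1) * s) (𝓝 0) (𝓝 (((n : ℝ) + 1) * 0)) :=
        (by fun_prop : Continuous fun s : ℝ => ((n : ℝ) + 1) * s).tendsto 0
      rw [mul_zero] at this
      exact this.mono_left nhdsWithin_le_nhds
    · filter_upwards [self_mem_nhdsWithin] with s hs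
      exact mul_pos (by positivity : (0 : ℝ) < (n : ℝ) + 1) hs
  have hn : (0 : ℝ) < (n : ℝ) + 1 := by positivity
  have h2 := (h.comp h1).const_mul (((n : ℝ) + 1) ^ (-ρ))
  have hΓ := (Real.Gamma_pos_of_pos hρ).ne'
  rw [gammaMean_pow hρ, show C / Real.Gamma ρ * (((n : ℝ) + 1) ^ (-ρ) * Real.Gamma ρ)
    = ((n : ℝ) + 1) ^ (-ρ) * C by field_simp]
  refine h2.congr' ?_
  filter_upwards [self_mem_nhdsWithin] with s hs
  have hs : 0 < s := hs
  simp only [Function.comp, abelMean, mul_one]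
  rw [Real.mul_rpow (by positivity) hs.le, ← mul_assoc, ← mul_assoc, ← Real.rpow_add hn]
  simp only [neg_add_cancel, Real.rpow_zero, one_mul]
  congr 1
  refine tsum_congr fun t => ?_
  rw [mul_assoc, ← pow_succ', ← Real.exp_nat_mul, ← Real.exp_nat_mul, ← Real.exp_nat_mul]
  congr 2
  push_cast; ring

theorem tendsto_abelMean_polynomial {b : ℕ → ℝ} {ρ C : ℝ} (hρ : 0 < ρ)
    (hs : ∀ s : ℝ, 0 < s → Summable fun t : ℕ => b t * Real.exp (-s) ^ t)
    (h : Tendsto (abelMean b ρ fun _ => 1) (𝓝[>] 0) (𝓝 C)) (p : Polynomial ℝ) :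
    Tendsto (abelMean b ρ p.eval) (𝓝[>] 0) (𝓝 (C / Real.Gamma ρ * gammaMean ρ p.eval)) := by
  induction p using Polynomial.induction_on' with
  | add p q hp hq =>
    have e : gammaMean ρ (p + q).eval = gammaMean ρ p.eval + gammaMean ρ q.eval := by
      unfold gammaMean
      rw [← integral_add (integrableOn_gammaMean hρ p.continuous)
        (integrableOn_gammaMean hρ q.continuous)]
      simp only [Polynomial.eval_add, mul_add]
    rw [e, mul_add]
    refine (hp.add hq).congr' ?_
    filter_upwards [self_mem_nhdsWithin] with s hs'
    simp only [abelMean]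
    rw [← mul_add, ← (summable_abelMean hs' (hs s hs') p.continuous).tsum_add
      (summable_abelMean hs' (hs s hs') q.continuous)]
    simp only [Polynomial.eval_add, mul_add]
  | monomial n a =>
    have e : gammaMean ρ (Polynomial.monomial n a).eval = a * gammaMean ρ fun u => u ^ n := by
      unfold gammaMean
      rw [← integral_const_mul]
      simp only [Polynomial.eval_monomial]
      congr 1; ext x; ring
    have := (tendsto_abelMean_pow hρ h n).const_mul a
    rw [e, mul_left_comm]
    refine this.congr fun s => ?_
    simp only [abelMean, Polynomial.eval_monomial]
    rw [mul_left_comm, ← tsum_mul_left]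
    congr 2; ext t; ring

/-- Weierstrass approximation on [0, 1]. Because b is nonnegative, a uniform error in the test
function costs at most that error times the Abel mean of the constant 1, which stays bounded. -/
theorem tendsto_abelMean {b : ℕ → ℝ} {ρ C : ℝ} (hρ : 0 < ρ) (hb : ∀ t, 0 ≤ b t)
    (hs : ∀ s : ℝ, 0 < s → Summable fun t : ℕ => b t * Real.exp (-s) ^ t)
    (h : Tendsto (abelMean b ρ fun _ => 1) (𝓝[>] 0) (𝓝 C)) {g : ℝ → ℝ} (hg : Continuous g) :
    Tendsto (abelMean b ρ g) (𝓝[>] 0) (𝓝 (C / Real.Gamma ρ * gammaMean ρ g)) := by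
  have hΓ := Real.Gamma_pos_of_pos hρ
  have hC : 0 ≤ C := by
    refine ge_of_tendsto h ?_
    filter_upwards [self_mem_nhdsWithin] with s hs'
    have : (0 : ℝ) < s := hs'
    refine mul_nonneg (by positivity) (tsum_nonneg fun t => ?_)
    have := hb t
    positivity
  rw [Metric.tendsto_nhds]
  intro ε hε
  -- The three errors are bounded by η (C + 1/2), C η and η/2; their total η (2C + 1) is below ε.
  set η := ε / (2 * C + 2) with hη
  have hη0 : 0 < η := by positivity
  obtain ⟨p, hp⟩ := exists_polynomial_near_of_continuousOn 0 1 g hg.continuousOn η hη0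
  have hI : |gammaMean ρ p.eval - gammaMean ρ g| ≤ η * Real.Gamma ρ := by
    unfold gammaMean
    rw [← integral_sub (integrableOn_gammaMean hρ p.continuous) (integrableOn_gammaMean hρ hg),
      Real.Gamma_eq_integral hρ, ← integral_const_mul, ← Real.norm_eq_abs]
    refine norm_integral_le_of_norm_le ((Real.GammaIntegral_convergent hρ).const_mul η) ?_
    refine (ae_restrict_iff' measurableSet_Ioi).2 (ae_of_all _ fun x hx => ?_)
    have hx : (0 : ℝ) < x := hx
    rw [← mul_sub, norm_mul, Real.norm_of_nonneg (by positivity), mul_comm]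
    refine mul_le_mul_of_nonneg_right ?_ (by positivity)
    exact (hp _ ⟨(Real.exp_pos _).le, Real.exp_le_one_iff.2 (by linarith)⟩).le
  have hA : ∀ s : ℝ, 0 < s → |abelMean b ρ g s - abelMean b ρ p.eval s|
      ≤ η * abelMean b ρ (fun _ => 1) s := by
    intro s hs'
    unfold abelMean
    have s1 := summable_abelMean hs' (hs s hs') p.continuous
    have s2 := summable_abelMean hs' (hs s hs') hg
    rw [← mul_sub, ← s2.tsum_sub s1, abs_mul, abs_of_nonneg (by positivity : 0 ≤ s ^ ρ),
      mul_left_comm, ← tsum_mul_left]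
    refine mul_le_mul_of_nonneg_left ?_ (by positivity)
    rw [← Real.norm_eq_abs]
    refine tsum_of_norm_bounded ((hs s hs').mul_left η |>.congr (fun t => by rw [mul_one])).hasSum
      fun t => ?_
    have := hb t
    rw [← mul_sub, norm_mul, Real.norm_of_nonneg (by positivity), mul_one, mul_comm]
    refine mul_le_mul_of_nonneg_right ?_ (by positivity)
    rw [Real.norm_eq_abs, abs_sub_comm]
    exact (hp _ (exp_neg_pow_mem hs' t)).le
  have h1 := tendsto_abelMean_polynomial hρ hs h p
  have h2 : ∀ᶠ s in 𝓝[>] (0 : ℝ), abelMean b ρ (fun _ => 1) s < C + 1 / 2 :=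
    h.eventually (gt_mem_nhds (by linarith))
  filter_upwards [self_mem_nhdsWithin, h2, (Metric.tendsto_nhds.1 h1) (η / 2) (by positivity)]
    with s s0 s1 s2
  rw [Real.dist_eq] at s2 ⊢
  have e1 := hA s s0
  have e2 : |C / Real.Gamma ρ * gammaMean ρ p.eval - C / Real.Gamma ρ * gammaMean ρ g| ≤ C * η := by
    rw [← mul_sub, abs_mul, abs_of_nonneg (by positivity : 0 ≤ C / Real.Gamma ρ)]
    calc _ ≤ C / Real.Gamma ρ * (η * Real.Gamma ρ) := by gcongr
      _ = C * η := by field_simp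
  have e3 : η * abelMean b ρ (fun _ => 1) s < η * (C + 1 / 2) := by gcongr
  have e4 : η * (2 * C + 2) = ε := by rw [hη]; field_simp
  rw [abs_lt] at s2 ⊢
  rw [abs_le] at e1 e2
  constructor <;> nlinarith

/-- A continuous function `g` such that `u * g u` lies between the indicators of `[u₁, ∞)` and
`[u₀, ∞)` on the positive half-line, for `0 < u₀ < u₁`. -/
noncomputable def cutoff (u₀ u₁ u : ℝ) : ℝ := max 0 (min 1 ((u - u₀) / (u₁ - u₀))) / max u u₀

theorem continuous_cutoff {u₀ u₁ : ℝ} (h0 : 0 < u₀) : Continuous (cutoff u₀ u₁) := by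
  unfold cutoff
  refine Continuous.div (by fun_prop) (by fun_prop) fun u => ?_
  exact (lt_of_lt_of_le h0 (le_max_right _ _)).ne'

theorem cutoff_of_le {u₀ u₁ u : ℝ} (h1 : u₀ < u₁) (h : u ≤ u₀) : cutoff u₀ u₁ u = 0 := by
  have : min 1 ((u - u₀) / (u₁ - u₀)) ≤ 0 :=
    (min_le_right _ _).trans (div_nonpos_of_nonpos_of_nonneg (by linarith) (by linarith))
  rw [cutoff, max_eq_left this, zero_div]

theorem mul_cutoff_of_ge {u₀ u₁ u : ℝ} (h0 : 0 < u₀) (h1 : u₀ < u₁) (h : u₁ ≤ u) :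
    u * cutoff u₀ u₁ u = 1 := by
  have : 1 ≤ (u - u₀) / (u₁ - u₀) := by rw [le_div_iff₀ (by linarith)]; linarith
  rw [cutoff, min_eq_left this, max_eq_left (by linarith : u₀ ≤ u), max_eq_right zero_le_one]
  field_simp [(by linarith : u ≠ 0)]

theorem mul_cutoff_mem {u₀ u₁ u : ℝ} (h0 : 0 < u₀) (hu : 0 ≤ u) :
    u * cutoff u₀ u₁ u ∈ Icc (0 : ℝ) 1 := by
  have hm : 0 < max u u₀ := lt_of_lt_of_le h0 (le_max_right _ _)
  have h2 : max 0 (min 1 ((u - u₀) / (u₁ - u₀))) ≤ 1 := max_le zero_le_one (min_le_left _ _)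
  have h3 : 0 ≤ max 0 (min 1 ((u - u₀) / (u₁ - u₀))) := le_max_left _ _
  unfold cutoff
  refine ⟨by positivity, ?_⟩
  rw [mul_div_assoc', div_le_one hm]
  nlinarith [le_max_left u u₀]

theorem integral_rpow_Ioc {ρ y : ℝ} (hρ : 0 < ρ) (hy : 0 ≤ y) :
    ∫ x in Ioc 0 y, x ^ (ρ - 1) = y ^ ρ / ρ := by
  rw [← intervalIntegral.integral_of_le hy, integral_rpow (Or.inl (by linarith))]
  simp [hρ.ne']

theorem integrableOn_rpow_Ioc {ρ y : ℝ} (hρ : 0 < ρ) (hy : 0 ≤ y) :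
    IntegrableOn (fun x : ℝ => x ^ (ρ - 1)) (Ioc 0 y) :=
  (intervalIntegrable_iff_integrableOn_Ioc_of_le hy).1
    (intervalIntegral.intervalIntegrable_rpow' (by linarith))

/-- Under u = exp (-t) the thresholds become t ≤ y and t ≤ x. The factor u of the cutoff cancels the
exponential weight, leaving t^(ρ-1) to integrate. -/
theorem gammaMean_cutoff_mem {ρ y x : ℝ} (hρ : 0 < ρ) (hy : 0 ≤ y) (hyx : y < x) :
    gammaMean ρ (cutoff (Real.exp (-x)) (Real.exp (-y))) ∈ Icc (y ^ ρ / ρ) (x ^ ρ / ρ) := by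
  have hlt : Real.exp (-x) < Real.exp (-y) := Real.exp_lt_exp.2 (by linarith)
  have hint := integrableOn_gammaMean hρ
    (continuous_cutoff (u₁ := Real.exp (-y)) (Real.exp_pos (-x)))
  have hnn : ∀ t ∈ Ioi (0 : ℝ), 0 ≤ Real.exp (-t) * t ^ (ρ - 1)
      * cutoff (Real.exp (-x)) (Real.exp (-y)) (Real.exp (-t)) := by
    intro t ht
    have ht : (0 : ℝ) < t := ht
    rw [mul_right_comm]
    exact mul_nonneg (mul_cutoff_mem (Real.exp_pos _) (Real.exp_pos _).le).1 (by positivity)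
  constructor
  · rw [← integral_rpow_Ioc hρ hy, gammaMean]
    calc _ = ∫ t in Ioc 0 y, Real.exp (-t) * t ^ (ρ - 1)
          * cutoff (Real.exp (-x)) (Real.exp (-y)) (Real.exp (-t)) := by
          refine setIntegral_congr_fun measurableSet_Ioc fun t ht => ?_
          rw [mul_right_comm, mul_cutoff_of_ge (Real.exp_pos _) hlt
            (Real.exp_le_exp.2 (by linarith [ht.2])), one_mul]
      _ ≤ _ := setIntegral_mono_set hint
          ((ae_restrict_iff' measurableSet_Ioi).2 (ae_of_all _ hnn))
          (Eventually.of_forall fun t ht => ht.1)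
  · rw [← integral_rpow_Ioc hρ (hy.trans hyx.le), gammaMean]
    calc _ = ∫ t in Ioc 0 x, Real.exp (-t) * t ^ (ρ - 1)
          * cutoff (Real.exp (-x)) (Real.exp (-y)) (Real.exp (-t)) := by
          refine setIntegral_eq_of_subset_of_forall_sdiff_eq_zero measurableSet_Ioi
            (fun t ht => ht.1) fun t ht => ?_
          have h0 : (0 : ℝ) < t := ht.1
          have : x < t := by by_contra hc; exact ht.2 ⟨h0, not_lt.1 hc⟩
          rw [cutoff_of_le hlt (Real.exp_le_exp.2 (by linarith)), mul_zero]
      _ ≤ _ := by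
          refine setIntegral_mono_on (hint.mono_set fun t ht => ht.1)
            (integrableOn_rpow_Ioc hρ (hy.trans hyx.le)) measurableSet_Ioc fun t ht => ?_
          have h0 : (0 : ℝ) < t := ht.1
          rw [mul_right_comm]
          exact mul_le_of_le_one_left (by positivity)
            (mul_cutoff_mem (Real.exp_pos _) (Real.exp_pos _).le).2

/-- At s = 1/T the condition t ≤ T reads exp (-t s) ≥ exp (-1). A cutoff that has reached its
plateau at exp (-1) therefore dominates the sharp truncation; in the companion bound the cutoff only
starts to rise there. -/
theorem partialSum_le_abelMean {b : ℕ → ℝ} {ρ : ℝ} (hb : ∀ t, 0 ≤ b t)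
    (hs : ∀ s : ℝ, 0 < s → Summable fun t : ℕ => b t * Real.exp (-s) ^ t) {x : ℝ} (hx : 1 < x)
    {T : ℕ} (hT : 0 < T) :
    (∑ t ∈ Finset.range (T + 1), b t) / (T : ℝ) ^ ρ
      ≤ abelMean b ρ (cutoff (Real.exp (-x)) (Real.exp (-1))) ((T : ℝ)⁻¹) := by
  have hT' : (0 : ℝ) < T := by exact_mod_cast hT
  have hlt : Real.exp (-x) < Real.exp (-1) := Real.exp_lt_exp.2 (by linarith)
  rw [abelMean, Real.inv_rpow hT'.le, div_eq_inv_mul]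
  refine mul_le_mul_of_nonneg_left ?_ (by positivity)
  have hsm := summable_abelMean (inv_pos.2 hT') (hs _ (inv_pos.2 hT'))
    (continuous_cutoff (u₁ := Real.exp (-1)) (Real.exp_pos (-x)))
  refine le_trans (Finset.sum_le_sum fun t ht => ?_) (hsm.sum_le_tsum (Finset.range (T + 1)) ?_)
  · rw [mul_assoc, mul_cutoff_of_ge (Real.exp_pos _) hlt, mul_one]
    rw [← Real.exp_nat_mul]
    refine Real.exp_le_exp.2 ?_
    have : (t : ℝ) ≤ T := by exact_mod_cast (Nat.lt_succ_iff.1 (Finset.mem_range.1 ht))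
    have : (t : ℝ) * (T : ℝ)⁻¹ ≤ 1 := by rw [← div_eq_mul_inv, div_le_one hT']; exact this
    linarith
  · intro t _
    rw [mul_assoc]
    exact mul_nonneg (hb t) (mul_cutoff_mem (Real.exp_pos _) (by positivity)).1

theorem abelMean_le_partialSum {b : ℕ → ℝ} {ρ : ℝ} (hb : ∀ t, 0 ≤ b t) {y : ℝ} (hy : y < 1)
    {T : ℕ} (hT : 0 < T) :
    abelMean b ρ (cutoff (Real.exp (-1)) (Real.exp (-y))) ((T : ℝ)⁻¹)
      ≤ (∑ t ∈ Finset.range (T + 1), b t) / (T : ℝ) ^ ρ := by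
  have hT' : (0 : ℝ) < T := by exact_mod_cast hT
  have hlt : Real.exp (-1) < Real.exp (-y) := Real.exp_lt_exp.2 (by linarith)
  rw [abelMean, Real.inv_rpow hT'.le, div_eq_inv_mul]
  refine mul_le_mul_of_nonneg_left ?_ (by positivity)
  rw [tsum_eq_sum (s := Finset.range (T + 1))]
  · refine Finset.sum_le_sum fun t _ => ?_
    rw [mul_assoc]
    exact mul_le_of_le_one_right (hb t) (mul_cutoff_mem (Real.exp_pos _) (by positivity)).2
  · intro t ht
    rw [cutoff_of_le hlt, mul_zero]
    rw [← Real.exp_nat_mul]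
    refine Real.exp_le_exp.2 ?_
    have : (T : ℝ) ≤ t := by
      rw [Finset.mem_range] at ht
      exact_mod_cast (by omega : T ≤ t)
    have : 1 ≤ (t : ℝ) * (T : ℝ)⁻¹ := by rw [← div_eq_mul_inv, one_le_div hT']; exact this
    linarith

/-- Karamata's Tauberian theorem for power series with nonnegative coefficients. -/
theorem tendsto_partialSum_of_tendsto_powerSeries {b : ℕ → ℝ} {ρ C : ℝ} (hρ : 0 < ρ)
    (hb : ∀ t, 0 ≤ b t) (hs : ∀ z : ℝ, 0 < z → z < 1 → Summable fun t : ℕ => b t * z ^ t)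
    (h : Tendsto (fun z : ℝ => (1 - z) ^ ρ * ∑' t : ℕ, b t * z ^ t) (𝓝[<] 1) (𝓝 C)) :
    Tendsto (fun T : ℕ => (∑ t ∈ Finset.range (T + 1), b t) / (T : ℝ) ^ ρ) atTop
      (𝓝 (C / Real.Gamma (ρ + 1))) := by
  have hΓ := Real.Gamma_pos_of_pos hρ
  have hs' : ∀ s : ℝ, 0 < s → Summable fun t : ℕ => b t * Real.exp (-s) ^ t := fun s h0 =>
    hs _ (Real.exp_pos _) (Real.exp_lt_one_iff.2 (by linarith))
  have hz : Tendsto (fun s : ℝ => Real.exp (-s)) (𝓝[>] 0) (𝓝[<] 1) := by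
    refine tendsto_nhdsWithin_iff.2 ⟨?_, ?_⟩
    · have : Tendsto (fun s : ℝ => Real.exp (-s)) (𝓝 0) (𝓝 (Real.exp (-0))) :=
        (by fun_prop : Continuous fun s : ℝ => Real.exp (-s)).tendsto 0
      rw [neg_zero, Real.exp_zero] at this
      exact this.mono_left nhdsWithin_le_nhds
    · filter_upwards [self_mem_nhdsWithin] with s h0
      exact Real.exp_lt_one_iff.2 (by simpa using h0)
  -- With z = exp (-s) the normalisations (1 - z)^ρ and s^ρ are asymptotically equal.
  have hratio : Tendsto (fun s : ℝ => (s / (1 - Real.exp (-s))) ^ ρ) (𝓝[>] 0) (𝓝 1) := by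
    have hd : HasDerivAt (fun s : ℝ => 1 - Real.exp (-s)) 1 0 := by
      have := ((hasDerivAt_neg (0 : ℝ)).exp).const_sub 1
      simpa using this
    have h1 := (hasDerivAt_iff_tendsto_slope.1 hd).mono_left
      (nhdsWithin_mono (0 : ℝ) (fun x hx => ne_of_gt hx : Ioi (0 : ℝ) ⊆ {0}ᶜ))
    have h2 := (h1.inv₀ one_ne_zero).rpow_const (p := ρ) (Or.inl (by norm_num))
    rw [inv_one, Real.one_rpow] at h2
    refine h2.congr fun s => ?_
    simp [slope_def_field]
  have hA : Tendsto (abelMean b ρ fun _ => 1) (𝓝[>] 0) (𝓝 C) := by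
    have := hratio.mul (h.comp hz)
    rw [one_mul] at this
    refine this.congr' ?_
    filter_upwards [self_mem_nhdsWithin] with s h0
    have h0 : (0 : ℝ) < s := h0
    have h1 : 0 < 1 - Real.exp (-s) := by
      have := Real.exp_lt_one_iff.2 (by linarith : -s < 0); linarith
    simp only [Function.comp, abelMean, mul_one]
    rw [← mul_assoc, ← Real.mul_rpow (by positivity) h1.le, div_mul_cancel₀ _ h1.ne']
  have hC : 0 ≤ C := by
    refine ge_of_tendsto hA ?_
    filter_upwards [self_mem_nhdsWithin] with s hs'
    have : (0 : ℝ) < s := hs'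
    refine mul_nonneg (by positivity) (tsum_nonneg fun t => ?_)
    have := hb t
    positivity
  have hinv : Tendsto (fun T : ℕ => ((T : ℝ))⁻¹) atTop (𝓝[>] 0) :=
    tendsto_inv_atTop_nhdsGT_zero.comp tendsto_natCast_atTop_atTop
  have hlim : Tendsto (fun x : ℝ => C / Real.Gamma ρ * (x ^ ρ / ρ)) (𝓝 1)
      (𝓝 (C / Real.Gamma (ρ + 1))) := by
    have : Tendsto (fun x : ℝ => C / Real.Gamma ρ * (x ^ ρ / ρ)) (𝓝 1)
        (𝓝 (C / Real.Gamma ρ * ((1 : ℝ) ^ ρ / ρ))) :=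
      ((tendsto_id.rpow_const (Or.inl one_ne_zero)).div_const ρ).const_mul _
    rw [Real.one_rpow] at this
    rw [Real.Gamma_add_one hρ.ne']
    convert this using 2
    field_simp
  -- The sharp indicator of t ≤ T is squeezed between continuous cutoffs whose outer threshold y
  -- tends to 1, from below for the lower bound and from above for the upper one.
  rw [tendsto_order]
  constructor
  · intro c hc
    obtain ⟨y, hy, hy0, hy1⟩ := ((hlim.eventually (lt_mem_nhds hc)).filter_mono
      (nhdsWithin_le_nhds (s := Iio 1)) |>.and (Ioo_mem_nhdsLT (zero_lt_one' ℝ))).exists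
    have h1 := (tendsto_abelMean hρ hb hs' hA (continuous_cutoff (u₁ := Real.exp (-y))
      (Real.exp_pos (-1)))).comp hinv
    have h2 : c < C / Real.Gamma ρ * gammaMean ρ (cutoff (Real.exp (-1)) (Real.exp (-y))) :=
      hy.trans_le (mul_le_mul_of_nonneg_left (gammaMean_cutoff_mem hρ hy0.le hy1).1 (by positivity))
    filter_upwards [h1.eventually (lt_mem_nhds h2), eventually_gt_atTop 0] with T hT1 hT0
    exact lt_of_lt_of_le hT1 (abelMean_le_partialSum hb hy1 hT0)
  · intro c hc
    obtain ⟨y, hy, hy1⟩ := ((hlim.eventually (gt_mem_nhds hc)).filter_mono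
      (nhdsWithin_le_nhds (s := Ioi 1)) |>.and self_mem_nhdsWithin).exists
    have hy1 : (1 : ℝ) < y := hy1
    have h1 := (tendsto_abelMean hρ hb hs' hA (continuous_cutoff (u₁ := Real.exp (-1))
      (Real.exp_pos (-y)))).comp hinv
    have h2 : C / Real.Gamma ρ * gammaMean ρ (cutoff (Real.exp (-y)) (Real.exp (-1))) < c :=
      (mul_le_mul_of_nonneg_left (gammaMean_cutoff_mem hρ zero_le_one hy1).2
        (by positivity)).trans_lt hy
    filter_upwards [h1.eventually (gt_mem_nhds h2), eventually_gt_atTop 0] with T hT1 hT0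
    exact lt_of_le_of_lt (partialSum_le_abelMean hb hs' hy1 hT0) hT1

end SESGD

/-! ### Sums of power-law weights against a singularity at zero -/

namespace SESGD

open MeasureTheory Set

theorem integral_sq_mul_exp {y : ℝ} (hy : 0 < y) :
    ∫ s in Ioi (0 : ℝ), s ^ (2 : ℝ) * Real.exp (-((1 + y) * s)) = 2 / (1 + y) ^ 3 := by
  have h := Real.integral_rpow_mul_exp_neg_mul_Ioi (by norm_num : (0 : ℝ) < 3)
    (by linarith : 0 < 1 + y)
  rw [show (3 : ℝ) - 1 = 2 by norm_num] at h
  rw [h, show (3 : ℝ) = ((2 : ℕ) : ℝ) + 1 by norm_num, Real.Gamma_nat_eq_factorial,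
    show ((2 : ℕ) : ℝ) + 1 = ((3 : ℕ) : ℝ) by norm_num, Real.rpow_natCast]
  simp only [Nat.factorial]
  push_cast
  rw [one_div, inv_pow]
  ring

theorem integrableOn_rpow_mul_exp {p r : ℝ} (hp : -1 < p) (hr : 0 < r) :
    IntegrableOn (fun x : ℝ => x ^ p * Real.exp (-(r * x))) (Ioi 0) := by
  have := integrableOn_rpow_mul_exp_neg_mul_rpow hp (zero_lt_one' ℝ) hr
  simpa only [Real.rpow_one, neg_mul] using this

/-- This justifies Fubini for the Beta integral below: integrating in s first gives y^ζ · 2/(1+y)³,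
integrating in y first gives Γ(ζ+1) s^(1-ζ) exp (-s). The latter is integrable at 0 precisely
because ζ < 2. -/
theorem integrable_betaKernel {ζ : ℝ} (h0 : 0 < ζ) (h2 : ζ < 2) :
    Integrable (Function.uncurry fun y s : ℝ => y ^ ζ * (s ^ (2 : ℝ) * Real.exp (-((1 + y) * s))))
      ((volume.restrict (Ioi 0)).prod (volume.restrict (Ioi 0))) := by
  have hmeas : Measurable (Function.uncurry fun y s : ℝ =>
      y ^ ζ * (s ^ (2 : ℝ) * Real.exp (-((1 + y) * s)))) := by
    simp only [Function.uncurry_def]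
    fun_prop
  rw [integrable_prod_iff' hmeas.aestronglyMeasurable]
  have key : ∀ s y : ℝ, y ^ ζ * (s ^ (2 : ℝ) * Real.exp (-((1 + y) * s)))
      = (s ^ (2 : ℝ) * Real.exp (-s)) * (y ^ ζ * Real.exp (-(s * y))) := by
    intro s y
    rw [show -((1 + y) * s) = -s + -(s * y) by ring, Real.exp_add]
    ring
  constructor
  · refine (ae_restrict_iff' measurableSet_Ioi).2 (ae_of_all _ fun s hs => ?_)
    simp only [Function.uncurry_apply_pair, key]
    exact (integrableOn_rpow_mul_exp (by linarith) hs).const_mul _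
  · have h : IntegrableOn (fun s : ℝ => Real.Gamma (ζ + 1) * (s ^ (1 - ζ) * Real.exp (-(1 * s))))
        (Ioi 0) := (integrableOn_rpow_mul_exp (by linarith) one_pos).const_mul _
    refine h.congr_fun (fun s hs => ?_) measurableSet_Ioi
    have hs : (0 : ℝ) < s := hs
    simp only [Function.uncurry_apply_pair]
    have e : ∫ y in Ioi (0 : ℝ), ‖y ^ ζ * (s ^ (2 : ℝ) * Real.exp (-((1 + y) * s)))‖
        = ∫ y in Ioi (0 : ℝ), (s ^ (2 : ℝ) * Real.exp (-s)) * (y ^ (ζ + 1 - 1)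
          * Real.exp (-(s * y))) := by
      refine setIntegral_congr_fun measurableSet_Ioi fun y hy => ?_
      have hy : (0 : ℝ) < y := hy
      rw [Real.norm_of_nonneg (by positivity), key, add_sub_cancel_right]
    rw [e, integral_const_mul, Real.integral_rpow_mul_exp_neg_mul_Ioi (by linarith) hs, one_div,
      Real.inv_rpow hs.le, ← Real.rpow_neg hs.le, one_mul,
      show (1 : ℝ) - ζ = 2 + -(ζ + 1) by ring, Real.rpow_add hs]
    ring

theorem integrableOn_rpow_mul_inv_cube {ζ : ℝ} (h0 : 0 < ζ) (h2 : ζ < 2) :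
    IntegrableOn (fun y : ℝ => y ^ ζ * (2 / (1 + y) ^ 3)) (Ioi 0) := by
  refine IntegrableOn.congr_fun (integrable_betaKernel h0 h2).integral_prod_left (fun y hy => ?_)
    measurableSet_Ioi
  simp only [Function.uncurry_apply_pair]
  rw [integral_const_mul, integral_sq_mul_exp hy]

theorem integral_rpow_mul_inv_cube {ζ : ℝ} (h0 : 0 < ζ) (h2 : ζ < 2) :
    ∫ y in Ioi (0 : ℝ), y ^ ζ * (2 / (1 + y) ^ 3) = Real.Gamma (ζ + 1) * Real.Gamma (2 - ζ) := by
  have e1 : ∫ y in Ioi (0 : ℝ), y ^ ζ * (2 / (1 + y) ^ 3) = ∫ y in Ioi (0 : ℝ),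
      ∫ s in Ioi (0 : ℝ), y ^ ζ * (s ^ (2 : ℝ) * Real.exp (-((1 + y) * s))) := by
    refine setIntegral_congr_fun measurableSet_Ioi fun y hy => ?_
    rw [integral_const_mul, integral_sq_mul_exp hy]
  rw [e1, integral_integral_swap (integrable_betaKernel h0 h2), Real.Gamma_eq_integral
    (by linarith : 0 < 2 - ζ), ← integral_const_mul]
  refine setIntegral_congr_fun measurableSet_Ioi fun s hs => ?_
  have hs : (0 : ℝ) < s := hs
  have e : ∫ y in Ioi (0 : ℝ), y ^ ζ * (s ^ (2 : ℝ) * Real.exp (-((1 + y) * s)))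
      = ∫ y in Ioi (0 : ℝ), (s ^ (2 : ℝ) * Real.exp (-s)) * (y ^ (ζ + 1 - 1)
        * Real.exp (-(s * y))) := by
    refine setIntegral_congr_fun measurableSet_Ioi fun y _ => ?_
    rw [add_sub_cancel_right, show -((1 + y) * s) = -s + -(s * y) by ring, Real.exp_add]
    ring
  rw [e, integral_const_mul, Real.integral_rpow_mul_exp_neg_mul_Ioi (by linarith) hs, one_div,
    Real.inv_rpow hs.le, ← Real.rpow_neg hs.le, show 2 - ζ - 1 = 2 + -(ζ + 1) by ring,
    Real.rpow_add hs]
  ring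

/-- With c = b/δ the value is δ²/(δ+b)², so each term of a Stieltjes sum becomes the integral of a
fixed density over a half-line. -/
theorem integral_Ioi_inv_cube {c : ℝ} (hc : 0 ≤ c) :
    IntegrableOn (fun y : ℝ => 2 / (1 + y) ^ 3) (Ioi c) ∧
      ∫ y in Ioi c, 2 / (1 + y) ^ 3 = 1 / (1 + c) ^ 2 := by
  have hd : ∀ x ∈ Ici c, HasDerivAt (fun y : ℝ => -(1 / (1 + y) ^ 2)) (2 / (1 + x) ^ 3) x := by
    intro x hx
    have hx : 0 < 1 + x := by have : c ≤ x := hx; linarith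
    have h1 : HasDerivAt (fun y : ℝ => (1 + y) ^ 2) (2 * (1 + x)) x := by
      simpa using ((hasDerivAt_id' x).const_add 1).fun_pow 2
    have h2 := (h1.fun_inv (by positivity)).fun_neg
    simp only [one_div]
    refine h2.congr_deriv ?_
    field_simp
  have hnn : ∀ x ∈ Ioi c, 0 ≤ 2 / (1 + x) ^ 3 := by
    intro x hx
    have : 0 < 1 + x := by have : c < x := hx; linarith
    positivity
  have hlim : Tendsto (fun y : ℝ => -(1 / (1 + y) ^ 2)) atTop (𝓝 0) := by
    have h1 : Tendsto (fun y : ℝ => (1 + y) ^ 2) atTop atTop :=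
      (tendsto_pow_atTop two_ne_zero).comp (tendsto_atTop_add_const_left _ 1 tendsto_id)
    simpa using h1.inv_tendsto_atTop.neg
  refine ⟨integrableOn_Ioi_deriv_of_nonneg' hd hnn hlim, ?_⟩
  rw [integral_Ioi_of_hasDerivAt_of_nonneg' hd hnn hlim]
  ring

/-- The tail sums of a sequence. -/
noncomputable def tail (w : ℕ → ℝ) (k : ℕ) : ℝ := ∑' l, w (k + l)

theorem tsum_ite_ge {w : ℕ → ℝ} (hw : Summable w) (m : ℕ) :
    ∑' k, (if m ≤ k then w k else 0) = tail w m := by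
  have hs : Summable fun k => if m ≤ k then w k else 0 := by
    refine (summable_nat_add_iff m).1 ?_
    simpa using (summable_nat_add_iff m).2 hw
  rw [← hs.sum_add_tsum_nat_add m, Finset.sum_eq_zero, zero_add, tail]
  · refine tsum_congr fun l => ?_
    rw [if_pos (by omega), add_comm]
  · intro k hk
    rw [if_neg (by simpa using hk)]

theorem tail_eq_add {w : ℕ → ℝ} (hw : Summable w) (k : ℕ) : tail w k = w k + tail w (k + 1) := by
  have h : Summable fun l => w (k + l) := by
    simpa only [add_comm] using (summable_nat_add_iff k).2 hw
  rw [tail, h.tsum_eq_zero_add, tail]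
  simp only [add_zero]
  congr 1
  exact tsum_congr fun l => by rw [add_right_comm, add_assoc]

/-- The strict inequality and the shift k + 1 make the floor the exact threshold, without rounding
error. -/
theorem lt_iff_floor_le {B ν x : ℝ} (hB : 0 < B) (hν : 0 < ν) (hx : 0 < x) (k : ℕ) :
    B * ((k : ℝ) + 1) ^ (-ν) < x ↔ ⌊(B / x) ^ (1 / ν)⌋₊ ≤ k := by
  have hk : (0 : ℝ) < (k : ℝ) + 1 := by positivity
  rw [← Nat.lt_succ_iff, Nat.floor_lt (by positivity), Real.rpow_neg hk.le, ← div_eq_mul_inv,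
    div_lt_comm₀ (by positivity) hx, ← Real.rpow_inv_lt_iff_of_pos (by positivity) hk.le hν]
  simp

/-- Layer-cake formula. After exchanging sum and integral, the indices contributing at y are those
with B (k+1)^(-ν) < δ y. They form a final segment, so only tails of w enter, and those are what the
hypotheses control. -/
theorem sum_eq_integral {w : ℕ → ℝ} {B ν : ℝ} (hw0 : ∀ k, 0 ≤ w k) (hw : Summable w) (hB : 0 < B)
    (hν : 0 < ν) {δ : ℝ} (hδ : 0 < δ) :
    δ ^ 2 * ∑' k : ℕ, w k / (δ + B * ((k : ℝ) + 1) ^ (-ν)) ^ 2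
      = ∫ y in Ioi (0 : ℝ), tail w ⌊(B / (δ * y)) ^ (1 / ν)⌋₊ * (2 / (1 + y) ^ 3) := by
  set b : ℕ → ℝ := fun k => B * ((k : ℝ) + 1) ^ (-ν) with hb
  have hb0 : ∀ k, 0 < b k := fun k => by positivity
  set F : ℕ → ℝ → ℝ := fun k y => w k * (Ioi (b k / δ)).indicator (fun y => 2 / (1 + y) ^ 3) y
    with hF
  have hsub : ∀ k, Ioi (b k / δ) ⊆ Ioi 0 := fun k y hy =>
    lt_trans (div_pos (hb0 k) hδ) hy
  have hFi : ∀ k, Integrable (F k) (volume.restrict (Ioi 0)) := by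
    intro k
    refine Integrable.const_mul ?_ _
    exact ((integrable_indicator_iff measurableSet_Ioi).2
      (integral_Ioi_inv_cube (div_pos (hb0 k) hδ).le).1).integrableOn
  have hFint : ∀ k, ∫ y in Ioi (0 : ℝ), F k y = δ ^ 2 * (w k / (δ + b k) ^ 2) := by
    intro k
    have := hb0 k
    simp only [hF]
    rw [integral_const_mul, setIntegral_indicator measurableSet_Ioi,
      inter_eq_self_of_subset_right (hsub k), (integral_Ioi_inv_cube (div_pos (hb0 k) hδ).le).2]
    field_simp
  have hFn : ∀ k, ∀ y, 0 ≤ F k y := by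
    intro k y
    refine mul_nonneg (hw0 k) (indicator_nonneg (fun y hy => ?_) y)
    have : 0 < y := hsub k hy
    positivity
  have hsum : Summable fun k => δ ^ 2 * (w k / (δ + b k) ^ 2) := by
    refine Summable.of_nonneg_of_le (fun k => ?_) (fun k => ?_) hw
    · have := hb0 k; have := hw0 k; positivity
    · have := hb0 k
      rw [mul_div_assoc', div_le_iff₀ (by positivity), mul_comm]
      refine mul_le_mul_of_nonneg_left ?_ (hw0 k)
      gcongr; linarith
  have H := hasSum_integral_of_summable_integral_norm (F := F) (μ := volume.restrict (Ioi 0)) hFi (by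
    refine hsum.congr fun k => ?_
    rw [← hFint k]
    exact (integral_congr_ae (ae_of_all _ fun y => Real.norm_of_nonneg (hFn k y))).symm)
  rw [← tsum_mul_left]
  calc _ = ∑' k, ∫ y in Ioi (0 : ℝ), F k y := tsum_congr fun k => (hFint k).symm
    _ = ∫ y in Ioi (0 : ℝ), ∑' k, F k y := H.tsum_eq
    _ = _ := by
      refine setIntegral_congr_fun measurableSet_Ioi fun y hy => ?_
      have hy : (0 : ℝ) < y := hy
      rw [← tsum_ite_ge hw, ← tsum_mul_right]
      refine tsum_congr fun k => ?_
      simp only [hF]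
      have hiff : y ∈ Ioi (b k / δ) ↔ ⌊(B / (δ * y)) ^ (1 / ν)⌋₊ ≤ k := by
        rw [← lt_iff_floor_le hB hν (by positivity), mem_Ioi, div_lt_iff₀' hδ]
      by_cases h : y ∈ Ioi (b k / δ)
      · rw [indicator_of_mem h, if_pos (hiff.1 h)]
      · rw [indicator_of_notMem h, if_neg (fun h' => h (hiff.2 h'))]; simp

theorem exists_tail_bound {w : ℕ → ℝ} {K κ : ℝ}
    (ht : Tendsto (fun k : ℕ => tail w k * ((k : ℝ) + 1) ^ κ) atTop (𝓝 K)) :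
    ∃ C, 0 < C ∧ ∀ k : ℕ, tail w k ≤ C * ((k : ℝ) + 1) ^ (-κ) := by
  obtain ⟨C, hC⟩ := ht.bddAbove_range
  refine ⟨max C 1, by positivity, fun k => ?_⟩
  have hk : (0 : ℝ) < (k : ℝ) + 1 := by positivity
  rw [Real.rpow_neg hk.le, ← div_eq_mul_inv, le_div_iff₀ (by positivity)]
  exact (hC (mem_range_self k)).trans (le_max_left _ _)

theorem tail_nonneg {w : ℕ → ℝ} (hw0 : ∀ k, 0 ≤ w k) (k : ℕ) : 0 ≤ tail w k :=
  tsum_nonneg fun _ => hw0 _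

/-- The Stieltjes transform of order two of a discrete measure with a power law at zero. -/
theorem tendsto_stieltjes {w : ℕ → ℝ} {B ν K κ : ℝ} (hw0 : ∀ k, 0 ≤ w k) (hw : Summable w)
    (hB : 0 < B) (hν : 0 < ν) (hκ : 0 < κ) (hκν : κ / ν < 2)
    (ht : Tendsto (fun k : ℕ => tail w k * ((k : ℝ) + 1) ^ κ) atTop (𝓝 K)) :
    Tendsto (fun δ : ℝ => δ ^ (2 - κ / ν) * ∑' k : ℕ, w k / (δ + B * ((k : ℝ) + 1) ^ (-ν)) ^ 2)
      (𝓝[>] 0)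
      (𝓝 (K * B ^ (-(κ / ν)) * (Real.Gamma (κ / ν + 1) * Real.Gamma (2 - κ / ν)))) := by
  set ζ := κ / ν with hζ
  have hζ0 : 0 < ζ := by positivity
  obtain ⟨C, hC0, hC⟩ := exists_tail_bound ht
  have hbase : ∀ x : ℝ, 0 < x → ((B / x) ^ (1 / ν)) ^ (-κ) = B ^ (-ζ) * x ^ ζ := by
    intro x hx
    rw [← Real.rpow_mul (by positivity), show 1 / ν * -κ = -ζ by rw [hζ]; ring,
      Real.div_rpow hB.le hx.le, Real.rpow_neg hx.le, div_inv_eq_mul]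
  have key : Tendsto (fun δ : ℝ => ∫ y in Ioi (0 : ℝ),
      δ ^ (-ζ) * (tail w ⌊(B / (δ * y)) ^ (1 / ν)⌋₊ * (2 / (1 + y) ^ 3))) (𝓝[>] 0)
      (𝓝 (∫ y in Ioi (0 : ℝ), K * B ^ (-ζ) * (y ^ ζ * (2 / (1 + y) ^ 3)))) := by
    -- The tail bound at the floor gives at most a constant times (δ y)^ζ, and the factor δ^(-ζ)
    -- removes δ. The majorant is a multiple of the Beta integrand, integrable for ζ < 2.
    refine tendsto_integral_filter_of_dominated_convergence
      (fun y => C * B ^ (-ζ) * (y ^ ζ * (2 / (1 + y) ^ 3))) ?_ ?_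
      ((integrableOn_rpow_mul_inv_cube hζ0 hκν).const_mul _) ?_
    · refine Eventually.of_forall fun δ => Measurable.aestronglyMeasurable ?_
      have h1 : Measurable fun y : ℝ => ⌊(B / (δ * y)) ^ (1 / ν)⌋₊ :=
        Nat.measurable_floor.comp (by fun_prop)
      have h2 : Measurable fun y : ℝ => tail w ⌊(B / (δ * y)) ^ (1 / ν)⌋₊ :=
        (measurable_from_nat (f := tail w)).comp h1
      fun_prop
    · filter_upwards [self_mem_nhdsWithin] with δ hδ
      have hδ : (0 : ℝ) < δ := hδ
      refine (ae_restrict_iff' measurableSet_Ioi).2 (ae_of_all _ fun y hy => ?_)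
      have hy : (0 : ℝ) < y := hy
      have hn := tail_nonneg hw0 ⌊(B / (δ * y)) ^ (1 / ν)⌋₊
      rw [Real.norm_of_nonneg (by positivity)]
      have h1 : tail w ⌊(B / (δ * y)) ^ (1 / ν)⌋₊ ≤ C * (B ^ (-ζ) * (δ * y) ^ ζ) := by
        refine (hC _).trans (mul_le_mul_of_nonneg_left ?_ hC0.le)
        rw [← hbase _ (by positivity)]
        exact Real.rpow_le_rpow_of_nonpos (by positivity) (Nat.lt_floor_add_one _).le (by linarith)
      calc _ ≤ δ ^ (-ζ) * (C * (B ^ (-ζ) * (δ * y) ^ ζ) * (2 / (1 + y) ^ 3)) := by gcongr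
        _ = (δ ^ (-ζ) * δ ^ ζ) * (C * B ^ (-ζ) * (y ^ ζ * (2 / (1 + y) ^ 3))) := by
          rw [Real.mul_rpow hδ.le hy.le]; ring
        _ = _ := by rw [← Real.rpow_add hδ]; simp
    · refine (ae_restrict_iff' measurableSet_Ioi).2 (ae_of_all _ fun y hy => ?_)
      have hy : (0 : ℝ) < y := hy
      have hY : Tendsto (fun δ : ℝ => (B / (δ * y)) ^ (1 / ν)) (𝓝[>] 0) atTop := by
        refine (tendsto_rpow_atTop (by positivity)).comp ?_
        have h1 : Tendsto (fun δ : ℝ => B / y * δ⁻¹) (𝓝[>] 0) atTop :=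
          tendsto_inv_nhdsGT_zero.const_mul_atTop (by positivity)
        refine h1.congr fun δ => ?_
        rw [← div_eq_mul_inv, div_div, mul_comm]
      have hm := tendsto_nat_floor_atTop.comp hY
      have h1 := ht.comp hm
      have h2 : Tendsto (fun x : ℝ => ((⌊x⌋₊ : ℝ) + 1) / x) atTop (𝓝 1) := by
        have := (tendsto_nat_floor_div_atTop (R := ℝ)).add tendsto_inv_atTop_zero
        rw [add_zero] at this
        refine this.congr fun x => ?_
        rw [add_div, one_div]
      have h3 := ((h2.comp hY).rpow_const (p := -κ) (Or.inl one_ne_zero))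
      rw [Real.one_rpow] at h3
      have h4 := ((h1.mul h3).mul_const (B ^ (-ζ) * y ^ ζ * (2 / (1 + y) ^ 3)))
      rw [mul_one] at h4
      rw [mul_assoc, ← mul_assoc (B ^ (-ζ))]
      refine h4.congr' ?_
      filter_upwards [self_mem_nhdsWithin] with δ hδ
      have hδ : (0 : ℝ) < δ := hδ
      simp only [Function.comp]
      have hpos : (0 : ℝ) < (B / (δ * y)) ^ (1 / ν) := by positivity
      rw [Real.div_rpow (by positivity) hpos.le, hbase _ (by positivity), Real.mul_rpow hδ.le hy.le,
        Real.rpow_neg (by positivity : (0 : ℝ) ≤ (⌊(B / (δ * y)) ^ (1 / ν)⌋₊ : ℝ) + 1),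
        Real.rpow_neg hδ.le]
      have e1 : (((⌊(B / (δ * y)) ^ (1 / ν)⌋₊ : ℝ) + 1) ^ κ) ≠ 0 := by positivity
      have e2 : B ^ (-ζ) ≠ 0 := by positivity
      have e3 : y ^ ζ ≠ 0 := by positivity
      have e4 : δ ^ ζ ≠ 0 := by positivity
      field_simp
  rw [integral_const_mul, integral_rpow_mul_inv_cube hζ0 hκν] at key
  refine key.congr' ?_
  filter_upwards [self_mem_nhdsWithin] with δ hδ
  have hδ : (0 : ℝ) < δ := hδ
  rw [integral_const_mul, ← sum_eq_integral hw0 hw hB hν hδ, ← mul_assoc, ← Real.rpow_natCast,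
    ← Real.rpow_add hδ]
  congr 2
  push_cast; ring

/-- Sums of power-law weights against functions with the singularity of order two at zero. -/
theorem tendsto_tsum_of_singularity {w : ℕ → ℝ} {B ν K κ m : ℝ} {H : ℕ → ℝ → ℝ}
    (hw0 : ∀ k, 0 ≤ w k) (hw : Summable w)
    (hB : 0 < B) (hν : 0 < ν) (hκ : 0 < κ) (hκν : κ / ν < 2)
    (ht : Tendsto (fun k : ℕ => tail w k * ((k : ℝ) + 1) ^ κ) atTop (𝓝 K))
    (hH : Tendsto (fun p : ℕ × ℝ => H p.1 p.2 * (p.2 + B * ((p.1 : ℝ) + 1) ^ (-ν)) ^ 2)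
      (atTop ×ˢ 𝓝[>] 0) (𝓝 m))
    (hb : ∀ k, ∃ M, ∀ᶠ δ in 𝓝[>] (0 : ℝ), |H k δ| ≤ M) :
    Tendsto (fun δ : ℝ => δ ^ (2 - κ / ν) * ∑' k : ℕ, w k * H k δ) (𝓝[>] 0)
      (𝓝 (m * (K * B ^ (-(κ / ν)) * (Real.Gamma (κ / ν + 1) * Real.Gamma (2 - κ / ν))))) := by
  set G : ℕ → ℝ → ℝ := fun k δ => w k / (δ + B * ((k : ℝ) + 1) ^ (-ν)) ^ 2 with hG
  set S := K * B ^ (-(κ / ν)) * (Real.Gamma (κ / ν + 1) * Real.Gamma (2 - κ / ν)) with hS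
  have hst : Tendsto (fun δ : ℝ => δ ^ (2 - κ / ν) * ∑' k : ℕ, G k δ) (𝓝[>] 0) (𝓝 S) :=
    tendsto_stieltjes hw0 hw hB hν hκ hκν ht
  have hφ : Tendsto (fun δ : ℝ => δ ^ (2 - κ / ν)) (𝓝[>] 0) (𝓝 0) := by
    have := (Real.continuousAt_rpow_const 0 (2 - κ / ν) (Or.inr (by linarith))).tendsto
    rw [Real.zero_rpow (by linarith)] at this
    exact this.mono_left nhdsWithin_le_nhds
  have hG0 : ∀ k, ∀ δ : ℝ, 0 < δ → 0 ≤ G k δ := fun k δ hδ => by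
    have := hw0 k; positivity
  have hGs : ∀ δ : ℝ, 0 < δ → Summable fun k => G k δ := by
    intro δ hδ
    refine Summable.of_nonneg_of_le (fun k => hG0 k δ hδ) (fun k => ?_) (hw.div_const (δ ^ 2))
    have := hw0 k
    have : 0 ≤ B * ((k : ℝ) + 1) ^ (-ν) := by positivity
    simp only [hG]
    gcongr; linarith
  suffices h : Tendsto (fun δ : ℝ => δ ^ (2 - κ / ν) * ∑' k : ℕ, (w k * H k δ - m * G k δ)) (𝓝[>] 0)
      (𝓝 0) ∧ ∀ᶠ δ in 𝓝[>] (0 : ℝ), Summable fun k => w k * H k δ - m * G k δ by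
    have h1 := h.1.add (hst.const_mul m)
    rw [zero_add] at h1
    refine h1.congr' ?_
    filter_upwards [self_mem_nhdsWithin, h.2] with δ hδ hs
    rw [mul_left_comm, ← mul_add, ← tsum_mul_left, ← hs.tsum_add ((hGs δ hδ).mul_left m)]
    simp
  -- The joint limit in (k, δ) yields a relative error uniform in k ≥ k₀. The finitely many
  -- remaining indices are bounded near δ = 0 and vanish after multiplication by δ^(2-κ/ν).
  have main : ∀ ε : ℝ, 0 < ε → ∃ k₀ : ℕ, ∀ᶠ δ in 𝓝[>] (0 : ℝ), ∀ k, k₀ ≤ k →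
      |w k * H k δ - m * G k δ| ≤ ε * G k δ := by
    intro ε hε
    obtain ⟨pa, hpa, pb, hpb, hab⟩ := Filter.eventually_prod_iff.1
      ((Metric.tendsto_nhds.1 hH) ε hε)
    obtain ⟨k₀, hk₀⟩ := eventually_atTop.1 hpa
    refine ⟨k₀, ?_⟩
    filter_upwards [self_mem_nhdsWithin, hpb] with δ hδ hb k hk
    have hδ : (0 : ℝ) < δ := hδ
    have h := (hab (hk₀ k hk) hb).le
    rw [Real.dist_eq] at h
    have hD : 0 < δ + B * ((k : ℝ) + 1) ^ (-ν) := by positivity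
    have e : w k * H k δ - m * G k δ
        = (H k δ * (δ + B * ((k : ℝ) + 1) ^ (-ν)) ^ 2 - m) * G k δ := by
      simp only [hG]; field_simp
    rw [e, abs_mul, abs_of_nonneg (hG0 k δ hδ)]
    exact mul_le_mul_of_nonneg_right h (hG0 k δ hδ)
  have hsumm : ∀ ε : ℝ, ∀ k₀ : ℕ, ∀ δ : ℝ, 0 < δ → (∀ k, k₀ ≤ k →
      |w k * H k δ - m * G k δ| ≤ ε * G k δ) → Summable fun k => w k * H k δ - m * G k δ := by
    intro ε k₀ δ hδ h
    refine (summable_nat_add_iff k₀).1 ?_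
    refine Summable.of_norm_bounded ((summable_nat_add_iff k₀).2 ((hGs δ hδ).mul_left ε)) fun k => ?_
    exact h (k + k₀) (by omega)
  constructor
  swap
  · obtain ⟨k₀, hk⟩ := main 1 one_pos
    filter_upwards [self_mem_nhdsWithin, hk] with δ hδ h using hsumm 1 k₀ δ hδ h
  rw [Metric.tendsto_nhds]
  intro ε hε
  set η := ε / (2 * (|S| + 1)) with hη
  have hη0 : 0 < η := by positivity
  obtain ⟨k₀, hk⟩ := main η hη0
  have hfin : Tendsto (fun δ : ℝ => δ ^ (2 - κ / ν) *
      ∑ k ∈ Finset.range k₀, |w k * H k δ - m * G k δ|) (𝓝[>] 0) (𝓝 0) := by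
    simp only [Finset.mul_sum]
    suffices h : ∀ k ∈ Finset.range k₀, Tendsto (fun δ : ℝ => δ ^ (2 - κ / ν) *
        |w k * H k δ - m * G k δ|) (𝓝[>] 0) (𝓝 0) by
      simpa using tendsto_finsetSum _ h
    intro k _
    obtain ⟨M, hM⟩ := hb k
    have hbk : 0 < B * ((k : ℝ) + 1) ^ (-ν) := by positivity
    refine squeeze_zero' (g := fun δ : ℝ => δ ^ (2 - κ / ν) *
      (w k * M + |m| * (w k / (B * ((k : ℝ) + 1) ^ (-ν)) ^ 2))) ?_ ?_ ?_
    · filter_upwards [self_mem_nhdsWithin] with δ hδ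
      have : (0 : ℝ) < δ := hδ
      positivity
    · filter_upwards [self_mem_nhdsWithin, hM] with δ hδ hM
      have hδ : (0 : ℝ) < δ := hδ
      refine mul_le_mul_of_nonneg_left ?_ (by positivity)
      refine (abs_sub _ _).trans ?_
      rw [abs_mul, abs_mul, abs_of_nonneg (hw0 k), abs_of_nonneg (hG0 k δ hδ)]
      have := hw0 k
      simp only [hG]
      gcongr
      linarith
    · simpa using hφ.mul_const _
  filter_upwards [self_mem_nhdsWithin, hk, (Metric.tendsto_nhds.1 hfin) (ε / 2) (by positivity),
    hst.eventually (gt_mem_nhds (lt_of_le_of_lt (le_abs_self S) (lt_add_one _)))] with δ hδ h1 h2 h3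
  have hδ : (0 : ℝ) < δ := hδ
  have hs := hsumm η k₀ δ hδ h1
  have hφ0 : 0 < δ ^ (2 - κ / ν) := by positivity
  rw [Real.dist_eq, sub_zero] at h2 ⊢
  have htail : ∑' k, |w (k + k₀) * H (k + k₀) δ - m * G (k + k₀) δ| ≤ η * ∑' k, G k δ := by
    have hs' := (summable_nat_add_iff k₀).2 hs.abs
    calc _ ≤ ∑' k, η * G (k + k₀) δ := hs'.tsum_le_tsum (fun k => h1 _ (by omega))
            (((summable_nat_add_iff k₀).2 (hGs δ hδ)).mul_left η)
      _ = η * ∑' k, G (k + k₀) δ := tsum_mul_left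
      _ ≤ _ := by
        refine mul_le_mul_of_nonneg_left ?_ hη0.le
        rw [← (hGs δ hδ).sum_add_tsum_nat_add k₀]
        have := Finset.sum_nonneg (s := Finset.range k₀) fun k _ => hG0 k δ hδ
        linarith
  have habs : |∑' k, (w k * H k δ - m * G k δ)| ≤ ∑ k ∈ Finset.range k₀,
      |w k * H k δ - m * G k δ| + η * ∑' k, G k δ := by
    refine (norm_tsum_le_tsum_norm hs.norm).trans ?_
    rw [← hs.norm.sum_add_tsum_nat_add k₀]
    exact add_le_add le_rfl htail
  rw [abs_mul, abs_of_pos hφ0]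
  have h4 : η * (δ ^ (2 - κ / ν) * ∑' k, G k δ) < η * (|S| + 1) := by gcongr
  have h5 : η * (|S| + 1) = ε / 2 := by rw [hη]; field_simp
  calc _ ≤ δ ^ (2 - κ / ν) * (∑ k ∈ Finset.range k₀,
      |w k * H k δ - m * G k δ| + η * ∑' k, G k δ) := by gcongr
    _ = δ ^ (2 - κ / ν) * ∑ k ∈ Finset.range k₀, |w k * H k δ - m * G k δ|
      + η * (δ ^ (2 - κ / ν) * ∑' k, G k δ) := by ring
    _ < ε / 2 + ε / 2 := add_lt_add (lt_of_le_of_lt (le_abs_self _) h2) (h5 ▸ h4)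
    _ = ε := by ring

theorem tail_antitone {w : ℕ → ℝ} (hw0 : ∀ k, 0 ≤ w k) (hw : Summable w) : Antitone (tail w) :=
  antitone_nat_of_succ_le fun k => by rw [tail_eq_add hw k]; linarith [hw0 k]

theorem tail_pos {w : ℕ → ℝ} {K κ : ℝ} (hw0 : ∀ k, 0 ≤ w k) (hw : Summable w) (hK : 0 < K)
    (ht : Tendsto (fun k : ℕ => tail w k * ((k : ℝ) + 1) ^ κ) atTop (𝓝 K)) (k : ℕ) :
    0 < tail w k := by
  obtain ⟨m, hm, hkm⟩ := ((ht.eventually (lt_mem_nhds hK)).and (eventually_ge_atTop k)).exists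
  have : 0 < tail w m := pos_of_mul_pos_left hm (by positivity)
  exact this.trans_le (tail_antitone hw0 hw hkm)

/-- Power moments below the exponent of a power-law tail are finite. -/
theorem summable_mul_rpow {w : ℕ → ℝ} {K κ s : ℝ} (hw0 : ∀ k, 0 ≤ w k) (hw : Summable w)
    (hK : 0 < K) (hκ : 0 < κ) (hs0 : 0 ≤ s) (hs : s < κ)
    (ht : Tendsto (fun k : ℕ => tail w k * ((k : ℝ) + 1) ^ κ) atTop (𝓝 K)) :
    Summable fun k : ℕ => w k * ((k : ℝ) + 1) ^ s := by
  obtain ⟨C, hC0, hC⟩ := exists_tail_bound ht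
  have hpos := tail_pos hw0 hw hK ht
  -- With R_k the tail, (k+1)^s is at most a constant times R_k^(-s/κ) = R_k^(p-1). Bernoulli's
  -- inequality for the exponent p ≤ 1 gives p (R_k - R_{k+1}) R_k^(p-1) ≤ R_k^p - R_{k+1}^p, which
  -- telescopes.
  set p := 1 - s / κ with hp
  have hp0 : 0 < p := by rw [hp, sub_pos, div_lt_one hκ]; exact hs
  have hp1 : p ≤ 1 := by rw [hp]; linarith [div_nonneg hs0 hκ.le]
  have step : ∀ k : ℕ, w k * ((k : ℝ) + 1) ^ s
      ≤ C ^ (s / κ) / p * (tail w k ^ p - tail w (k + 1) ^ p) := by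
    intro k
    have hR := hpos k
    have hR1 := hpos (k + 1)
    have hw' : w k = tail w k - tail w (k + 1) := by rw [tail_eq_add hw k]; ring
    have h1 : ((k : ℝ) + 1) ^ s ≤ C ^ (s / κ) * tail w k ^ (-(s / κ)) := by
      have hk : (0 : ℝ) < (k : ℝ) + 1 := by positivity
      have h2 : ((k : ℝ) + 1) ^ κ ≤ C / tail w k := by
        rw [le_div_iff₀ hR]
        have := hC k
        rwa [Real.rpow_neg hk.le, ← div_eq_mul_inv, le_div_iff₀ (by positivity), mul_comm] at this
      calc ((k : ℝ) + 1) ^ s = (((k : ℝ) + 1) ^ κ) ^ (s / κ) := by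
            rw [← Real.rpow_mul hk.le]; congr 1; field_simp
        _ ≤ (C / tail w k) ^ (s / κ) := Real.rpow_le_rpow (by positivity) h2 (by positivity)
        _ = _ := by rw [Real.div_rpow hC0.le hR.le, Real.rpow_neg hR.le]; rfl
    have h3 : p * (w k * tail w k ^ (-(s / κ))) ≤ tail w k ^ p - tail w (k + 1) ^ p := by
      have hx : -1 ≤ tail w (k + 1) / tail w k - 1 := by
        have : 0 < tail w (k + 1) / tail w k := by positivity
        linarith
      have hb := rpow_one_add_le_one_add_mul_self hx hp0.le hp1
      rw [add_sub_cancel, Real.div_rpow hR1.le hR.le, div_le_iff₀ (by positivity)] at hb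
      have e : tail w k ^ (-(s / κ)) = tail w k ^ p / tail w k := by
        rw [hp, sub_eq_add_neg, Real.rpow_add hR, Real.rpow_one]; field_simp
      rw [e, hw']
      have e2 : p * ((tail w k - tail w (k + 1)) * (tail w k ^ p / tail w k))
          = tail w k ^ p - (1 + p * (tail w (k + 1) / tail w k - 1)) * tail w k ^ p := by
        field_simp; ring
      rw [e2]; linarith
    calc _ ≤ w k * (C ^ (s / κ) * tail w k ^ (-(s / κ))) := mul_le_mul_of_nonneg_left h1 (hw0 k)
      _ = C ^ (s / κ) / p * (p * (w k * tail w k ^ (-(s / κ)))) := by field_simp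
      _ ≤ _ := mul_le_mul_of_nonneg_left h3 (by positivity)
  refine summable_of_sum_range_le (c := C ^ (s / κ) / p * tail w 0 ^ p)
    (fun k => mul_nonneg (hw0 k) (by positivity)) fun n => ?_
  refine (Finset.sum_le_sum fun k _ => step k).trans ?_
  rw [← Finset.mul_sum, Finset.sum_range_sub']
  have := (hpos n).le
  refine mul_le_mul_of_nonneg_left ?_ (by positivity)
  have : 0 ≤ tail w n ^ p := by positivity
  linarith

theorem summable_div_pow {w b : ℕ → ℝ} (hw0 : ∀ k, 0 ≤ w k) (hw : Summable w) (hb : ∀ k, 0 ≤ b k)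
    {δ : ℝ} (hδ : 0 < δ) (m : ℕ) : Summable fun k => w k / (δ + b k) ^ m := by
  refine Summable.of_nonneg_of_le (fun k => ?_) (fun k => ?_) (hw.div_const (δ ^ m))
  · have := hw0 k; have := hb k; positivity
  · have := hw0 k; have := hb k
    gcongr; linarith

/-- Interpolation: (δ + b)^m ≥ δ^(m-s) b^s for 0 ≤ s ≤ m. The sum of w b^(-s) is finite for s < κ/ν,
and the remaining power δ^(p+s-m) vanishes for s > m - p; the hypothesis on p makes both possible.
-/
theorem tendsto_rpow_mul_tsum_zero {w b : ℕ → ℝ} {K κ ν p c : ℝ} {m : ℕ} (hw0 : ∀ k, 0 ≤ w k)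
    (hw : Summable w) (hK : 0 < K) (hκ : 0 < κ) (hν : 0 < ν) (hc : 0 < c) (hm : 0 < m)
    (hp0 : 0 < p) (hp : m - κ / ν < p)
    (ht : Tendsto (fun k : ℕ => tail w k * ((k : ℝ) + 1) ^ κ) atTop (𝓝 K))
    (hb : ∀ k : ℕ, c * ((k : ℝ) + 1) ^ (-ν) ≤ b k) :
    Tendsto (fun δ : ℝ => δ ^ p * ∑' k, w k / (δ + b k) ^ m) (𝓝[>] 0) (𝓝 0) := by
  have hm' : (0 : ℝ) < m := by exact_mod_cast hm
  obtain ⟨s, hs1, hs2⟩ : ∃ s, max 0 (m - p) < s ∧ s < min (m : ℝ) (κ / ν) := by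
    refine exists_between (max_lt (lt_min hm' (by positivity)) (lt_min (by linarith) (by linarith)))
  rw [max_lt_iff] at hs1
  rw [lt_min_iff] at hs2
  have hsum := summable_mul_rpow hw0 hw hK hκ (mul_pos hν hs1.1).le
    (by rw [mul_comm]; exact (lt_div_iff₀ hν).1 hs2.2) ht
  have hb0 : ∀ k, 0 < b k := fun k => lt_of_lt_of_le (by positivity) (hb k)
  set Z := ∑' k : ℕ, w k * ((k : ℝ) + 1) ^ (ν * s) with hZ
  refine squeeze_zero' (g := fun δ : ℝ => δ ^ (p + s - m) * (c ^ (-s) * Z)) ?_ ?_ ?_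
  · filter_upwards [self_mem_nhdsWithin] with δ hδ
    have : (0 : ℝ) < δ := hδ
    refine mul_nonneg (by positivity) (tsum_nonneg fun k => ?_)
    have := hw0 k; have := hb0 k; positivity
  · filter_upwards [self_mem_nhdsWithin] with δ hδ
    have hδ : (0 : ℝ) < δ := hδ
    rw [show p + s - m = p + (s - m) by ring, Real.rpow_add hδ, mul_assoc]
    refine mul_le_mul_of_nonneg_left ?_ (by positivity)
    rw [hZ, ← mul_assoc, ← tsum_mul_left]
    refine (summable_div_pow hw0 hw (fun k => (hb0 k).le) hδ m).tsum_le_tsum (fun k => ?_)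
      (hsum.mul_left _)
    have hk : (0 : ℝ) < (k : ℝ) + 1 := by positivity
    have hbk := hb0 k
    have h1 : δ ^ (m - s) * (c ^ s * ((k : ℝ) + 1) ^ (-(ν * s))) ≤ (δ + b k) ^ m := by
      have e : (δ + b k) ^ m = (δ + b k) ^ (m - s) * (δ + b k) ^ s := by
        rw [← Real.rpow_add (by positivity), ← Real.rpow_natCast]; congr 1; ring
      have e2 : c ^ s * ((k : ℝ) + 1) ^ (-(ν * s)) = (c * ((k : ℝ) + 1) ^ (-ν)) ^ s := by
        rw [Real.mul_rpow hc.le (by positivity), ← Real.rpow_mul hk.le]; congr 2; ring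
      rw [e, e2]
      refine mul_le_mul (Real.rpow_le_rpow hδ.le (by linarith) (by linarith))
        (Real.rpow_le_rpow (by positivity) ((hb k).trans (by linarith)) hs1.1.le) (by positivity)
        (by positivity)
    calc w k / (δ + b k) ^ m ≤ w k / (δ ^ (m - s) * (c ^ s * ((k : ℝ) + 1) ^ (-(ν * s)))) := by
          have := hw0 k
          gcongr
      _ = _ := by
        rw [show s - (m : ℝ) = -(m - s) by ring, Real.rpow_neg hδ.le, Real.rpow_neg hc.le,
          Real.rpow_neg hk.le]
        have e1 : δ ^ ((m : ℝ) - s) ≠ 0 := by positivity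
        have e2 : c ^ s ≠ 0 := by positivity
        field_simp
  · have : Tendsto (fun δ : ℝ => δ ^ (p + s - m)) (𝓝[>] 0) (𝓝 0) := by
      have := (Real.continuousAt_rpow_const 0 (p + s - m) (Or.inr (by linarith))).tendsto
      rw [Real.zero_rpow (by linarith)] at this
      exact this.mono_left nhdsWithin_le_nhds
    simpa using this.mul_const _

end SESGD

/-! ### The resolvent of the main term in closed form -/

namespace SESGD

/-- The coefficient on the first entry in the numerator of the `(1, 1)` entry of
`(1 - z B · Bᵀ)⁻¹`, where `B = (1 - a, β; -a, β)`. -/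
noncomputable def coefC (β a z : ℝ) : ℝ :=
  (1 + β ^ 2 * z) * (1 + β * z) - 2 * β * z * (1 + β - a)

/-- The coefficient on the mean of the off-diagonal entries in the same numerator. -/
noncomputable def coefJ (β a z : ℝ) : ℝ := 2 * β * z * ((1 + β - a) - β * (1 + β * z))

/-- The coefficient on the last entry in the same numerator. -/
noncomputable def coefV (β z : ℝ) : ℝ := β ^ 2 * z * (1 + β * z)

/-- The discriminant factor `(1 - z r₁²) (1 - z r₂²)` for the eigenvalues `r₁, r₂` of `B`. -/
noncomputable def disc (β a z : ℝ) : ℝ := (1 + β * z) ^ 2 - (1 + β - a) ^ 2 * z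

/-- The denominator of the resolvent of the main term, at `a = α l` and `σ = τ γ`. -/
noncomputable def resDenom (β σ a z : ℝ) : ℝ :=
  (1 - β * z) * disc β a z + σ * a ^ 2 * z * (1 + β * z)

/-- The numerator of the resolvent of the main term. -/
noncomputable def resNum (β a z : ℝ) (M : Mat2) : ℝ :=
  coefC β a z * M 0 0 + coefJ β a z * ((M 0 1 + M 1 0) / 2) + coefV β z * M 1 1

theorem mainOp_apply (α β γ τ l : ℝ) (M : Mat2) :
    mainOp α β γ τ l M = !![
      (1 - α * l) ^ 2 * M 0 0 + (1 - α * l) * β * (M 0 1 + M 1 0) + β ^ 2 * M 1 1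
        - τ * γ * (α * l) ^ 2 * M 0 0,
      -(1 - α * l) * (α * l) * M 0 0 + (1 - α * l) * β * M 0 1 - β * (α * l) * M 1 0
        + β ^ 2 * M 1 1 - τ * γ * (α * l) ^ 2 * M 0 0;
      -(1 - α * l) * (α * l) * M 0 0 - β * (α * l) * M 0 1 + (1 - α * l) * β * M 1 0
        + β ^ 2 * M 1 1 - τ * γ * (α * l) ^ 2 * M 0 0,
      (α * l) ^ 2 * M 0 0 - (α * l) * β * (M 0 1 + M 1 0) + β ^ 2 * M 1 1
        - τ * γ * (α * l) ^ 2 * M 0 0] := by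
  ext i j
  simp only [mainOp, LinearMap.sub_apply, LinearMap.smul_apply, LinearMap.comp_apply,
    LinearMap.mulLeft_apply, LinearMap.mulRight_apply, Matrix.sub_apply, Matrix.smul_apply,
    Matrix.mul_apply, Fin.sum_univ_two, Matrix.transpose_apply, smul_eq_mul]
  fin_cases i <;> fin_cases j <;> simp [stepMatrix, leftOnes] <;> ring

/-- This is Cramer's rule for the first entry, written without inverting anything. It yields both
the resolvent at z = 1 and, applied along the recursion, the truncated identity for the moments. -/
theorem resNum_sub_smul (α β γ τ l z : ℝ) (M : Mat2) :
    resNum β (α * l) z (M - z • mainOp α β γ τ l M) = resDenom β (τ * γ) (α * l) z * M 0 0 := by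
  rw [mainOp_apply]
  simp [resNum, resDenom, disc, coefC, coefJ, coefV]
  ring

theorem resNum_add (β a z : ℝ) (M N : Mat2) :
    resNum β a z (M + N) = resNum β a z M + resNum β a z N := by
  simp [resNum]; ring

theorem resNum_smul (β a z r : ℝ) (M : Mat2) :
    resNum β a z (r • M) = r * resNum β a z M := by
  simp [resNum]; ring

theorem resNum_allOnes (β a z : ℝ) : resNum β a z allOnes = 1 + β * z := by
  simp [resNum, allOnes, coefC, coefJ, coefV]; ring

theorem resNum_unit11 (β a z : ℝ) : resNum β a z unit11 = coefC β a z := by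
  simp [resNum, unit11]

/-- In this form both summands are nonnegative for admissible parameters, and the orders 1 - z and a
of the denominator near (a, z) = (0, 1) are visible. -/
theorem disc_eq (β a z : ℝ) :
    disc β a z = (1 - z) * (1 - β ^ 2 * z) + a * z * (2 * (1 + β) - a) := by
  unfold disc; ring

/-- The admissible parameters: `|β| < 1`, `0 < a < 2 (1 + β)`, `0 < z ≤ 1`. -/
structure Admissible (β a z : ℝ) : Prop where
  neg_one_lt : -1 < β
  lt_one : β < 1
  pos : 0 < a
  lt : a < 2 * (1 + β)
  z_pos : 0 < z
  z_le : z ≤ 1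

namespace Admissible

variable {β a z : ℝ}

theorem one_add_pos (h : Admissible β a z) : 0 < 1 + β * z := by
  nlinarith [h.neg_one_lt, h.z_pos, h.z_le, h.lt_one]

theorem one_sub_pos (h : Admissible β a z) : 0 < 1 - β * z := by
  nlinarith [h.neg_one_lt, h.z_pos, h.z_le, h.lt_one]

theorem disc_pos (h : Admissible β a z) : 0 < disc β a z := by
  rw [disc_eq]
  have h1 := h.one_add_pos
  have h2 := h.one_sub_pos
  have h3 : 0 < 1 - β ^ 2 * z := by
    nlinarith [h.neg_one_lt, h.lt_one, h.z_pos, h.z_le, sq_nonneg β]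
  have h4 := mul_pos (mul_pos h.pos h.z_pos) (sub_pos.2 h.lt)
  have h5 := mul_nonneg (sub_nonneg.2 h.z_le) h3.le
  linarith

theorem resDenom_pos (h : Admissible β a z) {σ : ℝ} (hσ : 0 ≤ σ) : 0 < resDenom β σ a z := by
  have h1 := h.one_add_pos
  have h2 := h.one_sub_pos
  have h3 := h.disc_pos
  have h4 := h.z_pos
  unfold resDenom
  positivity

/-- Multiplication by 1 + β z > 0 turns the coefficient into the discriminant plus z times a square.
-/
theorem coefC_pos (h : Admissible β a z) : 0 < coefC β a z := by
  have h1 := h.one_add_pos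
  have h3 := h.disc_pos
  unfold disc at h3
  have h4 := h.z_pos
  have key : coefC β a z * (1 + β * z) = disc β a z + z * ((1 + β - a) - β * (1 + β * z)) ^ 2 := by
    unfold coefC disc; ring
  have : 0 < coefC β a z * (1 + β * z) := by
    rw [key]; have := h.disc_pos; positivity
  exact pos_of_mul_pos_left this h1.le

/-- The functional is the pairing of M with the symmetric matrix of entries `coefC`, `coefJ`/2,
`coefV`. That matrix is positive semidefinite, its determinant being β² z · `disc`, and two positive
semidefinite matrices pair nonnegatively. -/
theorem resNum_nonneg (h : Admissible β a z) {M : Mat2}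
    (hM : ∀ x y : ℝ, 0 ≤ x ^ 2 * M 0 0 + x * y * (M 0 1 + M 1 0) + y ^ 2 * M 1 1) :
    0 ≤ resNum β a z M := by
  have hC := h.coefC_pos
  have h1 := hM (coefC β a z) (coefJ β a z / 2)
  have h2 : 0 ≤ M 1 1 := by simpa using hM 0 1
  have key : 4 * (coefC β a z * coefV β z) - coefJ β a z ^ 2 = 4 * β ^ 2 * z * disc β a z := by
    unfold coefC coefJ coefV disc; ring
  have h3 : 0 ≤ 4 * β ^ 2 * z * disc β a z * M 1 1 := by
    have := h.disc_pos; have := h.z_pos; positivity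
  -- The form at (`coefC`, `coefJ`/2) plus a quarter of this term equals `coefC` times the
  -- functional.
  rw [← key] at h3
  have : 0 ≤ coefC β a z * resNum β a z M := by unfold resNum; nlinarith
  exact nonneg_of_mul_nonneg_right this hC

end Admissible

/-- In finite dimension injectivity suffices. The Cramer identity kills the first entry of a fixed
point, and with it the τγ term; a small linear system remains. -/
theorem isUnit_one_sub_mainOp {α β γ τ l : ℝ} (h : Admissible β (α * l) 1) (hσ : 0 ≤ τ * γ) :
    IsUnit (1 - (1 : ℝ) • mainOp α β γ τ l : Module.End ℝ Mat2) := by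
  rw [LinearMap.isUnit_iff_ker_eq_bot, LinearMap.ker_eq_bot']
  intro M hM
  have hM' : M - (1 : ℝ) • mainOp α β γ τ l M = 0 := hM
  have h00 : M 0 0 = 0 := by
    have h1 := resNum_sub_smul α β γ τ l 1 M
    rw [hM'] at h1
    have h2 : resNum β (α * l) 1 0 = 0 := by simp [resNum]
    rw [h2] at h1
    exact (mul_eq_zero.1 h1.symm).resolve_left (h.resDenom_pos hσ).ne'
  rw [one_smul, mainOp_apply, h00] at hM'
  have e00 := congrFun (congrFun hM' 0) 0
  have e01 := congrFun (congrFun hM' 0) 1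
  have e10 := congrFun (congrFun hM' 1) 0
  have e11 := congrFun (congrFun hM' 1) 1
  simp only [Matrix.sub_apply, Matrix.zero_apply, Matrix.of_apply, Matrix.cons_val', Matrix.cons_val_zero,
    Matrix.cons_val_one, Matrix.cons_val_fin_one, h00] at e00 e01 e10 e11
  -- The antisymmetric part is multiplied by the determinant of the step matrix, which is β ≠ 1.
  have hsymm : M 0 1 = M 1 0 := by
    have : (M 0 1 - M 1 0) * (1 - β) = 0 := by linear_combination e01 - e10
    have := (mul_eq_zero.1 this).resolve_right (by linarith [h.lt_one])
    linarith
  have hV : M 1 1 = 2 * M 0 1 := by linear_combination e00 - e01 - e10 + e11 - hsymm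
  have h1 : M 0 1 * (1 - β ^ 2 + β * (α * l)) = 0 := by
    rw [← hsymm, hV] at e11; linear_combination e11 / 2
  have h2 : M 0 1 * (β * (1 + β - α * l)) = 0 := by
    rw [← hsymm, hV] at e00; linear_combination -e00 / 2
  have h3 : M 0 1 * (1 + β) = 0 := by linear_combination h1 + h2
  have h01 : M 0 1 = 0 := (mul_eq_zero.1 h3).resolve_right (by linarith [h.neg_one_lt])
  ext i j
  fin_cases i <;> fin_cases j <;> simp [h00, h01, ← hsymm, hV]

/-- `Ring.inverse` is zero at non-units, so invertibility must be known first. It is needed only at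
z = 1, the one point where the theorem evaluates the generating functions. -/
theorem resolventEntry_one {α β γ τ l : ℝ} (h : Admissible β (α * l) 1) (hσ : 0 ≤ τ * γ)
    (M : Mat2) :
    resolventEntry α β γ τ l 1 M
      = resNum β (α * l) 1 M / resDenom β (τ * γ) (α * l) 1 := by
  have hu := isUnit_one_sub_mainOp h hσ
  set L : Module.End ℝ Mat2 := 1 - (1 : ℝ) • mainOp α β γ τ l with hL
  have h1 : L (Ring.inverse L M) = M := by
    have := Ring.mul_inverse_cancel L hu
    rw [← Module.End.mul_apply, this, Module.End.one_apply]
  have h2 := resNum_sub_smul α β γ τ l 1 (Ring.inverse L M)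
  have h3 : L (Ring.inverse L M)
      = Ring.inverse L M - (1 : ℝ) • mainOp α β γ τ l (Ring.inverse L M) := by
    rw [hL]; rfl
  rw [← h3, h1] at h2
  rw [h2, resolventEntry, ← hL, mul_div_cancel_left₀ _ (h.resDenom_pos hσ).ne']

end SESGD

/-! ### Positivity of the moments and the renewal equation -/

namespace SESGD

/-- Admissible SGD parameters for a summable spectrum that stays away from the stability edge. -/
structure IsStable (α β γ τ : ℝ) (lam c : ℕ → ℝ) : Prop where
  lam_pos : ∀ k, 0 < lam k
  c_nonneg : ∀ k, 0 ≤ c k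
  summable_lam : Summable lam
  summable_mul : Summable fun k => lam k * c k
  τ_nonneg : 0 ≤ τ
  τ_le : τ ≤ 1
  γ_nonneg : 0 ≤ γ
  α_pos : 0 < α
  neg_one_lt : -1 < β
  lt_one : β < 1
  exists_lt : ∃ A, A < 2 * (1 + β) ∧ ∀ k, α * lam k ≤ A

/-- The trace `∑ λ C`, twice the average loss. -/
noncomputable def energy (α β γ τ : ℝ) (lam c : ℕ → ℝ) (t : ℕ) : ℝ :=
  ∑' k, lam k * moments α β γ τ lam c t k 0 0

/-- The `k`-th term of the signal generating function. -/
noncomputable def signalTerm (α β γ τ : ℝ) (lam c : ℕ → ℝ) (k : ℕ) (z : ℝ) : ℝ :=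
  lam k * c k * (coefC β (α * lam k) z / resDenom β (τ * γ) (α * lam k) z)

/-- The `k`-th term of `z` times the noise generating function. -/
noncomputable def noiseTerm (α β γ τ : ℝ) (lam : ℕ → ℝ) (k : ℕ) (z : ℝ) : ℝ :=
  γ * (α * lam k) ^ 2 * (z * (1 + β * z) / resDenom β (τ * γ) (α * lam k) z)

theorem mul_summable_of_bounded {f g : ℕ → ℝ} {M : ℝ} (hf : Summable f) (hg : ∀ k, |g k| ≤ M) :
    Summable fun k => g k * f k := by
  refine Summable.of_norm_bounded (hf.norm.mul_left M) fun k => ?_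
  rw [norm_mul]
  exact mul_le_mul_of_nonneg_right (hg k) (norm_nonneg _)

theorem Admissible.coefC_le {β a z : ℝ} (ha : Admissible β a z) : coefC β a z ≤ 8 := by
  have hβ : |β| ≤ 1 := (abs_lt.2 ⟨ha.neg_one_lt, ha.lt_one⟩).le
  have hβz : |β * z| ≤ 1 := by
    rw [abs_mul, abs_of_pos ha.z_pos]; nlinarith [abs_nonneg β, ha.z_le]
  have hT : |1 + β - a| ≤ 2 := by
    rw [abs_le]; constructor <;> linarith [ha.pos, ha.lt, ha.lt_one]
  have hβ1 : |1 + β * z| ≤ 2 := (abs_add_le _ _).trans (by rw [abs_one]; linarith)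
  have e1 : |β * (β * z)| ≤ 1 := by
    rw [abs_mul]; exact mul_le_one₀ hβ (abs_nonneg _) hβz
  have e2 : |(1 + β * (β * z)) * (1 + β * z)| ≤ 2 * 2 := by
    rw [abs_mul]
    refine mul_le_mul ((abs_add_le _ _).trans (by rw [abs_one]; linarith)) hβ1 (abs_nonneg _)
      (by norm_num)
  have e3 : |β * z * (1 + β - a)| ≤ 1 * 2 := by
    rw [abs_mul]; exact mul_le_mul hβz hT (abs_nonneg _) zero_le_one
  have e : coefC β a z = (1 + β * (β * z)) * (1 + β * z)
      - 2 * (β * z * (1 + β - a)) := by unfold coefC; ring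
  rw [e]
  have := (abs_le.1 e2).2; have := (abs_le.1 e3).1; linarith

namespace IsStable

variable {α β γ τ : ℝ} {lam c : ℕ → ℝ}

theorem admissible (h : IsStable α β γ τ lam c) (k : ℕ) {z : ℝ} (h0 : 0 < z) (h1 : z ≤ 1) :
    Admissible β (α * lam k) z := by
  obtain ⟨A, hA, hk⟩ := h.exists_lt
  exact ⟨h.neg_one_lt, h.lt_one, mul_pos h.α_pos (h.lam_pos k), (hk k).trans_lt hA, h0, h1⟩

theorem σ_nonneg (h : IsStable α β γ τ lam c) : 0 ≤ τ * γ := mul_nonneg h.τ_nonneg h.γ_nonneg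

theorem lt_four (h : IsStable α β γ τ lam c) (k : ℕ) : α * lam k < 4 := by
  have := (h.admissible k one_pos le_rfl).lt; linarith [h.lt_one]

theorem summable_sq (h : IsStable α β γ τ lam c) : Summable fun k => (α * lam k) ^ 2 := by
  refine Summable.of_nonneg_of_le (fun k => by positivity) (fun k => ?_)
    ((h.summable_lam.mul_left α).mul_left 4)
  have h1 := h.lt_four k
  have h2 := mul_pos h.α_pos (h.lam_pos k)
  nlinarith

/-- The bound comes from `disc_eq`, the nonnegative τγ term being dropped. Its uniformity in k rests
on the gap between A and 2(1+β); z ≥ 1/2 handles the factor z. -/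
theorem exists_resDenom_ge (h : IsStable α β γ τ lam c) :
    ∃ d, 0 < d ∧ ∀ k, ∀ z : ℝ, 1 / 2 ≤ z → z ≤ 1 →
      d * ((1 - z) + α * lam k) ≤ resDenom β (τ * γ) (α * lam k) z := by
  obtain ⟨A, hA, hk⟩ := h.exists_lt
  have hβ : |β| < 1 := abs_lt.2 ⟨h.neg_one_lt, h.lt_one⟩
  have hβ2 : β ^ 2 < 1 := by rw [← sq_abs]; nlinarith [abs_nonneg β]
  set m := min (1 - β ^ 2) ((2 * (1 + β) - A) / 2) with hm
  have hm0 : 0 < m := lt_min (by linarith) (by linarith)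
  have hm1 : m ≤ 1 - β ^ 2 := min_le_left _ _
  have hm2 : m ≤ (2 * (1 + β) - A) / 2 := min_le_right _ _
  refine ⟨(1 - |β|) * m, mul_pos (by linarith) hm0, fun k z hz0 hz1 => ?_⟩
  have ha := h.admissible k (by linarith) hz1
  have h1 : 1 - |β| ≤ 1 - β * z := by
    have : β * z ≤ |β| := by
      calc β * z ≤ |β * z| := le_abs_self _
        _ = |β| * z := by rw [abs_mul, abs_of_pos ha.z_pos]
        _ ≤ |β| := mul_le_of_le_one_right (abs_nonneg β) hz1
    linarith
  have h2 : m * ((1 - z) + α * lam k) ≤ disc β (α * lam k) z := by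
    rw [disc_eq, mul_add]
    refine add_le_add ?_ ?_
    · rw [mul_comm]
      refine mul_le_mul_of_nonneg_left (hm1.trans ?_) (by linarith)
      nlinarith [sq_nonneg β]
    · have e1 : m ≤ z * (2 * (1 + β) - α * lam k) := by
        have := hk k
        nlinarith
      have := ha.pos
      nlinarith
  have h3 : (1 - |β|) * (m * ((1 - z) + α * lam k)) ≤ (1 - β * z) * disc β (α * lam k) z :=
    mul_le_mul h1 h2 (mul_nonneg hm0.le (by linarith [ha.pos])) ha.one_sub_pos.le
  have h4 : 0 ≤ τ * γ * (α * lam k) ^ 2 * z * (1 + β * z) := by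
    have := h.σ_nonneg; have := ha.z_pos; have := ha.one_add_pos; positivity
  unfold resDenom
  rw [mul_assoc]; linarith

/-- This ensures that the energies are genuine sums and not the default value of `tsum`. The
coefficients of the recursion are polynomials in α λ_k, hence bounded on [0, 4], and the noise adds
a multiple of λ_k², which is summable. -/
theorem summable_moments (h : IsStable α β γ τ lam c) (t : ℕ) :
    (Summable fun k => lam k * moments α β γ τ lam c t k 0 0) ∧
    (Summable fun k => lam k * (moments α β γ τ lam c t k 0 1 + moments α β γ τ lam c t k 1 0)) ∧
    Summable fun k => lam k * moments α β γ τ lam c t k 1 1 := by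
  induction t with
  | zero => simpa [moments, unit11] using h.summable_mul
  | succ t ih =>
    obtain ⟨hC, hJ, hV⟩ := ih
    have ha0 : ∀ k, 0 < α * lam k := fun k => mul_pos h.α_pos (h.lam_pos k)
    have ha : ∀ k, α * lam k < 4 := h.lt_four
    have hd : Summable fun k => lam k * (γ * α ^ 2 * lam k
        * ∑' l, lam l * moments α β γ τ lam c t l 0 0) := by
      refine (h.summable_sq.mul_left (γ * ∑' l, lam l * moments α β γ τ lam c t l 0 0)).congr
        fun k => ?_
      ring
    have hbd : ∀ p : ℝ → ℝ, Continuous p → ∀ f : ℕ → ℝ, Summable f →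
        Summable fun k => p (α * lam k) * f k := by
      intro p hp f hf
      obtain ⟨M, hM⟩ := isCompact_Icc.exists_bound_of_continuousOn (s := Set.Icc (0 : ℝ) 4)
        hp.continuousOn
      exact mul_summable_of_bounded hf fun k => hM _ ⟨(ha0 k).le, (ha k).le⟩
    simp only [moments, mainOp_apply, noiseOp, allOnes, Matrix.add_apply, Matrix.smul_apply,
      Matrix.of_apply, Matrix.cons_val', Matrix.cons_val_zero, Matrix.cons_val_one,
      Matrix.cons_val_fin_one, smul_eq_mul, mul_one]
    refine ⟨?_, ?_, ?_⟩
    · refine ((((hbd (fun a => (1 - a) ^ 2 - τ * γ * a ^ 2) (by fun_prop) _ hC).add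
        (hbd (fun a => (1 - a) * β) (by fun_prop) _ hJ)).add
        (hbd (fun _ => β ^ 2) (by fun_prop) _ hV)).add hd).congr fun k => ?_
      ring
    · refine ((((hbd (fun a => -2 * (1 - a) * a - 2 * (τ * γ) * a ^ 2) (by fun_prop) _ hC).add
        (hbd (fun a => (1 - a) * β - β * a) (by fun_prop) _ hJ)).add
        (hbd (fun _ => 2 * β ^ 2) (by fun_prop) _ hV)).add (hd.mul_left 2)).congr fun k => ?_
      ring
    · refine ((((hbd (fun a => a ^ 2 - τ * γ * a ^ 2) (by fun_prop) _ hC).add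
        (hbd (fun a => -(a * β)) (by fun_prop) _ hJ)).add
        (hbd (fun _ => β ^ 2) (by fun_prop) _ hV)).add hd).congr fun k => ?_
      ring

/-- Here τ ≤ 1 is essential: the negative part of the main term is absorbed by the contribution of
the same index k to the noise sum. -/
theorem moments_psd (h : IsStable α β γ τ lam c) (t : ℕ) : ∀ k, ∀ x y : ℝ,
    0 ≤ x ^ 2 * moments α β γ τ lam c t k 0 0
      + x * y * (moments α β γ τ lam c t k 0 1 + moments α β γ τ lam c t k 1 0)
      + y ^ 2 * moments α β γ τ lam c t k 1 1 := by
  induction t with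
  | zero =>
    intro k x y
    have := h.c_nonneg k
    simp [moments, unit11]
    positivity
  | succ t ih =>
    intro k x y
    have hC : ∀ l, 0 ≤ lam l * moments α β γ τ lam c t l 0 0 := fun l =>
      mul_nonneg (h.lam_pos l).le (by simpa using ih l 1 0)
    have hS : lam k * moments α β γ τ lam c t k 0 0
        ≤ ∑' l, lam l * moments α β γ τ lam c t l 0 0 :=
      (h.summable_moments t).1.le_tsum k fun l _ => hC l
    -- The test vector is the transposed step matrix applied to (x, y).
    have h1 := ih k (x * (1 - α * lam k) - y * (α * lam k)) (β * (x + y))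
    have h2 : 0 ≤ (x + y) ^ 2 * (γ * α ^ 2 * lam k) * (∑' l, lam l * moments α β γ τ lam c t l 0 0
        - τ * (lam k * moments α β γ τ lam c t k 0 0)) := by
      refine mul_nonneg ?_ ?_
      · have := h.γ_nonneg; have := (h.lam_pos k).le; positivity
      · have := hC k
        have := h.τ_le
        nlinarith
    simp only [moments, mainOp_apply, noiseOp, allOnes, Matrix.add_apply, Matrix.smul_apply,
      Matrix.of_apply, Matrix.cons_val', Matrix.cons_val_zero, Matrix.cons_val_one,
      Matrix.cons_val_fin_one, smul_eq_mul, mul_one]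
    refine (add_nonneg h1 h2).trans_eq ?_
    ring

theorem moments_nonneg (h : IsStable α β γ τ lam c) (t k : ℕ) :
    0 ≤ moments α β γ τ lam c t k 0 0 := by simpa using h.moments_psd t k 1 0

theorem energy_nonneg (h : IsStable α β γ τ lam c) (t : ℕ) : 0 ≤ energy α β γ τ lam c t :=
  tsum_nonneg fun k => mul_nonneg (h.lam_pos k).le (h.moments_nonneg t k)

/-- The new momentum is the displacement: (1, -1) times the step matrix is (1, 0), while (1, -1)
annihilates the noise and the correction term. -/
theorem moments_succ_relation (t k : ℕ) :
    moments α β γ τ lam c (t + 1) k 0 0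
      - (moments α β γ τ lam c (t + 1) k 0 1 + moments α β γ τ lam c (t + 1) k 1 0)
      + moments α β γ τ lam c (t + 1) k 1 1 = moments α β γ τ lam c t k 0 0 := by
  simp only [moments, mainOp_apply, noiseOp, allOnes, Matrix.add_apply, Matrix.smul_apply,
    Matrix.of_apply, Matrix.cons_val', Matrix.cons_val_zero, Matrix.cons_val_one,
    Matrix.cons_val_fin_one, smul_eq_mul, mul_one]
  ring

theorem resNum_moments_le (h : IsStable α β γ τ lam c) (t k : ℕ) {z : ℝ} (h0 : 0 < z)
    (h1 : z ≤ 1) :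
    resNum β (α * lam k) z (moments α β γ τ lam c (t + 1) k)
      ≤ 24 * (moments α β γ τ lam c t k 0 0 + moments α β γ τ lam c (t + 1) k 0 0) := by
  have ha := h.admissible k h0 h1
  have hrel := moments_succ_relation (α := α) (β := β) (γ := γ) (τ := τ) (lam := lam) (c := c) t k
  -- Combined with `hrel`, the test vector (2, -1) gives V ≤ 2 (C_t + C_{t+1}), so the momentum is
  -- controlled by positions alone. The constant 24 comes from 12 C + 6 V.
  have p1 := h.moments_psd (t + 1) k 2 (-1)
  have p2 := h.moments_psd (t + 1) k 1 1
  have p3 := h.moments_psd (t + 1) k 1 (-1)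
  have p4 := h.moments_psd (t + 1) k 0 1
  have p5 := h.moments_nonneg (t + 1) k
  set C := moments α β γ τ lam c (t + 1) k 0 0
  set J := moments α β γ τ lam c (t + 1) k 0 1 + moments α β γ τ lam c (t + 1) k 1 0 with hJ
  set V := moments α β γ τ lam c (t + 1) k 1 1
  have hβ : |β| ≤ 1 := (abs_lt.2 ⟨ha.neg_one_lt, ha.lt_one⟩).le
  have hβz : |β * z| ≤ 1 := by
    rw [abs_mul, abs_of_pos h0]; nlinarith [abs_nonneg β]
  have hT : |1 + β - α * lam k| ≤ 2 := by
    rw [abs_le]; constructor <;> linarith [ha.pos, ha.lt, ha.lt_one]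
  have hβ1 : |1 + β * z| ≤ 2 := (abs_add_le _ _).trans (by rw [abs_one]; linarith)
  have cC := ha.coefC_le
  have cJ : |coefJ β (α * lam k) z| ≤ 8 := by
    have e1 : |β * (1 + β * z)| ≤ 1 * 2 := by
      rw [abs_mul]; exact mul_le_mul hβ hβ1 (abs_nonneg _) zero_le_one
    have e2 : |(1 + β - α * lam k) - β * (1 + β * z)| ≤ 4 :=
      (abs_sub _ _).trans (by linarith)
    have e : coefJ β (α * lam k) z = 2 * (β * z * ((1 + β - α * lam k) - β * (1 + β * z))) := by
      unfold coefJ; ring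
    rw [e, abs_mul, abs_mul, abs_two]
    have := mul_le_mul hβz e2 (abs_nonneg _) zero_le_one
    linarith
  have cV : coefV β z ≤ 2 := by
    have e : coefV β z = (β * (β * z)) * (1 + β * z) := by unfold coefV; ring
    rw [e]
    refine (le_abs_self _).trans ?_
    rw [abs_mul, abs_mul]
    have := mul_le_mul (mul_le_one₀ hβ (abs_nonneg _) hβz) hβ1 (abs_nonneg _) zero_le_one
    linarith
  have hJb : |J| ≤ C + V := by rw [abs_le]; constructor <;> linarith
  have hV : 0 ≤ V := by linarith
  have g1 : coefC β (α * lam k) z * C ≤ 8 * C := mul_le_mul_of_nonneg_right cC p5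
  have g2 : coefV β z * V ≤ 2 * V := mul_le_mul_of_nonneg_right cV hV
  have g3 : coefJ β (α * lam k) z * (J / 2) ≤ 4 * (C + V) := by
    have e := (le_abs_self (coefJ β (α * lam k) z * J)).trans_eq (abs_mul _ _)
    have := mul_le_mul cJ hJb (abs_nonneg _) (by norm_num)
    linarith
  have hgoal : resNum β (α * lam k) z (moments α β γ τ lam c (t + 1) k)
      = coefC β (α * lam k) z * C + coefJ β (α * lam k) z * (J / 2) + coefV β z * V := rfl
  rw [hgoal]
  linarith

/-- The Cramer functional applied to the recursion telescopes. The identity is finite, so no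
convergence has to be assumed beforehand. -/
theorem truncated_identity (k : ℕ) (z : ℝ) (N : ℕ) :
    resDenom β (τ * γ) (α * lam k) z
        * ∑ t ∈ Finset.range N, moments α β γ τ lam c t k 0 0 * z ^ t
      + z ^ N * resNum β (α * lam k) z (moments α β γ τ lam c N k)
      = coefC β (α * lam k) z * c k
        + z * (1 + β * z) * (γ * α ^ 2 * lam k)
          * ∑ t ∈ Finset.range N, energy α β γ τ lam c t * z ^ t := by
  induction N with
  | zero => simp [moments, resNum_smul, resNum_unit11]; ring
  | succ N ih =>
    have h1 := resNum_sub_smul α β γ τ (lam k) z (moments α β γ τ lam c N k)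
    rw [sub_eq_add_neg, ← neg_smul, resNum_add, resNum_smul] at h1
    have h2 : resNum β (α * lam k) z (moments α β γ τ lam c (N + 1) k)
        = resNum β (α * lam k) z (mainOp α β γ τ (lam k) (moments α β γ τ lam c N k))
          + γ * α ^ 2 * lam k * energy α β γ τ lam c N * (1 + β * z) := by
      simp only [moments, noiseOp, resNum_add, resNum_smul, resNum_allOnes]; rfl
    rw [Finset.sum_range_succ, Finset.sum_range_succ, h2]
    linear_combination ih - z ^ N * h1

theorem exists_term_bounds (h : IsStable α β γ τ lam c) :
    ∃ M, 0 < M ∧ ∀ k, ∀ z : ℝ, 1 / 2 ≤ z → z ≤ 1 →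
      (0 ≤ signalTerm α β γ τ lam c k z ∧
        signalTerm α β γ τ lam c k z ≤ lam k * c k * (M / ((1 - z) + α * lam k))) ∧
      (0 ≤ noiseTerm α β γ τ lam k z ∧
        noiseTerm α β γ τ lam k z ≤ γ * (α * lam k) ^ 2 * (M / ((1 - z) + α * lam k))) := by
  obtain ⟨d, hd, hden⟩ := h.exists_resDenom_ge
  refine ⟨8 / d, by positivity, fun k z h0 h1 => ?_⟩
  have ha := h.admissible k (by linarith) h1
  have hp := ha.pos
  have hz := ha.z_pos
  have hC := ha.coefC_pos
  have hD := ha.resDenom_pos h.σ_nonneg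
  have hβ := ha.one_add_pos
  have hl := (h.lam_pos k).le
  have hc := h.c_nonneg k
  have hγ := h.γ_nonneg
  have hq : 0 < (1 - z) + α * lam k := by linarith
  unfold signalTerm noiseTerm
  refine ⟨⟨by positivity, ?_⟩, ⟨by positivity, ?_⟩⟩
  · rw [div_div]
    refine mul_le_mul_of_nonneg_left ?_ (by positivity)
    exact div_le_div₀ (by norm_num) ha.coefC_le (by positivity) (hden k z h0 h1)
  · rw [div_div]
    refine mul_le_mul_of_nonneg_left ?_ (by positivity)
    refine div_le_div₀ (by norm_num) ?_ (by positivity) (hden k z h0 h1)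
    nlinarith [ha.lt_one, ha.z_le]

theorem summable_signalTerm (h : IsStable α β γ τ lam c) {z : ℝ} (h0 : 1 / 2 ≤ z) (h1 : z < 1) :
    Summable fun k => signalTerm α β γ τ lam c k z := by
  obtain ⟨M, hM, hb⟩ := h.exists_term_bounds
  refine Summable.of_nonneg_of_le (fun k => (hb k z h0 h1.le).1.1) (fun k => ?_)
    (h.summable_mul.mul_right (M / (1 - z)))
  refine (hb k z h0 h1.le).1.2.trans (mul_le_mul_of_nonneg_left ?_
    (mul_nonneg (h.lam_pos k).le (h.c_nonneg k)))
  have : 0 < 1 - z := by linarith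
  have := (h.admissible k (by linarith) h1.le).pos
  gcongr; linarith

theorem exists_noiseTerm_le (h : IsStable α β γ τ lam c) :
    ∃ M, ∀ k, ∀ z : ℝ, 1 / 2 ≤ z → z ≤ 1 → noiseTerm α β γ τ lam k z ≤ M * lam k := by
  obtain ⟨M, hM, hb⟩ := h.exists_term_bounds
  refine ⟨γ * M * α, fun k z h0 h1 => (hb k z h0 h1).2.2.trans ?_⟩
  have hp := (h.admissible k (by linarith) h1).pos
  have hγ := h.γ_nonneg
  calc γ * (α * lam k) ^ 2 * (M / ((1 - z) + α * lam k))
      ≤ γ * (α * lam k) ^ 2 * (M / (α * lam k)) := by gcongr; linarith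
    _ = γ * M * α * lam k := by
      rw [show γ * (α * lam k) ^ 2 * (M / (α * lam k))
        = γ * M * ((α * lam k) ^ 2 / (α * lam k)) by ring, pow_two, mul_div_assoc, div_self hp.ne']
      ring

theorem noiseTerm_nonneg (h : IsStable α β γ τ lam c) (k : ℕ) {z : ℝ} (h0 : 1 / 2 ≤ z)
    (h1 : z ≤ 1) : 0 ≤ noiseTerm α β γ τ lam k z := by
  obtain ⟨M, hM, hb⟩ := h.exists_term_bounds
  exact (hb k z h0 h1).2.1

theorem summable_noiseTerm (h : IsStable α β γ τ lam c) {z : ℝ} (h0 : 1 / 2 ≤ z) (h1 : z ≤ 1) :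
    Summable fun k => noiseTerm α β γ τ lam k z := by
  obtain ⟨M, hb⟩ := h.exists_noiseTerm_le
  exact Summable.of_nonneg_of_le (fun k => h.noiseTerm_nonneg k h0 h1) (fun k => hb k z h0 h1)
    (h.summable_lam.mul_left M)

/-- The renewal equation for the generating function of the losses. -/
theorem renewal (h : IsStable α β γ τ lam c) {z : ℝ} (h0 : 1 / 2 ≤ z) (h1 : z < 1)
    (hG : ∑' k, noiseTerm α β γ τ lam k z < 1) :
    (Summable fun t : ℕ => energy α β γ τ lam c t * z ^ t) ∧
    (∑' t : ℕ, energy α β γ τ lam c t * z ^ t) * (1 - ∑' k, noiseTerm α β γ τ lam k z)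
      = ∑' k, signalTerm α β γ τ lam c k z := by
  have hz0 : 0 < z := by linarith
  have ha := fun k => h.admissible k hz0 h1.le
  have hD := fun k => (ha k).resDenom_pos h.σ_nonneg
  obtain ⟨d, hd, hden⟩ := h.exists_resDenom_ge
  have hsF := h.summable_signalTerm h0 h1
  have hsG := h.summable_noiseTerm h0 h1.le
  set F := ∑' k, signalTerm α β γ τ lam c k z with hFdef
  set G := ∑' k, noiseTerm α β γ τ lam k z with hGdef
  set S : ℕ → ℝ := fun N => ∑ t ∈ Finset.range N, energy α β γ τ lam c t * z ^ t with hS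
  -- This is the remainder of the truncated identity in direction k, scaled so that summation over k
  -- produces energies.
  set r : ℕ → ℕ → ℝ := fun N k => lam k * (z ^ N
    * resNum β (α * lam k) z (moments α β γ τ lam c N k)) / resDenom β (τ * γ) (α * lam k) z with hr
  have hr0 : ∀ N k, 0 ≤ r N k := by
    intro N k
    have h1 := (ha k).resNum_nonneg (h.moments_psd N k)
    have h2 := h.lam_pos k
    have h3 := hD k
    simp only [hr]
    positivity
  have hterm : ∀ N k, r N k = signalTerm α β γ τ lam c k z + noiseTerm α β γ τ lam k z * S N
      - ∑ t ∈ Finset.range N, lam k * moments α β γ τ lam c t k 0 0 * z ^ t := by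
    intro N k
    have key := truncated_identity (α := α) (β := β) (γ := γ) (τ := τ) (lam := lam) (c := c) k z N
    have h3 := (hD k).ne'
    have e : ∑ t ∈ Finset.range N, lam k * moments α β γ τ lam c t k 0 0 * z ^ t
        = lam k * ∑ t ∈ Finset.range N, moments α β γ τ lam c t k 0 0 * z ^ t := by
      rw [Finset.mul_sum]; exact Finset.sum_congr rfl fun t _ => by ring
    simp only [hr, signalTerm, noiseTerm]
    rw [e]
    generalize resDenom β (τ * γ) (α * lam k) z = D at key h3 ⊢
    generalize resNum β (α * lam k) z (moments α β γ τ lam c N k) = Q at key ⊢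
    generalize coefC β (α * lam k) z = P at key ⊢
    field_simp
    linear_combination lam k * key
  have hsC : ∀ N, Summable fun k => ∑ t ∈ Finset.range N,
      lam k * moments α β γ τ lam c t k 0 0 * z ^ t := fun N =>
    summable_sum fun t _ => (h.summable_moments t).1.mul_right _
  have hsr : ∀ N, Summable (r N) := fun N =>
    ((hsF.add (hsG.mul_right (S N))).sub (hsC N)).congr fun k => (hterm N k).symm
  have hid : ∀ N, ∑' k, r N k = F + G * S N - S N := by
    intro N
    have e : S N = ∑' k, ∑ t ∈ Finset.range N, lam k * moments α β γ τ lam c t k 0 0 * z ^ t := by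
      rw [Summable.tsum_finsetSum fun t _ => (h.summable_moments t).1.mul_right _]
      simp only [tsum_mul_right, hS]; rfl
    rw [tsum_congr (hterm N), (hsF.add (hsG.mul_right (S N))).tsum_sub (hsC N),
      hsF.tsum_add (hsG.mul_right (S N)), tsum_mul_right, ← e]
  have hen : ∀ t, 0 ≤ energy α β γ τ lam c t * z ^ t := fun t =>
    mul_nonneg (h.energy_nonneg t) (by positivity)
  -- Nonnegative remainders give S_N (1 - G) ≤ F, so the partial sums are bounded.
  have hsum : Summable fun t : ℕ => energy α β γ τ lam c t * z ^ t := by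
    refine summable_of_sum_range_le (c := F / (1 - G)) hen fun N => ?_
    rw [le_div_iff₀ (by linarith)]
    have h1 := hid N
    have h2 : 0 ≤ ∑' k, r N k := tsum_nonneg (hr0 N)
    linarith
  refine ⟨hsum, ?_⟩
  have hlim : Tendsto S atTop (𝓝 (∑' t : ℕ, energy α β γ τ lam c t * z ^ t)) :=
    hsum.hasSum.tendsto_sum_nat
  have hdz : 0 < d * (1 - z) := mul_pos hd (by linarith)
  -- The remainder is bounded by two consecutive terms of a series now known to converge, so it
  -- vanishes in the limit.
  have hrle : ∀ N, ∑' k, r (N + 1) k ≤ 24 / (d * (1 - z))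
      * (z * (energy α β γ τ lam c N * z ^ N) + energy α β γ τ lam c (N + 1) * z ^ (N + 1)) := by
    intro N
    have s1 := (h.summable_moments N).1
    have s2 := (h.summable_moments (N + 1)).1
    have hle : ∀ k, r (N + 1) k ≤ 24 / (d * (1 - z)) * z ^ (N + 1)
        * (lam k * moments α β γ τ lam c N k 0 0 + lam k * moments α β γ τ lam c (N + 1) k 0 0) := by
      intro k
      have h2 : d * (1 - z) ≤ resDenom β (τ * γ) (α * lam k) z :=
        (mul_le_mul_of_nonneg_left (by linarith [(ha k).pos]) hd.le).trans (hden k z h0 h1.le)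
      have h3 := h.resNum_moments_le N k hz0 h1.le
      have h4 := (h.lam_pos k).le
      have h5 := h.moments_nonneg N k
      have h6 := h.moments_nonneg (N + 1) k
      calc r (N + 1) k ≤ lam k * (z ^ (N + 1) * (24 * (moments α β γ τ lam c N k 0 0
            + moments α β γ τ lam c (N + 1) k 0 0))) / (d * (1 - z)) := by
            simp only [hr]; gcongr
        _ = _ := by ring
    calc _ ≤ ∑' k, 24 / (d * (1 - z)) * z ^ (N + 1) * (lam k * moments α β γ τ lam c N k 0 0
          + lam k * moments α β γ τ lam c (N + 1) k 0 0) :=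
          (hsr (N + 1)).tsum_le_tsum hle ((s1.add s2).mul_left _)
      _ = _ := by
        rw [tsum_mul_left, s1.tsum_add s2]
        simp only [energy]
        ring
  have hrlim : Tendsto (fun N => ∑' k, r (N + 1) k) atTop (𝓝 0) := by
    have t1 := hsum.tendsto_atTop_zero
    have t2 := ((t1.const_mul z).add ((tendsto_add_atTop_iff_nat 1).2 t1)).const_mul
      (24 / (d * (1 - z)))
    rw [mul_zero, add_zero, mul_zero] at t2
    exact squeeze_zero (fun N => tsum_nonneg (hr0 _)) hrle t2
  have hrlim' : Tendsto (fun N => ∑' k, r (N + 1) k) atTop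
      (𝓝 (F + G * (∑' t : ℕ, energy α β γ τ lam c t * z ^ t)
        - ∑' t : ℕ, energy α β γ τ lam c t * z ^ t)) := by
    simp only [hid]
    have := (tendsto_add_atTop_iff_nat 1).2 hlim
    exact (tendsto_const_nhds.add (this.const_mul G)).sub this
  have := tendsto_nhds_unique hrlim hrlim'
  linarith

end IsStable

end SESGD

/-! ### Tails of power-law sequences -/

namespace SESGD

/-- A Stolz–Cesàro principle for tails: a termwise relative error from N on carries over to the
sums. -/
theorem tendsto_tail_div_tail {w φ : ℕ → ℝ} {ℓ : ℝ} (hφ0 : ∀ k, 0 < φ k) (hφ : Summable φ)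
    (hw : Summable w) (h : Tendsto (fun k => w k / φ k) atTop (𝓝 ℓ)) :
    Tendsto (fun k => tail w k / tail φ k) atTop (𝓝 ℓ) := by
  have hshift : ∀ {f : ℕ → ℝ}, Summable f → ∀ k, Summable fun l => f (k + l) := fun hf k => by
    simpa only [add_comm] using (summable_nat_add_iff k).2 hf
  rw [Metric.tendsto_atTop] at h ⊢
  intro ε hε
  obtain ⟨N, hN⟩ := h (ε / 2) (by positivity)
  refine ⟨N, fun k hk => ?_⟩
  have htφ : 0 < tail φ k :=
    (hshift hφ k).tsum_pos (fun l => (hφ0 _).le) 0 (hφ0 _)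
  have e : tail w k / tail φ k - ℓ = (∑' l, (w (k + l) - ℓ * φ (k + l))) / tail φ k := by
    rw [(hshift hw k).tsum_sub ((hshift hφ k).mul_left ℓ), tsum_mul_left]
    change _ = (tail w k - ℓ * tail φ k) / tail φ k
    field_simp
  have hb : |∑' l, (w (k + l) - ℓ * φ (k + l))| ≤ ε / 2 * tail φ k := by
    rw [tail, ← tsum_mul_left, ← Real.norm_eq_abs]
    refine tsum_of_norm_bounded ((hshift hφ k).mul_left (ε / 2)).hasSum fun l => ?_
    have h1 := (hN (k + l) (by omega)).le
    have h2 := hφ0 (k + l)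
    rw [Real.dist_eq] at h1
    have e2 : w (k + l) - ℓ * φ (k + l) = (w (k + l) / φ (k + l) - ℓ) * φ (k + l) := by
      field_simp
    rw [e2, norm_mul, Real.norm_of_nonneg h2.le]
    exact mul_le_mul_of_nonneg_right h1 h2.le
  rw [Real.dist_eq, e, abs_div, abs_of_pos htφ, div_lt_iff₀ htφ]
  refine hb.trans_lt ?_
  have := mul_pos hε htφ
  linarith

theorem tendsto_rpow_sub_succ (p : ℝ) :
    Tendsto (fun k : ℕ => (((k : ℝ) + 1) ^ (1 - p) - ((k : ℝ) + 1 + 1) ^ (1 - p))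
      * ((k : ℝ) + 1) ^ p) atTop (𝓝 (p - 1)) := by
  have hd : HasDerivAt (fun x : ℝ => x ^ (1 - p)) (1 - p) 1 := by
    simpa using Real.hasDerivAt_rpow_const (x := (1 : ℝ)) (p := 1 - p) (Or.inl one_ne_zero)
  have hs := (hasDerivAt_iff_tendsto_slope_zero.1 hd).mono_left
    (nhdsWithin_mono (0 : ℝ) (fun x hx => ne_of_gt hx : Set.Ioi (0 : ℝ) ⊆ {0}ᶜ))
  have hn : Tendsto (fun k : ℕ => ((k : ℝ) + 1)⁻¹) atTop (𝓝[>] 0) :=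
    tendsto_inv_atTop_nhdsGT_zero.comp
      (tendsto_atTop_add_const_right _ 1 tendsto_natCast_atTop_atTop)
  have := (hs.comp hn).neg
  rw [neg_sub] at this
  refine this.congr fun k => ?_
  have hk : (0 : ℝ) < (k : ℝ) + 1 := by positivity
  have e1 : ((k : ℝ) + 1 + 1) ^ (1 - p) = (1 + ((k : ℝ) + 1)⁻¹) ^ (1 - p) * ((k : ℝ) + 1) ^ (1 - p) := by
    rw [← Real.mul_rpow (by positivity) hk.le]
    congr 1; field_simp
  have e2 : ((k : ℝ) + 1) ^ (1 - p) * ((k : ℝ) + 1) ^ p = (k : ℝ) + 1 := by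
    rw [← Real.rpow_add hk]; simp
  simp only [Function.comp, smul_eq_mul, inv_inv, Real.one_rpow]
  rw [e1]
  linear_combination (-1 + (1 + ((k : ℝ) + 1)⁻¹) ^ (1 - p)) * e2

/-- The comparison sequence is the difference of consecutive values of (k+1)^(1-p): its tails
telescope exactly, and its terms are asymptotic to (p-1)(k+1)^(-p). The lemma serves the noise
weights (α λ_k)², whose tails are not given. -/
theorem tendsto_tail_of_tendsto {w : ℕ → ℝ} {p L : ℝ} (hp : 1 < p) (hw : Summable w)
    (h : Tendsto (fun k : ℕ => w k * ((k : ℝ) + 1) ^ p) atTop (𝓝 L)) :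
    Tendsto (fun k : ℕ => tail w k * ((k : ℝ) + 1) ^ (p - 1)) atTop (𝓝 (L / (p - 1))) := by
  set ψ : ℕ → ℝ := fun k => ((k : ℝ) + 1) ^ (1 - p) with hψ
  set φ : ℕ → ℝ := fun k => ψ k - ψ (k + 1) with hφ
  have hψlim : Tendsto ψ atTop (𝓝 0) := by
    have := (tendsto_rpow_neg_atTop (by linarith : 0 < p - 1)).comp
      (tendsto_atTop_add_const_right atTop (1 : ℝ) tendsto_natCast_atTop_atTop)
    rw [neg_sub] at this
    exact this
  have hφ0 : ∀ k, 0 < φ k := by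
    intro k
    rw [hφ, sub_pos]
    simp only [hψ]
    exact Real.rpow_lt_rpow_of_neg (by positivity) (by push_cast; linarith) (by linarith)
  have hsum : ∀ k, HasSum (fun l => φ (k + l)) (ψ k) := by
    intro k
    rw [hasSum_iff_tendsto_nat_of_nonneg (fun l => (hφ0 _).le)]
    have e : ∀ n, ∑ l ∈ Finset.range n, φ (k + l) = ψ k - ψ (k + n) := by
      intro n
      have := Finset.sum_range_sub' (fun l => ψ (k + l)) n
      simpa only [add_zero, ← add_assoc] using this
    simp only [e]
    have := (tendsto_add_atTop_iff_nat k).2 hψlim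
    simp only [add_comm _ k] at this
    simpa using tendsto_const_nhds.sub this
  have htail : ∀ k, tail φ k = ψ k := fun k => (hsum k).tsum_eq
  have hφs : Summable φ := by simpa using (hsum 0).summable
  have hr : Tendsto (fun k => w k / φ k) atTop (𝓝 (L / (p - 1))) := by
    refine (h.div (tendsto_rpow_sub_succ p) (by linarith)).congr fun k => ?_
    have hk : ((k : ℝ) + 1) ^ p ≠ 0 := by positivity
    simp only [Pi.div_apply]
    rw [mul_div_mul_right _ _ hk]
    simp only [hφ, hψ]
    push_cast
    rfl
  refine (tendsto_tail_div_tail hφ0 hφs hw hr).congr fun k => ?_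
  have hk : (0 : ℝ) ≤ (k : ℝ) + 1 := by positivity
  rw [htail, show ψ k = ((k : ℝ) + 1) ^ (-(p - 1)) by simp only [hψ, neg_sub], Real.rpow_neg hk,
    div_inv_eq_mul]

theorem tendsto_mul_of_isEquivalent {f : ℕ → ℝ} {L p : ℝ} (hL : L ≠ 0)
    (h : f ~[atTop] fun k : ℕ => L * ((k : ℝ) + 1) ^ (-p)) :
    Tendsto (fun k : ℕ => f k * ((k : ℝ) + 1) ^ p) atTop (𝓝 L) := by
  have h1 := (isEquivalent_iff_tendsto_one (Eventually.of_forall fun k : ℕ => by positivity)).1 h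
  have h2 := h1.mul_const L
  rw [one_mul] at h2
  refine h2.congr fun k => ?_
  have hk : (0 : ℝ) ≤ (k : ℝ) + 1 := by positivity
  have hk' : ((k : ℝ) + 1) ^ p ≠ 0 := by positivity
  simp only [Pi.div_apply]
  rw [Real.rpow_neg hk]
  field_simp

theorem exists_le_of_tendsto_mul_rpow {f : ℕ → ℝ} {L p : ℝ}
    (h : Tendsto (fun k : ℕ => f k * ((k : ℝ) + 1) ^ p) atTop (𝓝 L)) :
    ∃ C, ∀ k : ℕ, f k ≤ C * ((k : ℝ) + 1) ^ (-p) := by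
  obtain ⟨C, hC⟩ := h.bddAbove_range
  refine ⟨C, fun k => ?_⟩
  have hk : (0 : ℝ) < (k : ℝ) + 1 := by positivity
  rw [Real.rpow_neg hk.le, ← div_eq_mul_inv, le_div_iff₀ (by positivity)]
  exact hC (Set.mem_range_self k)

theorem exists_ge_of_tendsto_mul_rpow {f : ℕ → ℝ} {L p : ℝ} (hf : ∀ k, 0 < f k) (hL : 0 < L)
    (h : Tendsto (fun k : ℕ => f k * ((k : ℝ) + 1) ^ p) atTop (𝓝 L)) :
    ∃ C, 0 < C ∧ ∀ k : ℕ, C * ((k : ℝ) + 1) ^ (-p) ≤ f k := by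
  obtain ⟨C, hC⟩ := (h.inv₀ hL.ne').bddAbove_range
  have hC0 : ∀ k : ℕ, (f k * ((k : ℝ) + 1) ^ p)⁻¹ ≤ C := fun k => hC (Set.mem_range_self k)
  have hpos : ∀ k : ℕ, 0 < f k * ((k : ℝ) + 1) ^ p := fun k => mul_pos (hf k) (by positivity)
  have hCpos : 0 < C := (inv_pos.2 (hpos 0)).trans_le (hC0 0)
  refine ⟨C⁻¹, inv_pos.2 hCpos, fun k => ?_⟩
  have hk : (0 : ℝ) < (k : ℝ) + 1 := by positivity
  rw [Real.rpow_neg hk.le, ← div_eq_mul_inv, div_le_iff₀ (by positivity)]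
  exact inv_le_of_inv_le₀ (hpos k) (hC0 k)

theorem summable_of_tendsto_mul_rpow {f : ℕ → ℝ} {L p : ℝ} (hp : 1 < p) (hf : ∀ k, 0 < f k)
    (h : Tendsto (fun k : ℕ => f k * ((k : ℝ) + 1) ^ p) atTop (𝓝 L)) : Summable f := by
  obtain ⟨C, hC⟩ := exists_le_of_tendsto_mul_rpow h
  refine Summable.of_nonneg_of_le (fun k => (hf k).le) hC (Summable.mul_left C ?_)
  have := (summable_nat_add_iff 1).2 (Real.summable_nat_rpow.2 (by linarith : -p < -1))
  simpa using this

end SESGD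

/-! ### Derivatives of the generating functions and their singularities -/

namespace SESGD

/-- The `z`-derivative of `coefC`. -/
noncomputable def coefCDeriv (β a z : ℝ) : ℝ :=
  β ^ 2 * (1 + β * z) + (1 + β ^ 2 * z) * β - 2 * β * (1 + β - a)

/-- The `z`-derivative of `resDenom`. -/
noncomputable def resDenomDeriv (β σ a z : ℝ) : ℝ :=
  -β * disc β a z + (1 - β * z) * (2 * β * (1 + β * z) - (1 + β - a) ^ 2)
    + σ * a ^ 2 * (1 + 2 * β * z)

/-- The numerator of the `z`-derivative of `coefC / resDenom`. -/
noncomputable def signalNum (β σ a z : ℝ) : ℝ :=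
  coefCDeriv β a z * resDenom β σ a z - coefC β a z * resDenomDeriv β σ a z

/-- The numerator of the `z`-derivative of `z (1 + β z) / resDenom`. -/
noncomputable def noiseNum (β σ a z : ℝ) : ℝ :=
  (1 + 2 * β * z) * resDenom β σ a z - z * (1 + β * z) * resDenomDeriv β σ a z

theorem continuous_resDenom (β σ : ℝ) :
    Continuous fun p : ℝ × ℝ => resDenom β σ p.1 p.2 := by
  unfold resDenom disc; fun_prop

theorem continuous_signalNum (β σ : ℝ) :
    Continuous fun p : ℝ × ℝ => signalNum β σ p.1 p.2 := by
  unfold signalNum resDenomDeriv resDenom coefC coefCDeriv disc; fun_prop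

theorem continuous_noiseNum (β σ : ℝ) :
    Continuous fun p : ℝ × ℝ => noiseNum β σ p.1 p.2 := by
  unfold noiseNum resDenomDeriv resDenom disc; fun_prop

theorem hasDerivAt_resDenom (β σ a z : ℝ) :
    HasDerivAt (resDenom β σ a) (resDenomDeriv β σ a z) z := by
  have hz := hasDerivAt_id' z
  have h1 : HasDerivAt (fun z => 1 - β * z) (-β) z := by
    simpa using (hz.const_mul β).const_sub 1
  have h2 : HasDerivAt (fun z => 1 + β * z) β z := by
    simpa using (hz.const_mul β).const_add 1
  have h3 := (h2.fun_pow 2).fun_sub (hz.const_mul ((1 + β - a) ^ 2))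
  have h4 := (h1.fun_mul h3).fun_add ((hz.const_mul (σ * a ^ 2)).fun_mul h2)
  refine h4.congr_deriv ?_
  unfold resDenomDeriv disc
  push_cast; ring

theorem hasDerivAt_coefC (β a z : ℝ) : HasDerivAt (coefC β a) (coefCDeriv β a z) z := by
  have hz := hasDerivAt_id' z
  have h1 : HasDerivAt (fun z => 1 + β ^ 2 * z) (β ^ 2) z := by
    simpa using (hz.const_mul (β ^ 2)).const_add 1
  have h2 : HasDerivAt (fun z => 1 + β * z) β z := by
    simpa using (hz.const_mul β).const_add 1
  have h4 := (h1.fun_mul h2).fun_sub ((hz.const_mul (2 * β)).mul_const (1 + β - a))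
  refine h4.congr_deriv ?_
  unfold coefCDeriv
  ring

theorem hasDerivAt_signal {β σ a z : ℝ} (h : resDenom β σ a z ≠ 0) :
    HasDerivAt (fun z => coefC β a z / resDenom β σ a z)
      (signalNum β σ a z / resDenom β σ a z ^ 2) z :=
  (hasDerivAt_coefC β a z).fun_div (hasDerivAt_resDenom β σ a z) h

theorem hasDerivAt_noise {β σ a z : ℝ} (h : resDenom β σ a z ≠ 0) :
    HasDerivAt (fun z => z * (1 + β * z) / resDenom β σ a z)
      (noiseNum β σ a z / resDenom β σ a z ^ 2) z := by
  have hz := hasDerivAt_id' z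
  have h2 : HasDerivAt (fun z => 1 + β * z) β z := by
    simpa using (hz.const_mul β).const_add 1
  refine ((hz.fun_mul h2).fun_div (hasDerivAt_resDenom β σ a z) h).congr_deriv ?_
  unfold noiseNum
  ring

/-- This is the square of the leading coefficient of the denominator, so the signal singularity has
constant exactly one; the corresponding ratio for the noise is 1/(1-β)². -/
theorem signalNum_zero_one (β σ : ℝ) : signalNum β σ 0 1 = ((1 - β) ^ 2 * (1 + β)) ^ 2 := by
  unfold signalNum resDenomDeriv resDenom coefC coefCDeriv disc; ring

theorem noiseNum_zero_one (β σ : ℝ) : noiseNum β σ 0 1 = ((1 - β) * (1 + β)) ^ 2 := by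
  unfold noiseNum resDenomDeriv resDenom disc; ring

/-- A weight with summable terms, differentiated against a quotient with a double pole. -/
theorem IsStable.hasDerivAt_tsum_quotient {α β γ τ : ℝ} {lam c : ℕ → ℝ}
    (h : IsStable α β γ τ lam c) {w : ℕ → ℝ} (hw0 : ∀ k, 0 ≤ w k) (hw : Summable w)
    {f num : ℝ → ℝ → ℝ} (hnum : Continuous fun p : ℝ × ℝ => num p.1 p.2)
    (hf : ∀ a z, resDenom β (τ * γ) a z ≠ 0 →
      HasDerivAt (f a) (num a z / resDenom β (τ * γ) a z ^ 2) z)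
    (hfs : ∀ z, 1 / 2 ≤ z → z < 1 → Summable fun k => w k * f (α * lam k) z)
    {z : ℝ} (h0 : 1 / 2 < z) (h1 : z < 1) :
    HasDerivAt (fun z => ∑' k, w k * f (α * lam k) z)
      (∑' k, w k * (num (α * lam k) z / resDenom β (τ * γ) (α * lam k) z ^ 2)) z := by
  obtain ⟨d, hd, hden⟩ := h.exists_resDenom_ge
  obtain ⟨M, hM⟩ := (isCompact_Icc.prod isCompact_Icc).exists_bound_of_continuousOn
    (s := Set.Icc (0 : ℝ) 4 ×ˢ Set.Icc (0 : ℝ) 1) hnum.continuousOn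
  -- On the interval up to the midpoint r all denominators are at least d (1 - r), uniformly in k.
  set r := (1 + z) / 2 with hr
  have hr1 : 0 < 1 - r := by rw [hr]; linarith
  have hzt : z ∈ Set.Ioo (1 / 2) r := ⟨h0, by rw [hr]; linarith⟩
  refine hasDerivAt_tsum_of_isPreconnected (t := Set.Ioo (1 / 2) r)
    (u := fun k => w k * (M / (d * (1 - r)) ^ 2)) (g := fun k y => w k * f (α * lam k) y)
    (g' := fun k y => w k * (num (α * lam k) y / resDenom β (τ * γ) (α * lam k) y ^ 2))
    (y₀ := z) (y := z) (hw.mul_right _) isOpen_Ioo isPreconnected_Ioo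
    (fun k y hy => ?_) (fun k y hy => ?_) hzt (hfs z h0.le h1) hzt
  · have ha := h.admissible k (by linarith [hy.1] : 0 < y) (by linarith [hy.2])
    exact (hf _ _ (ha.resDenom_pos h.σ_nonneg).ne').const_mul (w k)
  · have hy1 : y ≤ 1 := by linarith [hy.2]
    have hy0 : 0 < y := by linarith [hy.1]
    have ha := h.admissible k hy0 hy1
    have hb : ‖num (α * lam k) y‖ ≤ M :=
      hM (α * lam k, y) ⟨⟨ha.pos.le, (h.lt_four k).le⟩, ⟨hy0.le, hy1⟩⟩
    have h2 : d * (1 - r) ≤ resDenom β (τ * γ) (α * lam k) y :=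
      (mul_le_mul_of_nonneg_left (by linarith [ha.pos, hy.2]) hd.le).trans
        (hden k y hy.1.le hy1)
    have hdr := mul_pos hd hr1
    rw [norm_mul, Real.norm_of_nonneg (hw0 k), norm_div, norm_pow,
      Real.norm_of_nonneg (hdr.le.trans h2)]
    refine mul_le_mul_of_nonneg_left ?_ (hw0 k)
    exact div_le_div₀ ((norm_nonneg _).trans hb) hb (by positivity)
      (pow_le_pow_left₀ hdr.le h2 2)

theorem tendsto_prod_one_sub : Tendsto (fun p : ℕ × ℝ => 1 - p.2) (atTop ×ˢ 𝓝[>] 0) (𝓝 1) := by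
  have : Tendsto (fun p : ℕ × ℝ => p.2) (atTop ×ˢ 𝓝[>] 0) (𝓝 0) :=
    (tendsto_snd (f := (atTop : Filter ℕ)) (g := 𝓝[>] (0 : ℝ))).mono_right nhdsWithin_le_nhds
  simpa using this.const_sub 1

/-- The denominator is P δ + Q a. With a/b → (1-β)/2 for b = B (k+1)^(-ν), both P and Q a/b tend to
(1-β)²(1+β). The ratio is their average with weights δ and b, so the limit is joint in k and δ
whatever their relative sizes. -/
theorem tendsto_resDenom_div {β σ B ν : ℝ} {a : ℕ → ℝ} (hB : 0 < B)
    (ha : Tendsto (fun k : ℕ => a k * ((k : ℝ) + 1) ^ ν) atTop (𝓝 (B * ((1 - β) / 2))))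
    (ha0 : Tendsto a atTop (𝓝 0)) :
    Tendsto (fun p : ℕ × ℝ => resDenom β σ (a p.1) (1 - p.2)
      / (p.2 + B * ((p.1 : ℝ) + 1) ^ (-ν))) (atTop ×ˢ 𝓝[>] 0) (𝓝 ((1 - β) ^ 2 * (1 + β))) := by
  have hz := tendsto_prod_one_sub
  have hfst := tendsto_fst (f := (atTop : Filter ℕ)) (g := 𝓝[>] (0 : ℝ))
  have ha1 : Tendsto (fun p : ℕ × ℝ => (a p.1, 1 - p.2)) (atTop ×ˢ 𝓝[>] 0) (𝓝 ((0 : ℝ), (1 : ℝ))) :=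
    (ha0.comp hfst).prodMk_nhds hz
  set e := (1 - β) ^ 2 * (1 + β) with he
  have hP : Tendsto (fun p : ℕ × ℝ => (1 - β * (1 - p.2)) * (1 - β ^ 2 * (1 - p.2)))
      (atTop ×ˢ 𝓝[>] 0) (𝓝 e) := by
    have hc : Continuous fun z : ℝ => (1 - β * z) * (1 - β ^ 2 * z) := by fun_prop
    have := (hc.tendsto 1).comp hz
    rw [show (1 - β * 1) * (1 - β ^ 2 * 1) = e by rw [he]; ring] at this
    exact this
  have hQ : Tendsto (fun p : ℕ × ℝ => (1 - β * (1 - p.2)) * (1 - p.2) * (2 * (1 + β) - a p.1)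
      + σ * a p.1 * (1 - p.2) * (1 + β * (1 - p.2))) (atTop ×ˢ 𝓝[>] 0)
      (𝓝 ((1 - β) * (2 * (1 + β)))) := by
    have hc : Continuous fun q : ℝ × ℝ => (1 - β * q.2) * q.2 * (2 * (1 + β) - q.1)
      + σ * q.1 * q.2 * (1 + β * q.2) := by fun_prop
    have := (hc.tendsto (0, 1)).comp ha1
    simp only [mul_one, sub_zero, mul_zero, zero_mul, add_zero] at this
    exact this
  have hab : Tendsto (fun p : ℕ × ℝ => a p.1 * ((p.1 : ℝ) + 1) ^ ν / B) (atTop ×ˢ 𝓝[>] 0)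
      (𝓝 ((1 - β) / 2)) := by
    have := (ha.div_const B).comp hfst
    rwa [mul_div_cancel_left₀ _ hB.ne'] at this
  have hQa := hQ.mul hab
  rw [show (1 - β) * (2 * (1 + β)) * ((1 - β) / 2) = e by rw [he]; ring] at hQa
  have hbound := (tendsto_sub_nhds_zero_iff.2 hP).abs.add (tendsto_sub_nhds_zero_iff.2 hQa).abs
  rw [abs_zero, add_zero] at hbound
  rw [← tendsto_sub_nhds_zero_iff]
  refine squeeze_zero_norm' ?_ hbound
  have hδ : ∀ᶠ p : ℕ × ℝ in atTop ×ˢ 𝓝[>] 0, 0 < p.2 :=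
    (tendsto_snd (f := (atTop : Filter ℕ)) (g := 𝓝[>] (0 : ℝ))).eventually self_mem_nhdsWithin
  filter_upwards [hδ] with p hp
  have hk : (0 : ℝ) < (p.1 : ℝ) + 1 := by positivity
  set b := B * ((p.1 : ℝ) + 1) ^ (-ν) with hb
  have hb0 : 0 < b := by positivity
  have hden : 0 < p.2 + b := by positivity
  set P := (1 - β * (1 - p.2)) * (1 - β ^ 2 * (1 - p.2))
  set Q := (1 - β * (1 - p.2)) * (1 - p.2) * (2 * (1 + β) - a p.1)
      + σ * a p.1 * (1 - p.2) * (1 + β * (1 - p.2)) with hQd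
  have hkν : ((p.1 : ℝ) + 1) ^ ν ≠ 0 := by positivity
  have eab : a p.1 = a p.1 * ((p.1 : ℝ) + 1) ^ ν / B * b := by
    rw [hb, Real.rpow_neg hk.le]; field_simp
  have eD : resDenom β σ (a p.1) (1 - p.2)
      = P * p.2 + Q * (a p.1 * ((p.1 : ℝ) + 1) ^ ν / B) * b := by
    have e2 : Q * (a p.1 * ((p.1 : ℝ) + 1) ^ ν / B) * b = Q * a p.1 := by rw [mul_assoc, ← eab]
    rw [e2, hQd]
    simp only [P, resDenom, disc]; ring
  have e1 : resDenom β σ (a p.1) (1 - p.2) / (p.2 + b) - e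
      = ((P - e) * p.2 + (Q * (a p.1 * ((p.1 : ℝ) + 1) ^ ν / B) - e) * b) / (p.2 + b) := by
    rw [eD]; field_simp; ring
  rw [e1, Real.norm_eq_abs, abs_div, abs_of_pos hden, div_le_iff₀ hden]
  refine (abs_add_le _ _).trans ?_
  rw [abs_mul, abs_mul, abs_of_pos hp, abs_of_pos hb0]
  nlinarith [abs_nonneg (P - e), abs_nonneg (Q * (a p.1 * ((p.1 : ℝ) + 1) ^ ν / B) - e)]

/-- Asymptotics of sums of derivatives of the terms of the generating functions. -/
theorem IsStable.tendsto_tsum_quotient {α β γ τ B ν K κ : ℝ} {lam c : ℕ → ℝ}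
    (h : IsStable α β γ τ lam c) {w : ℕ → ℝ} (hw0 : ∀ k, 0 ≤ w k) (hw : Summable w)
    {num : ℝ → ℝ → ℝ} (hnum : Continuous fun p : ℝ × ℝ => num p.1 p.2)
    (hB : 0 < B) (hν : 0 < ν) (hκ : 0 < κ) (hκν : κ / ν < 2)
    (ht : Tendsto (fun k : ℕ => tail w k * ((k : ℝ) + 1) ^ κ) atTop (𝓝 K))
    (hB' : Tendsto (fun k : ℕ => α * lam k * ((k : ℝ) + 1) ^ ν) atTop (𝓝 (B * ((1 - β) / 2)))) :
    Tendsto (fun δ : ℝ => δ ^ (2 - κ / ν) * ∑' k : ℕ, w k *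
        (num (α * lam k) (1 - δ) / resDenom β (τ * γ) (α * lam k) (1 - δ) ^ 2)) (𝓝[>] 0)
      (𝓝 (num 0 1 / ((1 - β) ^ 2 * (1 + β)) ^ 2
        * (K * B ^ (-(κ / ν)) * (Real.Gamma (κ / ν + 1) * Real.Gamma (2 - κ / ν))))) := by
  have ha0 : Tendsto (fun k => α * lam k) atTop (𝓝 0) := by
    simpa using h.summable_lam.tendsto_atTop_zero.const_mul α
  have he : (1 - β) ^ 2 * (1 + β) ≠ 0 := by
    have h1 : 0 < 1 - β := by linarith [h.lt_one]
    have h2 : 0 < 1 + β := by linarith [h.neg_one_lt]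
    positivity
  refine tendsto_tsum_of_singularity hw0 hw hB hν hκ hκν ht ?_ fun k => ?_
  · have h1 := tendsto_resDenom_div (σ := τ * γ) hB hB' ha0
    have hfst := tendsto_fst (f := (atTop : Filter ℕ)) (g := 𝓝[>] (0 : ℝ))
    have h2 : Tendsto (fun p : ℕ × ℝ => num (α * lam p.1) (1 - p.2)) (atTop ×ˢ 𝓝[>] 0)
        (𝓝 (num 0 1)) :=
      (hnum.tendsto (0, 1)).comp ((ha0.comp hfst).prodMk_nhds tendsto_prod_one_sub)
    refine (h2.div (h1.pow 2) (pow_ne_zero 2 he)).congr fun p => ?_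
    simp only [Pi.div_apply]
    rw [div_pow, div_div_eq_mul_div, mul_div_right_comm]
  -- For a fixed index the denominator is nonzero at z = 1, so the term stays bounded there.
  · have ha := h.admissible k one_pos le_rfl
    have hcont : ContinuousAt (fun δ : ℝ => |num (α * lam k) (1 - δ)
        / resDenom β (τ * γ) (α * lam k) (1 - δ) ^ 2|) 0 := by
      have c1 : Continuous fun δ : ℝ => num (α * lam k) (1 - δ) :=
        hnum.comp (by fun_prop : Continuous fun δ : ℝ => (α * lam k, 1 - δ))
      have c2 : Continuous fun δ : ℝ => resDenom β (τ * γ) (α * lam k) (1 - δ) :=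
        (continuous_resDenom β (τ * γ)).comp (by fun_prop : Continuous fun δ : ℝ => (α * lam k, 1 - δ))
      refine (c1.continuousAt.div (c2.continuousAt.pow 2) ?_).abs
      change resDenom β (τ * γ) (α * lam k) (1 - 0) ^ 2 ≠ 0
      rw [sub_zero]
      exact pow_ne_zero 2 (ha.resDenom_pos h.σ_nonneg).ne'
    exact ⟨_, ((hcont.tendsto.eventually (gt_mem_nhds (lt_add_one _))).filter_mono
      nhdsWithin_le_nhds).mono fun δ hδ => hδ.le⟩

/-- Sums with a singularity of order two are negligible against a slower power. -/
theorem IsStable.tendsto_tsum_quotient_zero {α β γ τ ν K κ p c' : ℝ} {lam c : ℕ → ℝ}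
    (h : IsStable α β γ τ lam c) {w : ℕ → ℝ} (hw0 : ∀ k, 0 ≤ w k) (hw : Summable w)
    {num : ℝ → ℝ → ℝ} (hnum : Continuous fun p : ℝ × ℝ => num p.1 p.2)
    (hK : 0 < K) (hν : 0 < ν) (hκ : 0 < κ) (hp0 : 0 < p) (hp : 2 - κ / ν < p)
    (ht : Tendsto (fun k : ℕ => tail w k * ((k : ℝ) + 1) ^ κ) atTop (𝓝 K))
    (hc : 0 < c') (hb : ∀ k : ℕ, c' * ((k : ℝ) + 1) ^ (-ν) ≤ α * lam k) :
    Tendsto (fun δ : ℝ => δ ^ p * ∑' k : ℕ, w k *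
        (num (α * lam k) (1 - δ) / resDenom β (τ * γ) (α * lam k) (1 - δ) ^ 2)) (𝓝[>] 0)
      (𝓝 0) := by
  obtain ⟨d, hd, hden⟩ := h.exists_resDenom_ge
  obtain ⟨M, hM⟩ := (isCompact_Icc.prod isCompact_Icc).exists_bound_of_continuousOn
    (s := Set.Icc (0 : ℝ) 4 ×ˢ Set.Icc (0 : ℝ) 1) hnum.continuousOn
  have h1 := (tendsto_rpow_mul_tsum_zero (m := 2) hw0 hw hK hκ hν hc two_pos hp0
    (by exact_mod_cast hp) ht hb).const_mul (M / d ^ 2)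
  rw [mul_zero] at h1
  refine squeeze_zero_norm' ?_ h1
  filter_upwards [Ioo_mem_nhdsGT (by norm_num : (0 : ℝ) < 1 / 2)] with δ hδ
  have hδ0 : 0 < δ := hδ.1
  have hδ1 : 1 / 2 ≤ 1 - δ := by linarith [hδ.2]
  rw [norm_mul, Real.norm_of_nonneg (by positivity), mul_left_comm]
  refine mul_le_mul_of_nonneg_left ?_ (by positivity)
  have ha0 : ∀ k, 0 ≤ α * lam k := fun k => (mul_pos h.α_pos (h.lam_pos k)).le
  rw [← tsum_mul_left]
  refine tsum_of_norm_bounded ((summable_div_pow hw0 hw ha0 hδ0 2).mul_left _).hasSum fun k => ?_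
  have ha := h.admissible k (by linarith : 0 < 1 - δ) (by linarith)
  have hb : ‖num (α * lam k) (1 - δ)‖ ≤ M :=
    hM (α * lam k, 1 - δ) ⟨⟨ha0 k, (h.lt_four k).le⟩, ⟨ha.z_pos.le, ha.z_le⟩⟩
  have h2 := hden k (1 - δ) hδ1 ha.z_le
  rw [sub_sub_cancel] at h2
  have hq : 0 < d * (δ + α * lam k) := mul_pos hd (by linarith [ha.pos])
  rw [norm_mul, Real.norm_of_nonneg (hw0 k), norm_div, norm_pow,
    Real.norm_of_nonneg (hq.le.trans h2)]
  have hw' := hw0 k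
  calc w k * (‖num (α * lam k) (1 - δ)‖ / resDenom β (τ * γ) (α * lam k) (1 - δ) ^ 2)
      ≤ w k * (M / (d * (δ + α * lam k)) ^ 2) := by
        refine mul_le_mul_of_nonneg_left ?_ hw'
        exact div_le_div₀ ((norm_nonneg _).trans hb) hb (by positivity)
          (pow_le_pow_left₀ hq.le h2 2)
    _ = _ := by rw [mul_pow, div_mul_div_comm, mul_div_assoc', mul_comm]

end SESGD

/-! ### From the singularity at one to the weighted sums of losses -/

namespace SESGD

/-- Power series with nonnegative coefficients and radius of convergence at least one. -/
theorem hasDerivAt_powerSeries {e : ℕ → ℝ} (he : ∀ t, 0 ≤ e t)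
    (hs : ∀ z : ℝ, 0 < z → z < 1 → Summable fun t : ℕ => e t * z ^ t) {z : ℝ} (h0 : 0 < z)
    (h1 : z < 1) :
    (Summable fun t : ℕ => (t : ℝ) * e t * z ^ t) ∧
      HasDerivAt (fun z : ℝ => ∑' t : ℕ, e t * z ^ t) (∑' t : ℕ, e t * (t * z ^ (t - 1))) z := by
  have hsum : ∀ z : ℝ, 0 < z → z < 1 → Summable fun t : ℕ => (t : ℝ) * e t * z ^ t := by
    intro z h0 h1
    -- The factor t is absorbed by the geometric ratio: t (z/r)^t is bounded, and the series
    -- converges at r.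
    set r := (1 + z) / 2 with hr
    have hr0 : 0 < r := by rw [hr]; linarith
    have hzr : z < r := by rw [hr]; linarith
    obtain ⟨M, hM⟩ := (tendsto_self_mul_const_pow_of_lt_one (div_nonneg h0.le hr0.le)
      ((div_lt_one hr0).2 hzr)).bddAbove_range
    refine (mul_summable_of_bounded (g := fun t : ℕ => (t : ℝ) * (z / r) ^ t) (M := M)
      (hs r hr0 (by rw [hr]; linarith)) fun t => ?_).congr fun t => ?_
    · rw [abs_of_nonneg (by positivity)]; exact hM (Set.mem_range_self t)
    · rw [div_pow]; field_simp
  refine ⟨hsum z h0 h1, ?_⟩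
  set r := (1 + z) / 2 with hr
  have hr0 : 0 < r := by rw [hr]; linarith
  have hzt : z ∈ Set.Ioo 0 r := ⟨h0, by rw [hr]; linarith⟩
  refine hasDerivAt_tsum_of_isPreconnected (t := Set.Ioo 0 r) (g := fun t y => e t * y ^ t)
    (g' := fun t y => e t * (t * y ^ (t - 1))) (u := fun t : ℕ => r⁻¹ * ((t : ℝ) * e t * r ^ t))
    (y₀ := z) (y := z) ((hsum r hr0 (by rw [hr]; linarith)).mul_left _) isOpen_Ioo
    isPreconnected_Ioo (fun t y _ => (hasDerivAt_pow t y).const_mul (e t)) (fun t y hy => ?_) hzt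
    (hs z h0 h1) hzt
  have hy0 : 0 < y := hy.1
  have het := he t
  rw [Real.norm_of_nonneg (by positivity)]
  rcases Nat.eq_zero_or_pos t with rfl | ht
  · simp
  · have e1 : r⁻¹ * ((t : ℝ) * e t * r ^ t) = e t * (t * r ^ (t - 1)) := by
      obtain ⟨n, rfl⟩ : ∃ n, t = n + 1 := ⟨t - 1, by omega⟩
      rw [Nat.add_sub_cancel, pow_succ]; field_simp
    rw [e1]
    have := hy.2.le
    gcongr

/-- The `k`-th term of the derivative of the signal generating function. -/
noncomputable def signalTermDeriv (α β γ τ : ℝ) (lam c : ℕ → ℝ) (k : ℕ) (z : ℝ) : ℝ :=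
  lam k * c k * (signalNum β (τ * γ) (α * lam k) z / resDenom β (τ * γ) (α * lam k) z ^ 2)

/-- The `k`-th term of the derivative of `z` times the noise generating function, up to `γ`. -/
noncomputable def noiseTermDeriv (α β γ τ : ℝ) (lam : ℕ → ℝ) (k : ℕ) (z : ℝ) : ℝ :=
  (α * lam k) ^ 2 * (noiseNum β (τ * γ) (α * lam k) z / resDenom β (τ * γ) (α * lam k) z ^ 2)

theorem tendsto_one_sub_nhdsLT : Tendsto (fun z : ℝ => 1 - z) (𝓝[<] 1) (𝓝[>] 0) := by
  refine tendsto_nhdsWithin_iff.2 ⟨?_, ?_⟩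
  · have : Tendsto (fun z : ℝ => 1 - z) (𝓝 1) (𝓝 (1 - 1)) :=
      (by fun_prop : Continuous fun z : ℝ => 1 - z).tendsto 1
    rw [sub_self] at this
    exact this.mono_left nhdsWithin_le_nhds
  · filter_upwards [self_mem_nhdsWithin] with z hz
    exact Set.mem_Ioi.2 (sub_pos.2 (Set.mem_Iio.1 hz))

namespace IsStable

variable {α β γ τ : ℝ} {lam c : ℕ → ℝ}

theorem noiseGen_one (h : IsStable α β γ τ lam c) :
    noiseGen α β γ τ lam 1 = ∑' k, noiseTerm α β γ τ lam k 1 := by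
  rw [noiseGen, ← tsum_mul_left]
  refine tsum_congr fun k => ?_
  rw [resolventEntry_one (h.admissible k one_pos le_rfl) h.σ_nonneg, resNum_allOnes, noiseTerm]
  ring

theorem signalGen_one (h : IsStable α β γ τ lam c) :
    signalGen α β γ τ lam c 1 = ∑' k, signalTerm α β γ τ lam c k 1 := by
  refine tsum_congr fun k => ?_
  rw [resolventEntry_one (h.admissible k one_pos le_rfl) h.σ_nonneg, resNum_unit11, signalTerm]

theorem tendsto_term (h : IsStable α β γ τ lam c) (k : ℕ) :
    Tendsto (fun δ : ℝ => signalTerm α β γ τ lam c k (1 - δ)) (𝓝[>] 0)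
      (𝓝 (signalTerm α β γ τ lam c k 1)) ∧
    Tendsto (fun δ : ℝ => noiseTerm α β γ τ lam k (1 - δ)) (𝓝[>] 0)
      (𝓝 (noiseTerm α β γ τ lam k 1)) := by
  have hD := ((h.admissible k one_pos le_rfl).resDenom_pos h.σ_nonneg).ne'
  have hd : Tendsto (fun δ : ℝ => 1 - δ) (𝓝[>] 0) (𝓝 1) := by
    have : Tendsto (fun z : ℝ => 1 - z) (𝓝 0) (𝓝 (1 - 0)) :=
      (by fun_prop : Continuous fun z : ℝ => 1 - z).tendsto 0
    rw [sub_zero] at this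
    exact this.mono_left nhdsWithin_le_nhds
  exact ⟨(((hasDerivAt_signal hD).continuousAt.tendsto).comp hd).const_mul _,
    (((hasDerivAt_noise hD).continuousAt.tendsto).comp hd).const_mul _⟩

theorem eventually_one_sub : ∀ᶠ δ in 𝓝[>] (0 : ℝ), 0 < δ ∧ 1 / 2 < 1 - δ ∧ 1 - δ < 1 := by
  filter_upwards [Ioo_mem_nhdsGT (by norm_num : (0 : ℝ) < 1 / 2)] with δ hδ
  exact ⟨hδ.1, by linarith [hδ.2], by linarith [hδ.1]⟩

theorem tendsto_noise (h : IsStable α β γ τ lam c) :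
    Tendsto (fun δ : ℝ => ∑' k, noiseTerm α β γ τ lam k (1 - δ)) (𝓝[>] 0)
      (𝓝 (noiseGen α β γ τ lam 1)) := by
  obtain ⟨M, hM⟩ := h.exists_noiseTerm_le
  rw [h.noiseGen_one]
  refine tendsto_tsum_of_dominated_convergence (h.summable_lam.mul_left M)
    (fun k => (h.tendsto_term k).2) ?_
  filter_upwards [eventually_one_sub] with δ hδ k
  rw [Real.norm_of_nonneg (h.noiseTerm_nonneg k hδ.2.1.le hδ.2.2.le)]
  exact hM k _ hδ.2.1.le hδ.2.2.le

/-- The extra summability is the majorant obtained by dropping 1 - z from the denominator. It is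
available when ζ > 1, hence in the noise-dominated phase. -/
theorem tendsto_signal (h : IsStable α β γ τ lam c)
    (hs : Summable fun k => lam k * c k / (α * lam k)) :
    Tendsto (fun δ : ℝ => ∑' k, signalTerm α β γ τ lam c k (1 - δ)) (𝓝[>] 0)
      (𝓝 (signalGen α β γ τ lam c 1)) := by
  obtain ⟨M, hM0, hM⟩ := h.exists_term_bounds
  rw [h.signalGen_one]
  refine tendsto_tsum_of_dominated_convergence (hs.mul_left M) (fun k => (h.tendsto_term k).1) ?_
  filter_upwards [eventually_one_sub] with δ hδ k
  obtain ⟨h1, h2⟩ := (hM k _ hδ.2.1.le hδ.2.2.le).1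
  have hl := (h.lam_pos k).le
  have hc := h.c_nonneg k
  have ha := mul_pos h.α_pos (h.lam_pos k)
  rw [Real.norm_of_nonneg h1]
  refine h2.trans ?_
  calc lam k * c k * (M / (1 - (1 - δ) + α * lam k)) ≤ lam k * c k * (M / (α * lam k)) := by
        gcongr; linarith [hδ.1]
    _ = M * (lam k * c k / (α * lam k)) := by ring

theorem signalGen_pos (h : IsStable α β γ τ lam c)
    (hs : Summable fun k => lam k * c k / (α * lam k)) (hc : ∃ k, 0 < c k) :
    0 < signalGen α β γ τ lam c 1 := by
  obtain ⟨M, hM0, hM⟩ := h.exists_term_bounds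
  rw [h.signalGen_one]
  obtain ⟨k, hk⟩ := hc
  have hsum : Summable fun k => signalTerm α β γ τ lam c k 1 := by
    refine Summable.of_nonneg_of_le (fun k => (hM k 1 (by norm_num) le_rfl).1.1) (fun k => ?_)
      (hs.mul_left M)
    refine (hM k 1 (by norm_num) le_rfl).1.2.trans_eq ?_
    rw [sub_self, zero_add]; ring
  refine hsum.tsum_pos (fun k => (hM k 1 (by norm_num) le_rfl).1.1) k ?_
  have ha := h.admissible k one_pos le_rfl
  have h1 := ha.coefC_pos
  have h2 := ha.resDenom_pos h.σ_nonneg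
  have h3 := h.lam_pos k
  unfold signalTerm
  positivity

/-- The renewal equation is used only near 1, where continuity guarantees G < 1; smaller z follow by
comparison. -/
theorem summable_energy (h : IsStable α β γ τ lam c) (hU : noiseGen α β γ τ lam 1 < 1) {z : ℝ}
    (h0 : 0 < z) (h1 : z < 1) : Summable fun t : ℕ => energy α β γ τ lam c t * z ^ t := by
  obtain ⟨δ, hδ, hG, hzδ⟩ := (eventually_one_sub.and ((h.tendsto_noise.eventually
    (gt_mem_nhds hU)).and (Ioo_mem_nhdsGT (sub_pos.2 h1)))).exists
  have := (h.renewal hδ.2.1.le hδ.2.2 hG).1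
  refine Summable.of_nonneg_of_le (fun t => mul_nonneg (h.energy_nonneg t) (by positivity))
    (fun t => ?_) this
  have := h.energy_nonneg t
  have : z ≤ 1 - δ := by linarith [hzδ.2]
  gcongr

/-- The generating function of `t ↦ t * energy t`, from the derivative of the renewal equation. -/
theorem eventually_weighted_energy (h : IsStable α β γ τ lam c)
    (hU : noiseGen α β γ τ lam 1 < 1) :
    ∀ᶠ δ in 𝓝[>] (0 : ℝ), ∑' t : ℕ, (t : ℝ) * energy α β γ τ lam c t * (1 - δ) ^ t
      = (1 - δ) * (((∑' k, signalTermDeriv α β γ τ lam c k (1 - δ))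
            * (1 - ∑' k, noiseTerm α β γ τ lam k (1 - δ))
          + (∑' k, signalTerm α β γ τ lam c k (1 - δ))
            * (γ * ∑' k, noiseTermDeriv α β γ τ lam k (1 - δ)))
        / (1 - ∑' k, noiseTerm α β γ τ lam k (1 - δ)) ^ 2) := by
  -- Differentiating the renewal equation requires it on an open interval around z, not merely at z.
  obtain ⟨η, hη0, hη⟩ := mem_nhdsGT_iff_exists_Ioo_subset.1 (eventually_one_sub.and
    (h.tendsto_noise.eventually (gt_mem_nhds hU)))
  have hη0 : (0 : ℝ) < η := hη0
  have hgood : ∀ z ∈ Set.Ioo (1 - η) 1, 1 / 2 < z ∧ ∑' k, noiseTerm α β γ τ lam k z < 1 := by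
    intro z hz
    have := hη (⟨by linarith [hz.2], by linarith [hz.1]⟩ : 1 - z ∈ Set.Ioo 0 η)
    simp only [Set.mem_ofPred_eq, sub_sub_cancel] at this
    exact ⟨this.1.2.1, this.2⟩
  filter_upwards [Ioo_mem_nhdsGT hη0] with δ hδ
  set z := 1 - δ with hz
  have hzI : z ∈ Set.Ioo (1 - η) 1 := ⟨by linarith [hδ.2], by linarith [hδ.1]⟩
  obtain ⟨hz2, hzG⟩ := hgood z hzI
  have hγ := h.γ_nonneg
  have dF : HasDerivAt (fun z => ∑' k, signalTerm α β γ τ lam c k z)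
      (∑' k, signalTermDeriv α β γ τ lam c k z) z :=
    h.hasDerivAt_tsum_quotient (fun k => mul_nonneg (h.lam_pos k).le (h.c_nonneg k)) h.summable_mul
      (continuous_signalNum β (τ * γ)) (f := fun a z => coefC β a z / resDenom β (τ * γ) a z)
      (fun a z hD => hasDerivAt_signal hD) (fun z h0 h1 => h.summable_signalTerm h0 h1) hz2 hzI.2
  have dG : HasDerivAt (fun z => ∑' k, noiseTerm α β γ τ lam k z)
      (γ * ∑' k, noiseTermDeriv α β γ τ lam k z) z := by
    have := h.hasDerivAt_tsum_quotient (w := fun k => γ * (α * lam k) ^ 2)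
      (fun k => by positivity) (h.summable_sq.mul_left γ)
      (continuous_noiseNum β (τ * γ)) (f := fun a z => z * (1 + β * z) / resDenom β (τ * γ) a z)
      (fun a z hD => hasDerivAt_noise hD) (fun z h0 h1 => h.summable_noiseTerm h0 h1.le) hz2 hzI.2
    rw [← tsum_mul_left]
    simp only [noiseTermDeriv, ← mul_assoc] at this ⊢
    exact this
  have hG0 : (1 - ∑' k, noiseTerm α β γ τ lam k z) ≠ 0 := by linarith
  have dQ := dF.fun_div (dG.const_sub 1) hG0
  have hev : (fun z => ∑' t : ℕ, energy α β γ τ lam c t * z ^ t) =ᶠ[𝓝 z]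
      fun z => (∑' k, signalTerm α β γ τ lam c k z) / (1 - ∑' k, noiseTerm α β γ τ lam k z) := by
    filter_upwards [isOpen_Ioo.mem_nhds hzI] with y hy
    obtain ⟨hy2, hyG⟩ := hgood y hy
    rw [eq_div_iff (by linarith)]
    exact (h.renewal hy2.le hy.2 hyG).2
  obtain ⟨-, dE⟩ := hasDerivAt_powerSeries h.energy_nonneg
    (fun z h0 h1 => h.summable_energy hU h0 h1) (by linarith : 0 < z) hzI.2
  have huniq := dE.unique (dQ.congr_of_eventuallyEq hev)
  have e1 : ∑' t : ℕ, (t : ℝ) * energy α β γ τ lam c t * z ^ t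
      = z * ∑' t : ℕ, energy α β γ τ lam c t * (t * z ^ (t - 1)) := by
    rw [← tsum_mul_left]
    refine tsum_congr fun t => ?_
    rcases Nat.eq_zero_or_pos t with rfl | ht
    · simp
    · obtain ⟨n, rfl⟩ : ∃ n, t = n + 1 := ⟨t - 1, by omega⟩
      rw [Nat.add_sub_cancel, pow_succ]; ring
  rw [e1, huniq]
  congr 2
  ring

/-- From the singularity of the generating functions to the weighted sums of losses. -/
theorem tendsto_weighted_loss (h : IsStable α β γ τ lam c) (hU : noiseGen α β γ τ lam 1 < 1)
    {ρ C : ℝ} (hρ : 0 < ρ)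
    (hC : Tendsto (fun δ : ℝ => δ ^ ρ * ((∑' k, signalTermDeriv α β γ τ lam c k (1 - δ))
            * (1 - ∑' k, noiseTerm α β γ τ lam k (1 - δ))
          + (∑' k, signalTerm α β γ τ lam c k (1 - δ))
            * (γ * ∑' k, noiseTermDeriv α β γ τ lam k (1 - δ)))) (𝓝[>] 0) (𝓝 C)) :
    Tendsto (fun T : ℕ => (∑ t ∈ Finset.Icc 1 T, (t : ℝ) * loss α β γ τ lam c t) / (T : ℝ) ^ ρ)
      atTop (𝓝 (C / (1 - noiseGen α β γ τ lam 1) ^ 2 / Real.Gamma (ρ + 1) / 2)) := by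
  have hone : Tendsto (fun δ : ℝ => 1 - δ) (𝓝[>] 0) (𝓝 1) := by
    have : Tendsto (fun z : ℝ => 1 - z) (𝓝 0) (𝓝 (1 - 0)) :=
      (by fun_prop : Continuous fun z : ℝ => 1 - z).tendsto 0
    rw [sub_zero] at this
    exact this.mono_left nhdsWithin_le_nhds
  have hG : Tendsto (fun δ : ℝ => (1 - ∑' k, noiseTerm α β γ τ lam k (1 - δ)) ^ 2) (𝓝[>] 0)
      (𝓝 ((1 - noiseGen α β γ τ lam 1) ^ 2)) := (h.tendsto_noise.const_sub 1).pow 2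
  have hne : (1 - noiseGen α β γ τ lam 1) ^ 2 ≠ 0 := pow_ne_zero 2 (by linarith)
  have hlim := hone.mul (hC.div hG hne)
  rw [one_mul] at hlim
  have hδ : Tendsto (fun δ : ℝ => δ ^ ρ * ∑' t : ℕ,
      (t : ℝ) * energy α β γ τ lam c t * (1 - δ) ^ t) (𝓝[>] 0)
      (𝓝 (C / (1 - noiseGen α β γ τ lam 1) ^ 2)) := by
    refine hlim.congr' ?_
    filter_upwards [h.eventually_weighted_energy hU] with δ hδ
    rw [hδ]
    simp only [Pi.div_apply]
    ring
  have hz := hδ.comp tendsto_one_sub_nhdsLT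
  simp only [Function.comp_def, sub_sub_cancel] at hz
  have hT := tendsto_partialSum_of_tendsto_powerSeries hρ
    (fun t => mul_nonneg t.cast_nonneg (h.energy_nonneg t))
    (fun z h0 h1 => (hasDerivAt_powerSeries h.energy_nonneg
      (fun z h0 h1 => h.summable_energy hU h0 h1) h0 h1).1) hz
  -- The loss is half the energy, and the term t = 0 vanishes because of the weight.
  refine (hT.div_const 2).congr fun T => ?_
  rw [div_right_comm]
  congr 1
  rw [Finset.range_eq_Ico, Finset.sum_eq_sum_Ico_succ_bot (Nat.succ_pos T), Nat.cast_zero, zero_mul,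
    zero_add, Finset.sum_div]
  refine Finset.sum_congr (by ext; simp) fun t _ => ?_
  rw [loss, energy]; ring

end IsStable

end SESGD

/-! ### The two phases -/

namespace SESGD

theorem isEquivalent_of_tendsto_div_rpow {f : ℕ → ℝ} {L ρ : ℝ} (hL : L ≠ 0)
    (h : Tendsto (fun T : ℕ => f T / (T : ℝ) ^ ρ) atTop (𝓝 L)) :
    f ~[atTop] fun T : ℕ => L * (T : ℝ) ^ ρ := by
  refine isEquivalent_of_tendsto_one ?_
  have := h.div_const L
  rw [div_self hL] at this
  refine this.congr fun T => ?_
  simp only [Pi.div_apply]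
  rw [div_div, mul_comm]

/-- Power laws for the spectrum and the initial moments, with admissible parameters. -/
structure HasPowerLaw (α β γ τ Λ K ν κ : ℝ) (lam c : ℕ → ℝ) : Prop
    extends IsStable α β γ τ lam c where
  Λ_pos : 0 < Λ
  K_pos : 0 < K
  one_lt : 1 < ν
  κ_pos : 0 < κ
  tendsto_lam : Tendsto (fun k : ℕ => lam k * ((k : ℝ) + 1) ^ ν) atTop (𝓝 Λ)
  tendsto_tail : Tendsto (fun k : ℕ => tail (fun k => lam k * c k) k * ((k : ℝ) + 1) ^ κ) atTop (𝓝 K)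

namespace HasPowerLaw

variable {α β γ τ Λ K ν κ : ℝ} {lam c : ℕ → ℝ}

theorem scale_pos (h : HasPowerLaw α β γ τ Λ K ν κ lam c) : 0 < 2 * α * Λ / (1 - β) := by
  have := h.α_pos; have := h.Λ_pos
  have : 0 < 1 - β := by linarith [h.lt_one]
  positivity

theorem ν_pos (h : HasPowerLaw α β γ τ Λ K ν κ lam c) : 0 < ν := zero_lt_one.trans h.one_lt

theorem mul_nonneg (h : HasPowerLaw α β γ τ Λ K ν κ lam c) (k : ℕ) : 0 ≤ lam k * c k :=
  _root_.mul_nonneg (h.lam_pos k).le (h.c_nonneg k)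

theorem tendsto_scaled (h : HasPowerLaw α β γ τ Λ K ν κ lam c) :
    Tendsto (fun k : ℕ => α * lam k * ((k : ℝ) + 1) ^ ν) atTop (𝓝 (α * Λ)) := by
  simpa only [mul_assoc] using h.tendsto_lam.const_mul α

theorem exists_scaled_ge (h : HasPowerLaw α β γ τ Λ K ν κ lam c) :
    ∃ C, 0 < C ∧ ∀ k : ℕ, C * ((k : ℝ) + 1) ^ (-ν) ≤ α * lam k :=
  exists_ge_of_tendsto_mul_rpow (fun k => mul_pos h.α_pos (h.lam_pos k))
    (mul_pos h.α_pos h.Λ_pos) h.tendsto_scaled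

theorem scale_eq (h : HasPowerLaw α β γ τ Λ K ν κ lam c) :
    2 * α * Λ / (1 - β) * ((1 - β) / 2) = α * Λ := by
  have : 1 - β ≠ 0 := by linarith [h.lt_one]
  field_simp

theorem tendsto_signalDeriv (h : HasPowerLaw α β γ τ Λ K ν κ lam c) (hζ : κ / ν < 2) :
    Tendsto (fun δ : ℝ => δ ^ (2 - κ / ν) * ∑' k, signalTermDeriv α β γ τ lam c k (1 - δ)) (𝓝[>] 0)
      (𝓝 (K * (2 * α * Λ / (1 - β)) ^ (-(κ / ν))
        * (Real.Gamma (κ / ν + 1) * Real.Gamma (2 - κ / ν)))) := by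
  have := h.tendsto_tsum_quotient h.mul_nonneg h.summable_mul (continuous_signalNum β (τ * γ))
    h.scale_pos h.ν_pos h.κ_pos hζ h.tendsto_tail (by rw [h.scale_eq]; exact h.tendsto_scaled)
  rw [signalNum_zero_one, div_self, one_mul] at this
  · exact this
  · have h1 : 0 < 1 - β := by linarith [h.lt_one]
    have h2 : 0 < 1 + β := by linarith [h.neg_one_lt]
    positivity

theorem tendsto_signalDeriv_zero (h : HasPowerLaw α β γ τ Λ K ν κ lam c) {p : ℝ} (hp0 : 0 < p)
    (hp : 2 - κ / ν < p) :
    Tendsto (fun δ : ℝ => δ ^ p * ∑' k, signalTermDeriv α β γ τ lam c k (1 - δ)) (𝓝[>] 0)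
      (𝓝 0) := by
  obtain ⟨C, hC, hCk⟩ := h.exists_scaled_ge
  exact h.tendsto_tsum_quotient_zero h.mul_nonneg h.summable_mul (continuous_signalNum β (τ * γ))
    h.K_pos h.ν_pos h.κ_pos hp0 hp h.tendsto_tail hC hCk

/-- The undifferentiated signal has only first-order denominators, so its growth exponent is one
less than that of its derivative. This makes F G' negligible in the signal-dominated phase. -/
theorem tendsto_signal_zero (h : HasPowerLaw α β γ τ Λ K ν κ lam c) {p : ℝ} (hp0 : 0 < p)
    (hp : 1 - κ / ν < p) :
    Tendsto (fun δ : ℝ => δ ^ p * ∑' k, signalTerm α β γ τ lam c k (1 - δ)) (𝓝[>] 0) (𝓝 0) := by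
  obtain ⟨C, hC, hCk⟩ := h.exists_scaled_ge
  obtain ⟨M, hM0, hM⟩ := h.exists_term_bounds
  have h1 := (tendsto_rpow_mul_tsum_zero (m := 1) h.mul_nonneg h.summable_mul h.K_pos h.κ_pos h.ν_pos
    hC one_pos hp0 (by exact_mod_cast hp) h.tendsto_tail hCk).const_mul M
  rw [mul_zero] at h1
  refine squeeze_zero_norm' ?_ h1
  filter_upwards [IsStable.eventually_one_sub] with δ hδ
  obtain ⟨hδ0, hδ1, hδ2⟩ := hδ
  rw [norm_mul, Real.norm_of_nonneg (by positivity), mul_left_comm]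
  refine mul_le_mul_of_nonneg_left ?_ (by positivity)
  rw [← tsum_mul_left]
  refine tsum_of_norm_bounded ((summable_div_pow h.mul_nonneg h.summable_mul
    (fun k => (mul_pos h.α_pos (h.lam_pos k)).le) hδ0 1).mul_left _).hasSum fun k => ?_
  obtain ⟨h2, h3⟩ := (hM k _ hδ1.le hδ2.le).1
  rw [Real.norm_of_nonneg h2]
  refine h3.trans_eq ?_
  rw [sub_sub_cancel, pow_one]
  ring

/-- The weights (α λ_k)² have tail exponent 2ν - 1, so the order of the singularity is 2 - (2ν-1)/ν
= 1/ν. The factor 1/4 arises from (αΛ)² = B² (1-β)²/4 and the numerator ratio 1/(1-β)². -/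
theorem tendsto_noiseDeriv (h : HasPowerLaw α β γ τ Λ K ν κ lam c) :
    Tendsto (fun δ : ℝ => δ ^ (1 / ν) * ∑' k, noiseTermDeriv α β γ τ lam k (1 - δ)) (𝓝[>] 0)
      (𝓝 ((2 * α * Λ / (1 - β)) ^ (1 / ν) / 4
        * (Real.Gamma (2 - 1 / ν) * Real.Gamma (1 / ν + 1)))) := by
  have hν := h.ν_pos
  have hν1 := h.one_lt
  set B := 2 * α * Λ / (1 - β) with hB
  have hB0 : 0 < B := h.scale_pos
  have hsq : Tendsto (fun k : ℕ => (α * lam k) ^ 2 * ((k : ℝ) + 1) ^ (2 * ν)) atTop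
      (𝓝 ((α * Λ) ^ 2)) := by
    refine (h.tendsto_scaled.pow 2).congr fun k => ?_
    have hk : (0 : ℝ) ≤ (k : ℝ) + 1 := by positivity
    rw [mul_pow, mul_comm 2 ν, Real.rpow_mul hk, Real.rpow_two]
  have ht := tendsto_tail_of_tendsto (by linarith) h.summable_sq hsq
  have e1 : (2 * ν - 1) / ν = 2 - 1 / ν := by field_simp
  have hν1' : 0 < 1 / ν := by positivity
  have hν2 : 1 / ν < 1 := by rw [div_lt_one hν]; exact hν1
  have := h.tendsto_tsum_quotient (fun k => by positivity) h.summable_sq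
    (continuous_noiseNum β (τ * γ)) hB0 hν (by linarith : 0 < 2 * ν - 1) (by rw [e1]; linarith) ht
    (by rw [hB, h.scale_eq]; exact h.tendsto_scaled)
  rw [e1, sub_sub_cancel, noiseNum_zero_one] at this
  have h1 : 0 < 1 - β := by linarith [h.lt_one]
  have h2 : 0 < 1 + β := by linarith [h.neg_one_lt]
  have eΓ : Real.Gamma (2 - 1 / ν + 1) = (2 - 1 / ν) * Real.Gamma (2 - 1 / ν) :=
    Real.Gamma_add_one (by linarith)
  have eΓ2 : Real.Gamma (1 / ν + 1) = 1 / ν * Real.Gamma (1 / ν) := Real.Gamma_add_one hν1'.ne'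
  have eB : B ^ (1 / ν) = B ^ 2 * B ^ (-(2 - 1 / ν)) := by
    rw [← Real.rpow_two, ← Real.rpow_add hB0]; congr 1; ring
  have eαΛ : α * Λ = B * ((1 - β) / 2) := h.scale_eq.symm
  have e2 : (2 - 1 / ν) = (2 * ν - 1) * (1 / ν) := by field_simp
  have h3 : 2 * ν - 1 ≠ 0 := by linarith
  convert this using 2
  · rfl
  rw [eΓ, eΓ2, eB, eαΛ]
  generalize Real.Gamma (2 - 1 / ν) = g1
  generalize Real.Gamma (1 / ν) = g2
  generalize B ^ (-(2 - 1 / ν)) = g3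
  rw [e2]
  generalize 2 * ν - 1 = q at h3 ⊢
  field_simp
  ring

theorem summable_div (h : HasPowerLaw α β γ τ Λ K ν κ lam c) (hζ : 1 < κ / ν) :
    Summable fun k => lam k * c k / (α * lam k) := by
  obtain ⟨C, hC, hCk⟩ := h.exists_scaled_ge
  have hs := summable_mul_rpow h.mul_nonneg h.summable_mul h.K_pos h.κ_pos h.ν_pos.le
    (by rwa [one_lt_div h.ν_pos] at hζ) h.tendsto_tail
  refine Summable.of_nonneg_of_le (fun k => div_nonneg (h.mul_nonneg k)
    (mul_pos h.α_pos (h.lam_pos k)).le) (fun k => ?_) (hs.mul_left C⁻¹)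
  have hk : (0 : ℝ) < (k : ℝ) + 1 := by positivity
  calc lam k * c k / (α * lam k) ≤ lam k * c k / (C * ((k : ℝ) + 1) ^ (-ν)) :=
        div_le_div_of_nonneg_left (h.mul_nonneg k) (by positivity) (hCk k)
    _ = _ := by rw [Real.rpow_neg hk.le]; field_simp

theorem exists_c_pos (h : HasPowerLaw α β γ τ Λ K ν κ lam c) : ∃ k, 0 < c k := by
  by_contra! hc
  have h0 : ∀ k, lam k * c k = 0 := fun k => by
    rw [le_antisymm (hc k) (h.c_nonneg k), mul_zero]
  have := tail_pos h.mul_nonneg h.summable_mul h.K_pos h.tendsto_tail 0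
  simp [tail, h0] at this

theorem signal_phase (h : HasPowerLaw α β γ τ Λ K ν κ lam c) (hU : noiseGen α β γ τ lam 1 < 1)
    (hζ : 1 / ν < 2 - κ / ν) :
    (fun T : ℕ => ∑ t ∈ Finset.Icc 1 T, (t : ℝ) * loss α β γ τ lam c t)
      ~[atTop] fun T : ℕ =>
        K * Real.Gamma (κ / ν + 1) / (2 * (1 - noiseGen α β γ τ lam 1) * (2 - κ / ν))
          * (2 * α * Λ / (1 - β)) ^ (-(κ / ν)) * (T : ℝ) ^ (2 - κ / ν) := by
  have hν := h.ν_pos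
  have hν1 : 0 < 1 / ν := by positivity
  have hν2 : 1 / ν < 1 := by rw [div_lt_one hν]; exact h.one_lt
  have hρ : 0 < 2 - κ / ν := by linarith
  have hζ0 : 0 < κ / ν := div_pos h.κ_pos hν
  have hG : 0 < 1 - noiseGen α β γ τ lam 1 := by linarith
  -- The scale δ^(2-ζ) is split as δ^(2-ζ-1/ν) for F times δ^(1/ν) for G'. The first exponent is
  -- positive in this phase and exceeds 1 - ζ since 1/ν < 1, so the product tends to zero.
  have hlim := ((h.tendsto_signalDeriv (by linarith)).mul (h.tendsto_noise.const_sub 1)).add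
    ((h.tendsto_signal_zero (p := 2 - κ / ν - 1 / ν) (by linarith) (by linarith)).mul
      (h.tendsto_noiseDeriv.const_mul γ))
  rw [zero_mul, add_zero] at hlim
  have hT := h.tendsto_weighted_loss hU hρ (hlim.congr' (by
    filter_upwards [self_mem_nhdsWithin] with δ hδ
    have hδ : (0 : ℝ) < δ := hδ
    have e : δ ^ (2 - κ / ν) = δ ^ (2 - κ / ν - 1 / ν) * δ ^ (1 / ν) := by
      rw [← Real.rpow_add hδ]; congr 1; ring
    rw [mul_add, e]; ring))
  have hB := h.scale_pos
  have hΓ1 : 0 < Real.Gamma (κ / ν + 1) := Real.Gamma_pos_of_pos (by linarith)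
  have hΓ2 : 0 < Real.Gamma (2 - κ / ν) := Real.Gamma_pos_of_pos hρ
  have hK := h.K_pos
  have hc : K * (2 * α * Λ / (1 - β)) ^ (-(κ / ν)) * (Real.Gamma (κ / ν + 1)
        * Real.Gamma (2 - κ / ν)) * (1 - noiseGen α β γ τ lam 1)
        / (1 - noiseGen α β γ τ lam 1) ^ 2 / Real.Gamma (2 - κ / ν + 1) / 2
      = K * Real.Gamma (κ / ν + 1) / (2 * (1 - noiseGen α β γ τ lam 1) * (2 - κ / ν))
          * (2 * α * Λ / (1 - β)) ^ (-(κ / ν)) := by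
    rw [Real.Gamma_add_one hρ.ne']
    generalize 2 * α * Λ / (1 - β) = B
    generalize noiseGen α β γ τ lam 1 = G at hG ⊢
    generalize κ / ν = ζ at *
    generalize B ^ (-ζ) = g
    field_simp
  rw [hc] at hT
  exact isEquivalent_of_tendsto_div_rpow (by positivity) hT

/-- A limit, unlike an asymptotic equivalence, remains meaningful when the constant is zero, so it
covers γ > 0 and γ = 0 at once. -/
theorem tendsto_noise_phase (h : HasPowerLaw α β γ τ Λ K ν κ lam c)
    (hU : noiseGen α β γ τ lam 1 < 1) (hζ : 2 - κ / ν < 1 / ν) :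
    Tendsto (fun T : ℕ => (∑ t ∈ Finset.Icc 1 T, (t : ℝ) * loss α β γ τ lam c t)
      / (T : ℝ) ^ (1 / ν)) atTop
      (𝓝 (γ * signalGen α β γ τ lam c 1 * Real.Gamma (2 - 1 / ν)
          / (8 * (1 - noiseGen α β γ τ lam 1) ^ 2) * (2 * α * Λ / (1 - β)) ^ (1 / ν))) := by
  have hν := h.ν_pos
  have hν1 : 0 < 1 / ν := by positivity
  have hν2 : 1 / ν < 1 := by rw [div_lt_one hν]; exact h.one_lt
  have hG : 0 < 1 - noiseGen α β γ τ lam 1 := by linarith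
  have hlim := ((h.tendsto_signalDeriv_zero hν1 hζ).mul (h.tendsto_noise.const_sub 1)).add
    ((h.tendsto_signal (h.summable_div (by linarith))).mul (h.tendsto_noiseDeriv.const_mul γ))
  rw [zero_mul, zero_add] at hlim
  have hT := h.tendsto_weighted_loss hU hν1 (hlim.congr fun δ => by ring)
  have hΓ : 0 < Real.Gamma (1 / ν + 1) := Real.Gamma_pos_of_pos (by linarith)
  convert hT using 2
  generalize (2 * α * Λ / (1 - β)) ^ (1 / ν) = B
  generalize noiseGen α β γ τ lam 1 = G at hG ⊢
  generalize Real.Gamma (1 / ν + 1) = g at hΓ ⊢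
  field_simp
  ring

theorem noise_phase (h : HasPowerLaw α β γ τ Λ K ν κ lam c) (hU : noiseGen α β γ τ lam 1 < 1)
    (hζ : 2 - κ / ν < 1 / ν) (hγ : 0 < γ) :
    (fun T : ℕ => ∑ t ∈ Finset.Icc 1 T, (t : ℝ) * loss α β γ τ lam c t)
      ~[atTop] fun T : ℕ =>
        γ * signalGen α β γ τ lam c 1 * Real.Gamma (2 - 1 / ν)
            / (8 * (1 - noiseGen α β γ τ lam 1) ^ 2)
          * (2 * α * Λ / (1 - β)) ^ (1 / ν) * (T : ℝ) ^ (1 / ν) := by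
  have hν2 : 1 / ν < 1 := by rw [div_lt_one h.ν_pos]; exact h.one_lt
  have hG : 0 < 1 - noiseGen α β γ τ lam 1 := by linarith
  -- Equivalence needs a nonzero constant; K > 0 forces some initial moment to be positive, hence
  -- Ṽ(1) > 0.
  have hS := h.signalGen_pos (h.summable_div (by linarith)) h.exists_c_pos
  have hΓ : 0 < Real.Gamma (2 - 1 / ν) := Real.Gamma_pos_of_pos (by linarith)
  have hB := h.scale_pos
  exact isEquivalent_of_tendsto_div_rpow (by positivity) (h.tendsto_noise_phase hU hζ)

theorem noiseless_phase (h : HasPowerLaw α β γ τ Λ K ν κ lam c)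
    (hU : noiseGen α β γ τ lam 1 < 1) (hζ : 2 - κ / ν < 1 / ν) (hγ : γ = 0) :
    (fun T : ℕ => ∑ t ∈ Finset.Icc 1 T, (t : ℝ) * loss α β γ τ lam c t)
      =o[atTop] fun T : ℕ => (T : ℝ) ^ (1 / ν) := by
  have hT := h.tendsto_noise_phase hU hζ
  rw [show γ * signalGen α β γ τ lam c 1 * Real.Gamma (2 - 1 / ν)
      / (8 * (1 - noiseGen α β γ τ lam 1) ^ 2) * (2 * α * Λ / (1 - β)) ^ (1 / ν) = 0 by
    rw [hγ]; ring] at hT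
  refine (isLittleO_iff_tendsto' ?_).2 hT
  filter_upwards [eventually_gt_atTop 0] with T hT0 h0
  have : (0 : ℝ) < (T : ℝ) := by exact_mod_cast hT0
  exact absurd h0 (by positivity)

end HasPowerLaw

end SESGD

theorem theorem2
    (lam c : ℕ → ℝ) (α β γ τ Λ K ν κ : ℝ)
    -- the spectrum of the Hessian and the initial second moments
    (hlam : ∀ k, 0 < lam k) (hc : ∀ k, 0 ≤ c k) (hsum : Summable fun k => lam k * c k)
    -- the parameter of the spectrally expressible approximation
    (hτ0 : 0 < τ) (hτ1 : τ ≤ 1)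
    -- the power laws; index `k` stands for the `(k+1)`-st eigenvalue
    (hΛ : 0 < Λ) (hK : 0 < K) (hν : 1 < ν) (hκ : 0 < κ)
    (hpow : lam ~[atTop] fun k : ℕ => Λ * ((k : ℝ) + 1) ^ (-ν))
    (htail : (fun k : ℕ => ∑' l, lam (k + l) * c (k + l))
      ~[atTop] fun k : ℕ => K * ((k : ℝ) + 1) ^ (-κ))
    -- admissible parameters of SGD, and stability
    (hβ0 : -1 < β) (hβ1 : β < 1) (hα0 : 0 < α) (hα1 : α < 2 * (β + 1) / ⨆ k, lam k)
    (hγ0 : 0 ≤ γ) (hγ1 : γ ≤ 1)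
    (hU : SESGD.noiseGen α β γ τ lam 1 < 1) :
    -- the signal-dominated phase
    (1 / ν < 2 - κ / ν →
      (fun T : ℕ => ∑ t ∈ Finset.Icc 1 T, (t : ℝ) * SESGD.loss α β γ τ lam c t)
        ~[atTop] fun T : ℕ =>
          K * Real.Gamma (κ / ν + 1)
              / (2 * (1 - SESGD.noiseGen α β γ τ lam 1) * (2 - κ / ν))
            * (2 * α * Λ / (1 - β)) ^ (-(κ / ν)) * (T : ℝ) ^ (2 - κ / ν))
    ∧
    -- the noise-dominated phase; without noise, the constant is zero
    (2 - κ / ν < 1 / ν →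
      (0 < γ →
        (fun T : ℕ => ∑ t ∈ Finset.Icc 1 T, (t : ℝ) * SESGD.loss α β γ τ lam c t)
          ~[atTop] fun T : ℕ =>
            γ * SESGD.signalGen α β γ τ lam c 1 * Real.Gamma (2 - 1 / ν)
                / (8 * (1 - SESGD.noiseGen α β γ τ lam 1) ^ 2)
              * (2 * α * Λ / (1 - β)) ^ (1 / ν) * (T : ℝ) ^ (1 / ν))
      ∧ (γ = 0 →
        (fun T : ℕ => ∑ t ∈ Finset.Icc 1 T, (t : ℝ) * SESGD.loss α β γ τ lam c t)
          =o[atTop] fun T : ℕ => (T : ℝ) ^ (1 / ν))) := by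
  have hlim := SESGD.tendsto_mul_of_isEquivalent hΛ.ne' hpow
  have hs := SESGD.summable_of_tendsto_mul_rpow hν hlam hlim
  have h : SESGD.HasPowerLaw α β γ τ Λ K ν κ lam c :=
    { lam_pos := hlam
      c_nonneg := hc
      summable_lam := hs
      summable_mul := hsum
      τ_nonneg := hτ0.le
      τ_le := hτ1
      γ_nonneg := hγ0
      α_pos := hα0
      neg_one_lt := hβ0
      lt_one := hβ1
      exists_lt := by
        -- Boundedness makes the supremum genuine rather than a default value; α times it then
        -- serves as the uniform gap constant.
        have hbdd : BddAbove (Set.range lam) := hs.tendsto_atTop_zero.bddAbove_range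
        have hsup : 0 < ⨆ k, lam k := (hlam 0).trans_le (le_ciSup hbdd 0)
        refine ⟨α * ⨆ k, lam k, ?_, fun k =>
          mul_le_mul_of_nonneg_left (le_ciSup hbdd k) hα0.le⟩
        rw [lt_div_iff₀ hsup] at hα1
        linarith
      Λ_pos := hΛ
      K_pos := hK
      one_lt := hν
      κ_pos := hκ
      tendsto_lam := hlim
      tendsto_tail := SESGD.tendsto_mul_of_isEquivalent hK.ne' htail }
  exact ⟨h.signal_phase hU, fun hζ => ⟨h.noise_phase hU hζ, h.noiseless_phase hU hζ⟩⟩
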